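/- Let $S$ be a simply connected Riemann surface (so, up to isomorphism, the unit disk, the complex plane or the Riemann sphere), and let $f:S\to S$ be a holomorphic branched covering of finite degree $d>1$, that is, a proper holomorphic map which, over the complement of some finite set, is a covering with $d$-point fibres. Let $S_\infty$ be the plaque inverse limit of $S\xleftarrow{f}S\xleftarrow{f}S\leftarrow\cdots$: its points are the sequences $x=(x_1,x_2,\dots)$ in $S$ with $f(x_{n+1})=x_n$ for all $n$, and a local basis of its topology at $x$ is given by the pull-backs along $x$ of open sets $A\ni x_1$, i.e. the sets $\{y\in S_\infty : y_n\in A_n \text{ for all } n\}$, where $A_1$ is the connected component of $A$ containing $x_1$ and $A_{n+1}$ is the connected component of $f^{-1}(A_n)$ containing $x_{n+1}$. For $U\subset S_\infty$ write $U_n=\{y_n : y\in U\}$. A *plaque* is a set $\{y\in S_\infty : y_n\in U_n\text{ for all }n\}$, where every $U_n\subset S$ is conformally equivalent to the open unit disk and $U_{n+1}$ is a connected component of $f^{-1}(U_n)$ for every $n$. A point $x\in S_\infty$ is *regular* if it has an open neighborhood $U$ such that, for all sufficiently large $n$, $U_n$ contains no critical point of $f$; otherwise $x$ is *irregular*. Let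 $I$ be the set of binary sequences modulo changing finitely many entries, with the coordinatewise order, and let $\alpha(a)=\{b\in I: b\le a\}$ for $a\in I$. For an open set $U\subset S_\infty$ and a critical point $c$ of $f$, let $\mathrm{ind}(U,c)\in I$ be the class of the sequence whose $n$-th entry is $1$ if and only if $c\in U_n$. The signature of $x$ with respect to $c$ is $\mathrm{sign}(x,c)=\bigcap_U\alpha(\mathrm{ind}(U,c))\subset I$, the intersection being over all open neighborhoods $U$ of $x$ (equivalently, over any sequence of open neighborhoods shrinking to $x$). It *has a maximal element* if $\mathrm{sign}(x,c)=\alpha(a)$ for some $a\in I$. **Theorem.** Let $x\in S_\infty$ be an irregular point that is contained in some plaque, and suppose that $\mathrm{sign}(x,c)$ has a maximal element for every critical point $c$ of $f$. Then there is an open neighborhood $U$ of $x$, which is a plaque, such that for every open neighborhood $V\subset U$ of $x$ which is a plaque or is connected, and for every point $v\in V$ with $v\neq x$, the set $V\setminus\{v\}$ is path-connected. -/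

import Mathlib

open scoped Manifold ContDiff

/-- A holomorphic branched covering `f : S → S` of degree `d`: a proper holomorphic map which,
over the complement of some finite set, is a covering map all of whose fibres have `d` points. -/
structure IsBranchedSelfCovering {S : Type*} [TopologicalSpace S] [ChartedSpace ℂ S]
    (f : S → S) (d : ℕ) : Prop where
  holomorphic : MDifferentiable 𝓘(ℂ) 𝓘(ℂ) f
  proper : IsProperMap f
  generic_fibre : ∃ B : Set S, B.Finite ∧ IsCoveringMapOn f Bᶜ ∧
    ∀ y ∈ Bᶜ, (f ⁻¹' {y}).ncard = d

/-- Critical points of a holomorphic self-map of a Riemann surface. -/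
def IsCriticalPoint {S : Type*} [TopologicalSpace S] [ChartedSpace ℂ S]
    (f : S → S) (c : S) : Prop :=
  mfderiv 𝓘(ℂ) 𝓘(ℂ) f c = 0

/-- `U` is (open and) conformally equivalent to the open unit disk: it is the image of the unit
disk under an injective holomorphic map. -/
def IsConformalDisk {S : Type*} [TopologicalSpace S] [ChartedSpace ℂ S] (U : Set S) : Prop :=
  ∃ g : ℂ → S, MDifferentiableOn 𝓘(ℂ) 𝓘(ℂ) g (Metric.ball 0 1) ∧
    Set.InjOn g (Metric.ball 0 1) ∧ g '' Metric.ball 0 1 = U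

/-- The underlying set of the plaque inverse limit of `S ← S ← S ← ⋯` (all maps equal to `f`):
the backward orbits of `f`. The levels are numbered `0, 1, 2, …`. -/
@[ext]
structure PlaqueInverseLimit {S : Type*} (f : S → S) where
  coord : ℕ → S
  map_coord : ∀ n, f (coord (n + 1)) = coord n

namespace PlaqueInverseLimit

/-- The set of points of the inverse limit given by a sequence `U` of subsets of the levels. -/
def box {S : Type*} (f : S → S) (U : ℕ → Set S) : Set (PlaqueInverseLimit f) :=
  {y | ∀ n, y.coord n ∈ U n}

/-- The `n`-th level `p_n(U)` of a set `U` of points of the inverse limit. -/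
def level {S : Type*} {f : S → S} (U : Set (PlaqueInverseLimit f)) (n : ℕ) : Set S :=
  (fun y : PlaqueInverseLimit f => y.coord n) '' U

/-- The levels of the pull-back of `A` along `x`: start with the component of `A` containing the
first coordinate of `x`, and at each step take the component of the preimage under `f` that
contains the next coordinate of `x`. -/
def pullbackLevel {S : Type*} [TopologicalSpace S] {f : S → S} (x : PlaqueInverseLimit f)
    (A : Set S) : ℕ → Set S
  | 0 => connectedComponentIn A (x.coord 0)
  | n + 1 => connectedComponentIn (f ⁻¹' pullbackLevel x A n) (x.coord (n + 1))

/-- The pull-back of `A` along `x`. -/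
def pullback {S : Type*} [TopologicalSpace S] {f : S → S} (x : PlaqueInverseLimit f)
    (A : Set S) : Set (PlaqueInverseLimit f) :=
  box f (pullbackLevel x A)

theorem coord_mem_pullbackLevel {S : Type*} [TopologicalSpace S] {f : S → S}
    (x : PlaqueInverseLimit f) {A : Set S} (hA : x.coord 0 ∈ A) (n : ℕ) :
    x.coord n ∈ pullbackLevel x A n := by
  induction n with
  | zero => exact mem_connectedComponentIn hA
  | succ n ih =>
    refine mem_connectedComponentIn ?_
    rw [Set.mem_preimage, x.map_coord]
    exact ih

theorem pullbackLevel_mono {S : Type*} [TopologicalSpace S] {f : S → S}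
    (x : PlaqueInverseLimit f) {A B : Set S} (h : A ⊆ B) (n : ℕ) :
    pullbackLevel x A n ⊆ pullbackLevel x B n := by
  induction n with
  | zero => exact connectedComponentIn_mono _ h
  | succ n ih => exact connectedComponentIn_mono _ (Set.preimage_mono ih)

/-- The plaque topology: the pull-backs along `x` of the open neighbourhoods of the first
coordinate of `x` form a local basis at `x`. -/
instance instTopologicalSpace {S : Type*} [TopologicalSpace S] (f : S → S) :
    TopologicalSpace (PlaqueInverseLimit f) where
  IsOpen U := ∀ x ∈ U, ∃ A : Set S, IsOpen A ∧ x.coord 0 ∈ A ∧ pullback x A ⊆ U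
  isOpen_univ := fun _ _ => ⟨Set.univ, isOpen_univ, Set.mem_univ _, Set.subset_univ _⟩
  isOpen_inter := by
    intro U V hU hV x hx
    obtain ⟨A, hA, hxA, hAU⟩ := hU x hx.1
    obtain ⟨B, hB, hxB, hBV⟩ := hV x hx.2
    refine ⟨A ∩ B, hA.inter hB, ⟨hxA, hxB⟩, fun y hy => ⟨hAU fun n => ?_, hBV fun n => ?_⟩⟩
    · exact pullbackLevel_mono x Set.inter_subset_left n (hy n)
    · exact pullbackLevel_mono x Set.inter_subset_right n (hy n)
  isOpen_sUnion := by
    intro s hs x hx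
    obtain ⟨U, hU, hxU⟩ := hx
    obtain ⟨A, hA, hxA, hAU⟩ := hs U hU x hxU
    exact ⟨A, hA, hxA, hAU.trans (Set.subset_sUnion_of_mem hU)⟩

theorem isOpen_pullback {S : Type*} [TopologicalSpace S] {f : S → S}
    (x : PlaqueInverseLimit f) {A : Set S} (hA : IsOpen A) : IsOpen (pullback x A) := by
  intro y hy
  have h0 : y.coord 0 ∈ connectedComponentIn A (x.coord 0) := hy 0
  refine ⟨A, hA, connectedComponentIn_subset _ _ h0, ?_⟩
  have key : ∀ n, pullbackLevel y A n = pullbackLevel x A n := by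
    intro n
    induction n with
    | zero => exact (connectedComponentIn_eq h0).symm
    | succ n ih =>
      have h1 : y.coord (n + 1) ∈ connectedComponentIn (f ⁻¹' pullbackLevel x A n)
        (x.coord (n + 1)) := hy (n + 1)
      change connectedComponentIn (f ⁻¹' pullbackLevel y A n) (y.coord (n + 1)) = _
      rw [ih]
      exact (connectedComponentIn_eq h1).symm
  intro z hz n
  rw [← key n]
  exact hz n

/-- A plaque: a set given by a sequence of conformal disks `U 0, U 1, …` such that each `U (n+1)`
is a connected component of `f ⁻¹ (U n)`. -/
def IsPlaque {S : Type*} [TopologicalSpace S] [ChartedSpace ℂ S] (f : S → S)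
    (P : Set (PlaqueInverseLimit f)) : Prop :=
  ∃ U : ℕ → Set S, (∀ n, IsConformalDisk (U n)) ∧
    (∀ n, ∃ s ∈ f ⁻¹' U n, U (n + 1) = connectedComponentIn (f ⁻¹' U n) s) ∧
    P = box f U

/-- Regular points: some open neighbourhood has no critical points at all sufficiently high
levels. -/
def IsRegularPoint {S : Type*} [TopologicalSpace S] [ChartedSpace ℂ S] {f : S → S}
    (x : PlaqueInverseLimit f) : Prop :=
  ∃ U : Set (PlaqueInverseLimit f), IsOpen U ∧ x ∈ U ∧
    ∃ N : ℕ, ∀ n ≥ N, ∀ c ∈ level U n, ¬ IsCriticalPoint f c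

/-- Irregular points. -/
def IsIrregularPoint {S : Type*} [TopologicalSpace S] [ChartedSpace ℂ S] {f : S → S}
    (x : PlaqueInverseLimit f) : Prop :=
  ¬ IsRegularPoint x

end PlaqueInverseLimit

/-- Binary sequences (a binary sequence being a sequence of truth values) modulo almost equality,
i.e. modulo differing in only finitely many places, with the coordinatewise order. -/
abbrev AlmostBinarySeq : Type := Filter.Germ (Filter.cofinite : Filter ℕ) Prop

namespace PlaqueInverseLimit

/-- The index `ind(U, c)`: the class of the sequence that is true in place `n` iff `c` lies in the
`n`-th level of `U`. -/
def index {S : Type*} {f : S → S} (U : Set (PlaqueInverseLimit f)) (c : S) : AlmostBinarySeq :=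
  ((fun n : ℕ => c ∈ level U n) : ℕ → Prop)

theorem index_mono {S : Type*} {f : S → S} {U V : Set (PlaqueInverseLimit f)} (h : U ⊆ V)
    (c : S) : index U c ≤ index V c :=
  Filter.Germ.coe_le.mpr (Filter.Eventually.of_forall fun _ hn => Set.image_mono h hn)

/-- The signature `sign(x, c)`: the intersection, over the open neighbourhoods `U` of `x`, of the
sets `α(ind(U, c)) = {b | b ≤ ind(U, c)}`. -/
def signature {S : Type*} [TopologicalSpace S] {f : S → S} (x : PlaqueInverseLimit f) (c : S) :
    Set AlmostBinarySeq :=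
  ⋂ (U : Set (PlaqueInverseLimit f)) (_ : IsOpen U ∧ x ∈ U), Set.Iic (index U c)

/-- The signature can be computed along any sequence of open neighbourhoods shrinking to `x`. -/
theorem signature_eq_iInter_of_shrinking {S : Type*} [TopologicalSpace S] {f : S → S}
    (x : PlaqueInverseLimit f) (c : S) (U : ℕ → Set (PlaqueInverseLimit f))
    (hU : ∀ j, IsOpen (U j) ∧ x ∈ U j)
    (hshrink : ∀ V : Set (PlaqueInverseLimit f), IsOpen V → x ∈ V → ∃ j, U j ⊆ V) :
    signature x c = ⋂ j, Set.Iic (index (U j) c) := by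
  apply Set.Subset.antisymm
  · exact Set.subset_iInter fun j => Set.iInter₂_subset (U j) (hU j)
  · refine Set.subset_iInter₂ fun V hV => ?_
    obtain ⟨j, hj⟩ := hshrink V hV.1 hV.2
    exact (Set.iInter_subset _ j).trans (Set.Iic_subset_Iic.mpr (index_mono hj c))

/-- `sign(x, c)` has a maximal element: it equals `α(a)` for some class `a`. -/
def SignatureHasMax {S : Type*} [TopologicalSpace S] {f : S → S} (x : PlaqueInverseLimit f)
    (c : S) : Prop :=
  ∃ a : AlmostBinarySeq, signature x c = Set.Iic a

end PlaqueInverseLimit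

/-! Take round disks shrinking to the first coordinate of `x` in a parametrization of the first
level of the given plaque, and let P_k be their pull-backs along `x`. Every level of P_k is a
conformal disk (`IsBranchedSelfCovering.isConformalDisk_pullbackLevel`): seen in the unit disk, it
is a component of a sublevel set of the modulus of a holomorphic function. By the maximum principle
such a component has a compact exhaustion without bounded complementary components. This suffices
for polynomial approximation, hence for square roots, hence for the extremal proof of the Riemann
mapping theorem.

There are finitely many critical points, so a diagonal argument turns maximality of the signatures
into a uniform statement (`IsBranchedSelfCovering.exists_forall_criticalPoint_mem`): for some K and
every k, all critical points in sufficiently high levels of P_K already lie in the same levels of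
P_k. The neighborhood sought is P_K. Two facts about it carry the theorem.

Away from `x` it is a surface. A point z ≠ `x` of P_K leaves the closure of some P_k at all high
levels. A small disk around such a coordinate of z misses P_k, so its pull-backs contain no critical
points, `f` is injective on them, and z has a disk neighborhood
(`IsBranchedSelfCovering.exists_disk_nhds`).

Near `x` everything can be joined to `x`. By a Riemann–Hurwitz count, a disk component of a preimage
that contains all critical points of a larger one is the full preimage inside the larger one
(`IsBranchedSelfCovering.inter_preimage_subset`). So whether a point of P_K lies in a smaller P_k is
decided at a single high level N. If a path component of a punctured pull-back A along `x` avoided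
P_k, its projection to level N would be open and relatively closed in the level of A, hence would
contain the coordinate of `x`, which is absurd (`IsBranchedSelfCovering.exists_joinedIn`).
Concatenating paths into smaller and smaller neighborhoods gives a path that ends at `x`
(`joinedIn_of_antitone_basis`).

Hence small pull-backs along `x` are path-connected. Deleting v ≠ `x` removes the center of a disk
from a connected set, which leaves it connected; being open and locally path-connected, the rest is
path-connected.

The Riemann–Hurwitz count is explicit: a proper holomorphic self-map of the disk is a finite
Blaschke product, and the numerator of its derivative is a self-reciprocal polynomial without zeros
on the circle, so half of its zeros, counted with those at infinity, lie inside
(`IsDiskProper.exists_degree`). -/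

open Filter Topology Metric Set Polynomial ComplexConjugate

/-! ### Injective holomorphic functions, Montel and Hurwitz -/

/-- An analytic function that is injective near a point has nonzero derivative there. -/
theorem AnalyticAt.deriv_ne_zero_of_injOn {f : ℂ → ℂ} {z₀ : ℂ} {s : Set ℂ}
    (hf : AnalyticAt ℂ f z₀) (hs : s ∈ 𝓝 z₀) (hinj : InjOn f s) : deriv f z₀ ≠ 0 := by
  intro h0
  have hF : AnalyticAt ℂ (fun z => f z - f z₀) z₀ := hf.sub analyticAt_const
  have hne : ∀ᶠ z in 𝓝[≠] z₀, f z - f z₀ ≠ 0 := by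
    filter_upwards [mem_nhdsWithin_of_mem_nhds hs, self_mem_nhdsWithin] with z hz hz' h
    exact hz' (hinj hz (mem_of_mem_nhds hs) (sub_eq_zero.mp h))
  obtain ⟨n, g, hg, hg0, hfg⟩ := hF.exists_eventuallyEq_pow_smul_nonzero_iff.mpr fun h =>
    (hne.and (h.filter_mono nhdsWithin_le_nhds)).exists.elim fun z hz => hz.1 hz.2
  have hn : 2 ≤ n := by
    rcases n with _ | _ | n
    · exact absurd (by simpa using hfg.self_of_nhds.symm) hg0
    · have h1 : HasDerivAt (fun z => (z - z₀) ^ (0 + 1) • g z) (g z₀) z₀ := by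
        have := ((hasDerivAt_id z₀).sub_const z₀).fun_mul hg.differentiableAt.hasDerivAt
        simpa using this
      have h2 : HasDerivAt (fun z => f z - f z₀) (g z₀) z₀ := h1.congr_of_eventuallyEq hfg
      have h3 := h2.deriv
      rw [deriv_sub_const, h0] at h3
      exact absurd h3.symm hg0
    · omega
  have hn0 : (n : ℂ) ≠ 0 := by exact_mod_cast (by omega : n ≠ 0)
  -- `u` is an `n`-th root of `(f - f z₀) / g z₀`, hence a local coordinate in which `f - f z₀` is a
  -- multiple of the `n`-th power. Points with coordinates `t` and `ζ * t` then have the same image.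
  set u : ℂ → ℂ := fun z => (z - z₀) * Complex.exp (Complex.log (g z / g z₀) / n) with hu
  have hga : AnalyticAt ℂ (fun z => Complex.exp (Complex.log (g z / g z₀) / n)) z₀ := by
    refine AnalyticAt.cexp (AnalyticAt.div (AnalyticAt.clog (hg.div analyticAt_const hg0) ?_)
      analyticAt_const hn0)
    simp [hg0]
  have hud : HasStrictDerivAt u 1 z₀ := by
    have hua : AnalyticAt ℂ u z₀ := (analyticAt_id.sub analyticAt_const).mul hga
    have h1 : HasDerivAt u 1 z₀ := by
      have := ((hasDerivAt_id z₀).sub_const z₀).fun_mul hga.differentiableAt.hasDerivAt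
      simpa [hg0] using this
    simpa [h1.deriv] using hua.hasStrictDerivAt
  have hmap := hud.map_nhds_eq one_ne_zero
  have hu0 : u z₀ = 0 := by simp [hu]
  rw [hu0] at hmap
  have hgne : ∀ᶠ z in 𝓝 z₀, g z ≠ 0 := hg.continuousAt.eventually_ne hg0
  have hset : s ∩ {z | f z - f z₀ = (z - z₀) ^ n • g z ∧ g z ≠ 0} ∈ 𝓝 z₀ :=
    inter_mem hs (hfg.and hgne)
  have himg := image_mem_map (m := u) hset
  rw [hmap] at himg
  set ζ : ℂ := Complex.exp (2 * Real.pi * Complex.I / n)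
  have hζ : IsPrimitiveRoot ζ n := Complex.isPrimitiveRoot_exp n (by omega)
  have hcont : Tendsto (fun t : ℂ => ζ * t) (𝓝[≠] 0) (𝓝 0) := by
    have : Continuous fun t : ℂ => ζ * t := by fun_prop
    simpa using (this.tendsto 0).mono_left nhdsWithin_le_nhds
  have hmem0 : ∀ᶠ t in 𝓝[≠] (0 : ℂ), t ≠ 0 := self_mem_nhdsWithin
  have himg' : ∀ᶠ t in 𝓝 (0 : ℂ),
      t ∈ u '' (s ∩ {z | f z - f z₀ = (z - z₀) ^ n • g z ∧ g z ≠ 0}) := himg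
  obtain ⟨t, ht1, ht2, ht0⟩ := ((himg'.filter_mono nhdsWithin_le_nhds).and
    ((hcont.eventually himg').and hmem0)).exists
  obtain ⟨z₁, ⟨hz₁, hf₁, hg₁⟩, rfl⟩ := ht1
  obtain ⟨z₂, ⟨hz₂, hf₂, hg₂⟩, h₂⟩ := ht2
  have hpow : ∀ z, g z ≠ 0 → (z - z₀) ^ n * g z = u z ^ n * g z₀ := by
    intro z hz
    simp only [hu, mul_pow, ← Complex.exp_nat_mul]
    rw [mul_div_cancel₀ _ hn0, Complex.exp_log (div_ne_zero hz hg0)]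
    field_simp
  have : f z₁ = f z₂ := by
    have e : f z₁ - f z₀ = f z₂ - f z₀ := by
      rw [hf₁, hf₂, smul_eq_mul, smul_eq_mul, hpow _ hg₁, hpow _ hg₂, h₂, mul_pow ζ, hζ.pow_eq_one,
        one_mul]
    linear_combination e
  have e := hinj hz₁ hz₂ this
  rw [← e] at h₂
  have : ζ = 1 := by
    have h3 : (ζ - 1) * u z₁ = 0 := by linear_combination -h₂
    exact sub_eq_zero.mp ((mul_eq_zero.mp h3).resolve_right ht0)
  exact hζ.ne_one (by omega) this

/-- Montel's theorem for functions bounded by one, along an ultrafilter. -/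
theorem exists_tendstoLocallyUniformlyOn_of_norm_le_one {V : Set ℂ} (hV : IsOpen V)
    {ι : Type*} (l : Ultrafilter ι) {ψ : ι → ℂ → ℂ} (hd : ∀ n, DifferentiableOn ℂ (ψ n) V)
    (hb : ∀ n, ∀ z ∈ V, ‖ψ n z‖ ≤ 1) :
    ∃ φ : ℂ → ℂ, TendstoLocallyUniformlyOn ψ φ l V := by
  have hlim : ∀ z, ∃ w, z ∈ V → Tendsto (fun n => ψ n z) l (𝓝 w) := by
    intro z
    by_cases hz : z ∈ V
    · obtain ⟨w, -, hw⟩ := (isCompact_closedBall (0 : ℂ) 1).ultrafilter_le_nhds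
        (l.map fun n => ψ n z) (by
          rw [le_principal_iff]
          exact Filter.mem_map.mpr (Filter.Eventually.of_forall fun n => by simpa using hb n z hz))
      exact ⟨w, fun _ => hw⟩
    · exact ⟨0, fun h => absurd h hz⟩
  choose φ hφ using hlim
  refine ⟨φ, Metric.tendstoLocallyUniformlyOn_iff.mpr fun ε hε z₀ hz₀ => ?_⟩
  obtain ⟨r, hr, hrV⟩ := Metric.isOpen_iff.mp hV z₀ hz₀
  -- Values in the unit disk differ by at most 2, so the Schwarz lemma gives a Lipschitz bound
  -- independent of `n`; 3 leaves some room.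
  have hlip : ∀ n, ∀ z ∈ ball z₀ r, dist (ψ n z) (ψ n z₀) ≤ 3 / r * dist z z₀ := by
    intro n z hz
    refine Complex.dist_le_div_mul_dist_of_mapsTo_ball ((hd n).mono hrV) (fun w hw => ?_) hz
    have h1 := hb n w (hrV hw)
    have h2 := hb n z₀ hz₀
    rw [mem_closedBall, dist_eq_norm]
    linarith [norm_sub_le (ψ n w) (ψ n z₀)]
  have hlip' : ∀ z ∈ ball z₀ r, dist (φ z) (φ z₀) ≤ 3 / r * dist z z₀ := fun z hz =>
    le_of_tendsto ((hφ z (hrV hz)).dist (hφ z₀ hz₀)) (Eventually.of_forall fun n => hlip n z hz)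
  have hδ : 0 < min r (r * ε / 9) := by positivity
  refine ⟨ball z₀ (min r (r * ε / 9)), mem_nhdsWithin_of_mem_nhds (ball_mem_nhds _ hδ), ?_⟩
  have hev : ∀ᶠ n in (l : Filter ι), dist (ψ n z₀) (φ z₀) < ε / 3 :=
    (Metric.tendsto_nhds.mp (hφ z₀ hz₀)) _ (by positivity)
  filter_upwards [hev] with n hn z hz
  have hz1 : z ∈ ball z₀ r := ball_subset_ball (min_le_left _ _) hz
  have hz2 : dist z z₀ < r * ε / 9 := lt_of_lt_of_le hz (min_le_right _ _)
  have hb3 : 3 / r * dist z z₀ < ε / 3 := by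
    calc 3 / r * dist z z₀ < 3 / r * (r * ε / 9) := by gcongr
      _ = ε / 3 := by field_simp; norm_num
  have a1 := hlip n z hz1
  have a2 := hlip' z hz1
  have t1 := dist_triangle (φ z) (φ z₀) (ψ n z)
  have t2 := dist_triangle (φ z₀) (ψ n z₀) (ψ n z)
  rw [dist_comm (φ z₀) (ψ n z₀), dist_comm (ψ n z₀) (ψ n z)] at t2
  linarith

/-- Local form of Hurwitz' theorem for injective functions. -/
theorem eventually_mem_image_closedBall {V : Set ℂ} (hV : IsOpen V)
    {ι : Type*} {l : Filter ι} {ψ : ι → ℂ → ℂ} {φ : ℂ → ℂ}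
    (hd : ∀ n, DifferentiableOn ℂ (ψ n) V) (hinj : ∀ n, InjOn (ψ n) V)
    (hlim : TendstoLocallyUniformlyOn ψ φ l V) (hφ : ContinuousOn φ V) {a : ℂ} {r : ℝ} (hr : 0 < r)
    (haV : closedBall a r ⊆ V) (hne : ∀ z ∈ sphere a r, φ z ≠ φ a) :
    ∀ᶠ n in l, φ a ∈ ψ n '' closedBall a r := by
  have hcomp : IsCompact (sphere a r) := isCompact_sphere a r
  have hsub : sphere a r ⊆ V := sphere_subset_closedBall.trans haV
  have haa : a ∈ V := haV (mem_closedBall_self hr.le)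
  obtain ⟨z₁, hz₁, hmin⟩ := hcomp.exists_isMinOn (NormedSpace.sphere_nonempty.mpr hr.le)
    (f := fun z => ‖φ z - φ a‖) (((hφ.mono hsub).sub continuousOn_const).norm)
  set δ := ‖φ z₁ - φ a‖ with hδ
  have hδ0 : 0 < δ := norm_pos_iff.mpr (sub_ne_zero.mpr (hne z₁ hz₁))
  have hunif : TendstoUniformlyOn ψ φ l (closedBall a r) :=
    (tendstoLocallyUniformlyOn_iff_forall_isCompact hV).mp hlim _ haV (isCompact_closedBall a r)
  filter_upwards [Metric.tendstoUniformlyOn_iff.mp hunif (δ / 8) (by positivity)] with n hn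
  have hna := hn a (mem_closedBall_self hr.le)
  have hcl : DiffContOnCl ℂ (ψ n) (ball a r) :=
    ((hd n).mono (by rwa [closure_ball _ hr.ne'])).diffContOnCl
  -- Quantitative open mapping: on the circle `ψ n` stays at distance at least `δ / 2` from `ψ n a`,
  -- so its image contains the ball of radius `δ / 4` around `ψ n a`, and `φ a` is within `δ / 8`.
  have key := hcl.ball_subset_image_closedBall (ε := δ / 2) hr (fun z hz => ?_) ?_
  · refine key ?_
    rw [mem_ball]
    linarith
  · have h1 : δ ≤ dist (φ z) (φ a) := by rw [dist_eq_norm]; exact hmin hz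
    have h2 := hn z (sphere_subset_closedBall hz)
    have t := dist_triangle4 (φ z) (ψ n z) (ψ n a) (φ a)
    rw [dist_comm (ψ n a) (φ a)] at t
    rw [← dist_eq_norm]
    linarith
  · refine Eventually.frequently (f := 𝓝[≠] a) ?_ |>.filter_mono nhdsWithin_le_nhds
    filter_upwards [mem_nhdsWithin_of_mem_nhds (hV.mem_nhds haa), self_mem_nhdsWithin] with z hz hza
      h
    exact hza (hinj n hz haa h)

/-- Hurwitz' theorem: a nonconstant locally uniform limit of injective holomorphic functions is
injective. -/
theorem injOn_of_tendstoLocallyUniformlyOn {V : Set ℂ} (hV : IsOpen V) (hVc : IsPreconnected V)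
    {ι : Type*} {l : Filter ι} [l.NeBot] {ψ : ι → ℂ → ℂ} {φ : ℂ → ℂ}
    (hd : ∀ n, DifferentiableOn ℂ (ψ n) V) (hinj : ∀ n, InjOn (ψ n) V)
    (hlim : TendstoLocallyUniformlyOn ψ φ l V) {p : ℂ} (hp : p ∈ V) (hφp : deriv φ p ≠ 0) :
    InjOn φ V := by
  have hφd : DifferentiableOn ℂ φ V := hlim.differentiableOn (Eventually.of_forall hd) hV
  have hφa : AnalyticOnNhd ℂ φ V := hφd.analyticOnNhd hV
  have hiso : ∀ a ∈ V, ∀ᶠ z in 𝓝[≠] a, φ z ≠ φ a := by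
    intro a ha
    refine ((hφa a ha).eventually_eq_or_eventually_ne analyticAt_const).resolve_left fun h => ?_
    have := hφa.eqOn_of_preconnected_of_eventuallyEq (g := fun _ => φ a)
      (fun _ _ => analyticAt_const) hVc ha h
    apply hφp
    rw [(this.eventuallyEq_of_mem (hV.mem_nhds hp)).deriv_eq]
    simp
  have hball : ∀ a ∈ V, ∀ ρ > 0, ∃ r, 0 < r ∧ r < ρ ∧ closedBall a r ⊆ V ∧
      ∀ z ∈ sphere a r, φ z ≠ φ a := by
    intro a ha ρ hρ
    obtain ⟨r, hr, hrs⟩ := Metric.mem_nhds_iff.mp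
      (inter_mem (hV.mem_nhds ha) (mem_nhdsWithin_iff_eventually.mp (hiso a ha)))
    refine ⟨min r ρ / 2, by positivity, ?_, ?_, ?_⟩
    · have := min_le_right r ρ
      have : 0 < min r ρ := by positivity
      linarith
    · refine fun z hz => (hrs (lt_of_le_of_lt (mem_closedBall.mp hz) ?_ : z ∈ ball a r)).1
      have := min_le_left r ρ
      have : 0 < min r ρ := by positivity
      linarith
    · intro z hz
      have h0 : 0 < min r ρ := by positivity
      have h1 := min_le_left r ρ
      refine (hrs (?_ : z ∈ ball a r)).2 ?_
      · rw [mem_ball, mem_sphere.mp hz]; linarith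
      · rintro rfl
        simp only [mem_sphere, dist_self] at hz
        linarith
  intro a ha b hb hab
  by_contra hne
  have hdist : 0 < dist a b / 2 := by have := dist_pos.mpr hne; positivity
  obtain ⟨r, hr, hr', hrV, hrs⟩ := hball a ha _ hdist
  obtain ⟨t, ht, ht', htV, hts⟩ := hball b hb _ hdist
  obtain ⟨n, ⟨z, hz, hz'⟩, ⟨w, hw, hw'⟩⟩ :=
    ((eventually_mem_image_closedBall hV hd hinj hlim hφd.continuousOn hr hrV hrs).and
    (eventually_mem_image_closedBall hV hd hinj hlim hφd.continuousOn ht htV hts)).exists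
  have hzw : z = w := hinj n (hrV hz) (htV hw) (by rw [hz', hw', hab])
  subst hzw
  rw [mem_closedBall] at hz hw
  have := dist_triangle_left a b z
  linarith

/-! ### Approximation by polynomials: inverses, primitives, square roots -/

/-- The uniform closure of the polynomial functions on a set of complex numbers. -/
noncomputable abbrev polyAlgebra (K : Set ℂ) [CompactSpace K] : Subalgebra ℂ C(K, ℂ) :=
  (polynomialFunctions K).topologicalClosure

/-- On a compact set whose complement has no bounded component, a uniform limit of polynomials
without zeros is invertible in the algebra of such limits. -/
theorem exists_mul_eq_one_of_mem_polyAlgebra {K : Set ℂ} [CompactSpace K]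
    (hKc : ∀ z ∉ K, ¬ Bornology.IsBounded (connectedComponentIn Kᶜ z)) {F : C(K, ℂ)}
    (hF : F ∈ polyAlgebra K) (h0 : ∀ z, F z ≠ 0) : ∃ G ∈ polyAlgebra K, G * F = 1 := by
  have hcl : IsClosed ((polyAlgebra K : Subalgebra ℂ C(K, ℂ)) : Set C(K, ℂ)) :=
    Subalgebra.isClosed_topologicalClosure _
  have : CompleteSpace (polyAlgebra K) := hcl.completeSpace_coe
  have hpoly : ∀ p : ℂ[X], p.toContinuousMapOn K ∈ polyAlgebra K := fun p =>
    Subalgebra.le_topologicalClosure _ ⟨p, trivial, rfl⟩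
  suffices hu : IsUnit (⟨F, hF⟩ : polyAlgebra K) by
    obtain ⟨G, hG⟩ := hu.exists_left_inv
    exact ⟨G, G.2, congrArg Subtype.val hG⟩
  by_contra hnu
  obtain ⟨χ, hχ⟩ := WeakDual.CharacterSpace.exists_apply_eq_zero hnu
  set x : polyAlgebra K := ⟨X.toContinuousMapOn K, hpoly X⟩ with hx
  have hspec : spectrum ℂ (x : C(K, ℂ)) = K := by
    rw [ContinuousMap.spectrum_eq_range]
    ext z
    simp [hx]
  -- Passing from `C(K, ℂ)` to a closed subalgebra enlarges the spectrum only by bounded components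
  -- of the complement of `K`, and there are none.
  have hz₀ : χ x ∈ K := by
    by_contra hz
    have h1 : χ x ∈ spectrum ℂ x :=
      WeakDual.CharacterSpace.mem_spectrum_iff_exists.mpr ⟨χ, rfl⟩
    have h2 := Subalgebra.spectrum_isBounded_connectedComponentIn (polyAlgebra K) x h1
    rw [hspec] at h2
    exact hKc _ hz h2
  -- A character is determined by its value on `X`, since polynomials are dense; so `χ` is
  -- evaluation at the point `χ x` of `K`.
  have hev : ∀ G (hG : G ∈ polyAlgebra K), χ ⟨G, hG⟩ = G ⟨χ x, hz₀⟩ := by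
    have hclosed : IsClosed {G : polyAlgebra K | χ G = (G : C(K, ℂ)) ⟨χ x, hz₀⟩} :=
      isClosed_eq (map_continuous χ)
        ((continuous_eval_const _).comp continuous_subtype_val)
    have hp : ∀ p : ℂ[X], χ ⟨p.toContinuousMapOn K, hpoly p⟩ = p.eval (χ x) := by
      intro p
      have e : (⟨p.toContinuousMapOn K, hpoly p⟩ : polyAlgebra K) = aeval x p := by
        apply Subtype.ext
        have : ((aeval x p : polyAlgebra K) : C(K, ℂ)) = aeval (X.toContinuousMapOn K) p := by
          rw [← Subalgebra.coe_val, ← Polynomial.aeval_algHom_apply]; rfl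
        rw [this]
        ext z
        simp [Polynomial.aeval_continuousMap_apply]
      rw [e, ← Polynomial.aeval_algHom_apply χ, Polynomial.coe_aeval_eq_eval]
    intro G hG
    have hG' : G ∈ closure ((polynomialFunctions K : Subalgebra ℂ C(K, ℂ)) : Set C(K, ℂ)) := hG
    obtain ⟨u, hu, hlim⟩ := mem_closure_iff_seq_limit.mp hG'
    have hlim' : Tendsto (fun n => (⟨u n, Subalgebra.le_topologicalClosure _ (hu n)⟩ :
        polyAlgebra K)) atTop (𝓝 ⟨G, hG⟩) := tendsto_subtype_rng.mpr hlim
    refine hclosed.mem_of_tendsto hlim' (Eventually.of_forall fun n => ?_)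
    obtain ⟨p, -, hp'⟩ := hu n
    have hp'' : p.toContinuousMapOn K = u n := hp'
    simp only [mem_ofPred_eq, ← hp'']
    simpa using hp p
  rw [hev] at hχ
  exact h0 _ hχ

/-- `φ` is on every compact subset of `V` a uniform limit of polynomials. -/
def PolyApprox (V : Set ℂ) (φ : ℂ → ℂ) : Prop :=
  ∀ (K : Set ℂ) [CompactSpace K], K ⊆ V → ∃ F ∈ polyAlgebra K, ∀ z, F z = φ z

namespace PolyApprox

variable {V : Set ℂ} {φ ψ : ℂ → ℂ}

theorem eval (p : ℂ[X]) : PolyApprox V fun z => p.eval z := fun K _ _ =>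
  ⟨p.toContinuousMapOn K, Subalgebra.le_topologicalClosure _ ⟨p, trivial, rfl⟩, fun _ => rfl⟩

theorem const (c : ℂ) : PolyApprox V fun _ => c := by simpa using eval (V := V) (C c)

theorem id : PolyApprox V fun z => z := by simpa using eval (V := V) X

theorem mul (hφ : PolyApprox V φ) (hψ : PolyApprox V ψ) : PolyApprox V fun z => φ z * ψ z := by
  intro K _ hKV
  obtain ⟨F, hF, hF'⟩ := hφ K hKV
  obtain ⟨G, hG, hG'⟩ := hψ K hKV
  exact ⟨F * G, mul_mem hF hG, fun z => by simp [hF', hG']⟩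

theorem sub (hφ : PolyApprox V φ) (hψ : PolyApprox V ψ) : PolyApprox V fun z => φ z - ψ z := by
  intro K _ hKV
  obtain ⟨F, hF, hF'⟩ := hφ K hKV
  obtain ⟨G, hG, hG'⟩ := hψ K hKV
  exact ⟨F - G, sub_mem hF hG, fun z => by simp [hF', hG']⟩

theorem cexp (hφ : PolyApprox V φ) : PolyApprox V fun z => Complex.exp (φ z) := by
  intro K _ hKV
  obtain ⟨F, hF, hF'⟩ := hφ K hKV
  let _ : NormedAlgebra ℚ C(K, ℂ) := NormedAlgebra.restrictScalars ℚ ℂ C(K, ℂ)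
  refine ⟨NormedSpace.exp F, ?_, fun z => ?_⟩
  · have hcl : IsClosed ((polyAlgebra K : Subalgebra ℂ C(K, ℂ)) : Set C(K, ℂ)) :=
      Subalgebra.isClosed_topologicalClosure _
    refine hcl.mem_of_tendsto (NormedSpace.exp_series_hasSum_exp' (𝕂 := ℂ) F)
      (Eventually.of_forall fun s => ?_)
    exact sum_mem fun n _ => Subalgebra.smul_mem _ (pow_mem hF n) _
  · have := NormedSpace.map_exp (ContinuousMap.evalAlgHom ℂ ℂ z)
      (continuous_eval_const z) F
    simp only [← hF' z, Complex.exp_eq_exp_ℂ]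
    exact this

theorem of_tendsto {ι : Type*} {l : Filter ι} [l.NeBot] {ψ : ι → ℂ → ℂ}
    (hψ : ∀ n, PolyApprox V (ψ n)) (hV : IsOpen V) (h : TendstoLocallyUniformlyOn ψ φ l V) :
    PolyApprox V φ := by
  intro K _ hKV
  have hu : TendstoUniformlyOn ψ φ l K :=
    (tendstoLocallyUniformlyOn_iff_forall_isCompact hV).mp h K hKV (isCompact_iff_compactSpace.mpr inferInstance)
  choose F hF hF' using fun n => hψ n K hKV
  have hc : ContinuousOn φ K := hu.continuousOn (Eventually.of_forall (fun n => by
    rw [continuousOn_iff_continuous_domRestrict]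
    exact (F n).continuous.congr (hF' n))).frequently
  refine ⟨⟨K.domRestrict φ, continuousOn_iff_continuous_domRestrict.mp hc⟩, ?_, fun _ => rfl⟩
  have hcl : IsClosed ((polyAlgebra K : Subalgebra ℂ C(K, ℂ)) : Set C(K, ℂ)) :=
    Subalgebra.isClosed_topologicalClosure _
  refine hcl.mem_of_tendsto (f := F) (b := l) ?_ (Eventually.of_forall hF)
  rw [ContinuousMap.tendsto_iff_tendstoUniformly]
  rw [tendstoUniformlyOn_iff_tendstoUniformly_comp_coe] at hu
  have e : (fun n z => F n z) = fun n (z : K) => ψ n z := by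
    ext n z
    exact hF' n z
  rw [e]
  exact hu

/-- A function approximable on compact sets is a locally uniform limit of polynomials. -/
theorem exists_seq (hV : IsOpen V) (hφ : PolyApprox V φ) :
    ∃ p : ℕ → ℂ[X], TendstoLocallyUniformlyOn (fun n z => (p n).eval z) φ atTop V := by
  have : LocallyCompactSpace V := hV.locallyCompactSpace
  let E : CompactExhaustion V := default
  have hE : ∀ n, ((↑) '' E n : Set ℂ) ⊆ V := fun n => by rintro _ ⟨z, -, rfl⟩; exact z.2
  have hEc : ∀ n, IsCompact ((↑) '' E n : Set ℂ) := fun n =>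
    (E.isCompact n).image continuous_subtype_val
  have hex : ∀ n : ℕ, ∃ p : ℂ[X], ∀ z ∈ ((↑) '' E n : Set ℂ), dist (φ z) (p.eval z) < 1 / (n + 1) := by
    intro n
    have : CompactSpace ((↑) '' E n : Set ℂ) := isCompact_iff_compactSpace.mp (hEc n)
    obtain ⟨F, hF, hF'⟩ := hφ _ (hE n)
    obtain ⟨G, ⟨p, -, hp⟩, hG⟩ := Metric.mem_closure_iff.mp hF (1 / (n + 1)) (by positivity)
    refine ⟨p, fun z hz => ?_⟩
    have h1 := (ContinuousMap.dist_apply_le_dist (f := F) (g := G) ⟨z, hz⟩).trans_lt hG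
    have hp' : p.toContinuousMapOn _ = G := hp
    rw [hF', ← hp'] at h1
    simpa using h1
  choose p hp using hex
  refine ⟨p, (tendstoLocallyUniformlyOn_iff_forall_isCompact hV).mpr fun K hKV hK => ?_⟩
  obtain ⟨N, hN⟩ := E.exists_superset_of_isCompact (s := (↑) ⁻¹' K)
    (Topology.IsInducing.subtypeVal.isCompact_preimage_iff (by simpa using hKV) |>.mpr hK)
  rw [Metric.tendstoUniformlyOn_iff]
  intro ε hε
  obtain ⟨M, hM⟩ := exists_nat_one_div_lt hε
  filter_upwards [eventually_ge_atTop (max N M)] with n hn z hz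
  have hzE : z ∈ ((↑) '' E n : Set ℂ) :=
    ⟨⟨z, hKV hz⟩, E.subset ((le_max_left _ _).trans hn) (hN hz), rfl⟩
  refine (hp n z hzE).trans (lt_of_le_of_lt ?_ hM)
  have : (M : ℝ) ≤ n := by exact_mod_cast (le_max_right _ _).trans hn
  gcongr

theorem differentiableOn (hV : IsOpen V) (hφ : PolyApprox V φ) : DifferentiableOn ℂ φ V := by
  obtain ⟨p, hp⟩ := hφ.exists_seq hV
  exact hp.differentiableOn (Eventually.of_forall fun n => (p n).differentiable.differentiableOn) hV

theorem deriv (hV : IsOpen V) (hφ : PolyApprox V φ) : PolyApprox V (_root_.deriv φ) := by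
  obtain ⟨p, hp⟩ := hφ.exists_seq hV
  have h := hp.deriv (Eventually.of_forall fun n => (p n).differentiable.differentiableOn) hV
  refine of_tendsto (fun n => ?_) hV h
  have : (_root_.deriv ∘ fun n z => (p n).eval z) n = fun z => (derivative (p n)).eval z := by
    ext z; simp
  rw [this]
  exact eval _

end PolyApprox

theorem Polynomial.exists_derivative_eq (p : ℂ[X]) (a : ℂ) :
    ∃ q : ℂ[X], derivative q = p ∧ q.eval a = 0 := by
  obtain ⟨q, hq⟩ : ∃ q : ℂ[X], derivative q = p := by
    induction p using Polynomial.induction_on' with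
    | add p q hp hq =>
      obtain ⟨p', rfl⟩ := hp
      obtain ⟨q', rfl⟩ := hq
      exact ⟨p' + q', by simp⟩
    | monomial n c =>
      refine ⟨monomial (n + 1) (c / (n + 1)), ?_⟩
      rw [derivative_monomial]
      have : (n + 1 : ℂ) ≠ 0 := by exact_mod_cast n.succ_ne_zero
      simp [div_mul_cancel₀ _ this]
  exact ⟨q - C (q.eval a), by simp [hq], by simp⟩

namespace PolyApprox

variable {V : Set ℂ} {φ ψ : ℂ → ℂ}

/-- A function approximable by polynomials on a connected open set has a primitive of the same
kind. -/
theorem exists_primitive (hV : IsOpen V) (hVc : IsConnected V) (hφ : PolyApprox V φ) :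
    ∃ Φ, PolyApprox V Φ ∧ ∀ z ∈ V, HasDerivAt Φ (φ z) z := by
  obtain ⟨a, ha⟩ := hVc.nonempty
  obtain ⟨p, hp⟩ := hφ.exists_seq hV
  choose P hP hPa using fun n => (p n).exists_derivative_eq a
  have hder : ∀ n, ∀ z : ℂ, HasDerivAt (fun z => (P n).eval z) ((p n).eval z) z := fun n z => by
    simpa [hP] using (P n).hasDerivAt z
  have hball : ∀ z ∈ V, ∃ r > 0, ball z r ⊆ V ∧ ∀ w ∈ ball z r,
      CauchySeq (fun n => (P n).eval w) →
      UniformCauchySeqOn (fun n z => (P n).eval z) atTop (ball z r) := by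
    intro z hz
    obtain ⟨r, hr, hrV⟩ := nhds_basis_closedBall.mem_iff.mp (hV.mem_nhds hz)
    refine ⟨r, hr, ball_subset_closedBall.trans hrV, fun w hw hcw => ?_⟩
    have hu : UniformCauchySeqOn (fun n z => (p n).eval z) atTop (ball z r) :=
      ((tendstoLocallyUniformlyOn_iff_forall_isCompact hV).mp hp _ hrV
        (isCompact_closedBall z r)).uniformCauchySeqOn.mono ball_subset_closedBall
    refine uniformCauchySeqOn_ball_of_deriv hu (fun n y _ => hder n y) ?_
    refine cauchy_map_of_uniformCauchySeqOn_fderiv isOpen_ball (convex_ball z r).isPreconnected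
      ((ContinuousLinearMap.smulRightL ℂ ℂ ℂ 1).uniformContinuous.comp_uniformCauchySeqOn hu)
      (fun n y _ => hasDerivAt_iff_hasFDerivAt.mp (hder n y)) hw (mem_ball_self hr) hcw
  -- Convergence of the normalized primitives at one point of a ball spreads to the whole ball, so
  -- the set of convergence is open and relatively closed in `V`; it contains the base point `a`,
  -- where all of them vanish.
  have hcauchy : ∀ z ∈ V, CauchySeq (fun n => (P n).eval z) := by
    have hsub : V ⊆ {z | CauchySeq (fun n => (P n).eval z)} := by
      refine hVc.isPreconnected.subset_of_closure_inter_subset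
        (u := V ∩ {z | CauchySeq (fun n => (P n).eval z)}) ?_ ⟨a, ha, ha, ?_⟩ ?_ |>.trans
        inter_subset_right
      · refine isOpen_iff_mem_nhds.mpr fun z hz => ?_
        obtain ⟨r, hr, hrV, h⟩ := hball z hz.1
        exact mem_of_superset (ball_mem_nhds z hr) fun w hw =>
          ⟨hrV hw, (h z (mem_ball_self hr) hz.2).cauchySeq hw⟩
      · simp only [mem_ofPred_eq, hPa]
        exact cauchySeq_const 0
      · rintro z ⟨hz, hzV⟩
        obtain ⟨r, hr, hrV, h⟩ := hball z hzV
        obtain ⟨w, hw, hw'⟩ := mem_closure_iff_nhds.mp hz _ (ball_mem_nhds z hr)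
        exact ⟨hzV, (h w hw hw'.2).cauchySeq (mem_ball_self hr)⟩
    exact hsub
  choose! Φ hΦ using fun z hz => cauchySeq_tendsto_of_complete (hcauchy z hz)
  refine ⟨Φ, of_tendsto (ψ := fun n z => (P n).eval z) (l := atTop) (fun n => eval _) hV ?_,
    fun z hz => ?_⟩
  · refine tendstoLocallyUniformlyOn_of_forall_exists_nhds fun z hz => ?_
    obtain ⟨r, hr, hrV, h⟩ := hball z hz
    exact ⟨ball z r, mem_nhdsWithin_of_mem_nhds (ball_mem_nhds z hr),
      (h z (mem_ball_self hr) (hcauchy z hz)).tendstoUniformlyOn_of_tendsto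
        fun w hw => hΦ w (hrV hw)⟩
  · exact hasDerivAt_of_tendstoLocallyUniformlyOn hV hp
      (Eventually.of_forall fun n z _ => hder n z) hΦ hz

end PolyApprox

/-- Compact subsets of `V` are contained in compact subsets of `V` whose complement has no bounded
component. -/
def HasRungeExhaustion (V : Set ℂ) : Prop :=
  ∀ K ⊆ V, IsCompact K → ∃ K' ⊆ V, IsCompact K' ∧ K ⊆ K' ∧
    ∀ z ∉ K', ¬ Bornology.IsBounded (connectedComponentIn K'ᶜ z)

namespace PolyApprox

variable {V : Set ℂ} {φ ψ : ℂ → ℂ}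

/-- Enlarge the compact set to one whose complement has no bounded component, invert there in the
uniform closure of the polynomials, and restrict back. -/
theorem inv (hV : HasRungeExhaustion V) (hφ : PolyApprox V φ) (h0 : ∀ z ∈ V, φ z ≠ 0) :
    PolyApprox V fun z => (φ z)⁻¹ := by
  intro K _ hKV
  obtain ⟨K', hK'V, hK', hKK', hc⟩ := hV K hKV (isCompact_iff_compactSpace.mpr inferInstance)
  have : CompactSpace K' := isCompact_iff_compactSpace.mp hK'
  obtain ⟨F, hF, hF'⟩ := hφ K' hK'V
  obtain ⟨G, hG, hGF⟩ := exists_mul_eq_one_of_mem_polyAlgebra hc hF fun z => by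
    rw [hF']; exact h0 z (hK'V z.2)
  let ρ : C(K', ℂ) →A[ℂ] C(K, ℂ) :=
    { ContinuousMap.compRightAlgHom ℂ ℂ ⟨Set.inclusion hKK', continuous_inclusion hKK'⟩ with
      cont := ContinuousMap.continuous_precomp _ }
  refine ⟨ρ G, ?_, fun z => ?_⟩
  · have hG' : G ∈ closure ((polynomialFunctions K' : Subalgebra ℂ C(K', ℂ)) : Set C(K', ℂ)) := hG
    refine map_mem_closure ρ.cont hG' fun H hH => ?_
    obtain ⟨p, -, hp⟩ := hH
    refine ⟨p, trivial, ?_⟩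
    rw [← hp]
    rfl
  · have := congrArg (fun H : C(K', ℂ) => H (Set.inclusion hKK' z)) hGF
    simp only [ContinuousMap.mul_apply, hF', ContinuousMap.one_apply] at this
    exact eq_inv_of_mul_eq_one_left this

/-- The logarithmic derivative has a primitive Φ, and `φ` is a constant times exp Φ. Halving Φ and
taking a root of the constant gives the square root. This is the only form in which the proof of the
Riemann mapping theorem uses simple connectivity. -/
theorem exists_sqrt (hV : IsOpen V) (hVc : IsConnected V) (hVR : HasRungeExhaustion V)
    (hφ : PolyApprox V φ) (h0 : ∀ z ∈ V, φ z ≠ 0) :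
    ∃ s, PolyApprox V s ∧ ∀ z ∈ V, s z ^ 2 = φ z := by
  obtain ⟨Φ, hΦ, hd⟩ := ((hφ.deriv hV).mul (hφ.inv hVR h0)).exists_primitive hV hVc
  have hE : ∀ z ∈ V, HasDerivAt (fun z => Complex.exp (-Φ z) * φ z)
      (Complex.exp (-Φ z) * -(_root_.deriv φ z * (φ z)⁻¹) * φ z
        + Complex.exp (-Φ z) * _root_.deriv φ z) z := fun z hz =>
    ((hd z hz).fun_neg.cexp).fun_mul
      ((hφ.differentiableOn hV).differentiableAt (hV.mem_nhds hz)).hasDerivAt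
  have hconst : ∃ c, ∀ z ∈ V, Complex.exp (-Φ z) * φ z = c := by
    refine hV.exists_is_const_of_deriv_eq_zero hVc.isPreconnected (𝕜 := ℂ)
      (f := fun z => Complex.exp (-Φ z) * φ z) ?_ ?_
    · intro z hz
      exact (hE z hz).differentiableAt.differentiableWithinAt
    · intro z hz
      rw [(hE z hz).deriv]
      have := h0 z hz
      simp only [Pi.zero_apply]
      field_simp
      ring
  obtain ⟨c, hc⟩ := hconst
  obtain ⟨b, hb⟩ := IsAlgClosed.exists_pow_nat_eq c (n := 2) (by norm_num)
  refine ⟨fun z => b * Complex.exp ((1 / 2) * Φ z), (const b).mul ((const (1 / 2)).mul hΦ).cexp,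
    fun z hz => ?_⟩
  rw [mul_pow, hb, ← hc z hz, ← Complex.exp_nat_mul, mul_right_comm, ← Complex.exp_add]
  push_cast
  rw [show -Φ z + 2 * (1 / 2 * Φ z) = 0 by ring]
  simp

end PolyApprox

/-! ### The Riemann mapping theorem for domains with a Runge exhaustion -/

/-- The automorphism of the unit disk that maps `a` to `0`. -/
noncomputable def diskMobius (a z : ℂ) : ℂ := (z - a) / (1 - conj a * z)

theorem one_sub_conj_mul_ne_zero {a z : ℂ} (ha : ‖a‖ < 1) (hz : ‖z‖ ≤ 1) :
    1 - conj a * z ≠ 0 := by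
  intro h
  have h1 : ‖conj a * z‖ = 1 := by rw [← sub_eq_zero.mp h]; simp
  rw [norm_mul, RCLike.norm_conj] at h1
  nlinarith [norm_nonneg a, norm_nonneg z]

theorem normSq_one_sub_conj_mul_sub (a z : ℂ) :
    ‖1 - conj a * z‖ ^ 2 - ‖z - a‖ ^ 2 = (1 - ‖a‖ ^ 2) * (1 - ‖z‖ ^ 2) := by
  simp only [← Complex.normSq_eq_norm_sq, Complex.normSq_apply]
  simp
  ring

theorem norm_diskMobius_lt_one {a z : ℂ} (ha : ‖a‖ < 1) (hz : ‖z‖ < 1) : ‖diskMobius a z‖ < 1 := by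
  have h0 := one_sub_conj_mul_ne_zero ha hz.le
  rw [diskMobius, norm_div, div_lt_one (norm_pos_iff.mpr h0)]
  have h := normSq_one_sub_conj_mul_sub a z
  have : 0 < (1 - ‖a‖ ^ 2) * (1 - ‖z‖ ^ 2) := by
    have := norm_nonneg a; have := norm_nonneg z
    apply mul_pos <;> nlinarith
  exact lt_of_pow_lt_pow_left₀ 2 (norm_nonneg _) (by linarith)

theorem diskMobius_self (a : ℂ) : diskMobius a a = 0 := by simp [diskMobius]

theorem diskMobius_eq_zero_iff {a z : ℂ} (ha : ‖a‖ < 1) (hz : ‖z‖ ≤ 1) :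
    diskMobius a z = 0 ↔ z = a := by
  rw [diskMobius, div_eq_zero_iff, or_iff_left (one_sub_conj_mul_ne_zero ha hz), sub_eq_zero]

theorem diskMobius_injOn {a : ℂ} (ha : ‖a‖ < 1) : InjOn (diskMobius a) (ball 0 1) := by
  intro z hz w hw h
  rw [mem_ball_zero_iff] at hz hw
  have h1 := one_sub_conj_mul_ne_zero ha hz.le
  have h2 := one_sub_conj_mul_ne_zero ha hw.le
  rw [diskMobius, diskMobius, div_eq_div_iff h1 h2] at h
  have h3 : (1 - conj a * a) * (z - w) = 0 := by linear_combination h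
  exact sub_eq_zero.mp ((mul_eq_zero.mp h3).resolve_left (one_sub_conj_mul_ne_zero ha ha.le))

theorem hasDerivAt_diskMobius {a z : ℂ} (ha : ‖a‖ < 1) (hz : ‖z‖ ≤ 1) :
    HasDerivAt (diskMobius a) ((1 - ‖a‖ ^ 2) / (1 - conj a * z) ^ 2) z := by
  have h0 := one_sub_conj_mul_ne_zero ha hz
  have := ((hasDerivAt_id z).sub_const a).fun_div
    (((hasDerivAt_id z).const_mul (conj a)).const_sub 1) h0
  refine this.congr_deriv ?_
  rw [← Complex.conj_mul']
  simp only [_root_.id]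
  congr 1
  ring

theorem PolyApprox.diskMobius_comp {V : Set ℂ} {φ : ℂ → ℂ} (hV : HasRungeExhaustion V)
    (hφ : PolyApprox V φ) (hb : MapsTo φ V (ball 0 1)) {a : ℂ} (ha : ‖a‖ < 1) :
    PolyApprox V fun z => diskMobius a (φ z) := by
  simp only [diskMobius, div_eq_mul_inv]
  exact (hφ.sub (const a)).mul (inv hV ((const 1).sub ((const (conj a)).mul hφ)) fun z hz =>
    one_sub_conj_mul_ne_zero ha (mem_ball_zero_iff.mp (hb hz)).le)

/-- The extremal step in the proof of the Riemann mapping theorem. -/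
theorem exists_norm_deriv_lt {V : Set ℂ} (hV : IsOpen V) (hVc : IsConnected V)
    (hVR : HasRungeExhaustion V) {p : ℂ} (hp : p ∈ V) {φ : ℂ → ℂ} (hφ : PolyApprox V φ)
    (hinj : InjOn φ V) (hb : MapsTo φ V (ball 0 1)) (hp0 : φ p = 0) (hd : deriv φ p ≠ 0)
    {a : ℂ} (ha : a ∈ ball (0 : ℂ) 1) (ha' : a ∉ φ '' V) :
    ∃ χ, PolyApprox V χ ∧ InjOn χ V ∧ MapsTo χ V (ball 0 1) ∧ χ p = 0 ∧
      ‖deriv φ p‖ < ‖deriv χ p‖ := by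
  have ha1 : ‖a‖ < 1 := mem_ball_zero_iff.mp ha
  have hne : ∀ z ∈ V, diskMobius a (φ z) ≠ 0 := fun z hz h =>
    ha' ⟨z, hz, (diskMobius_eq_zero_iff ha1 (mem_ball_zero_iff.mp (hb hz)).le).mp h⟩
  -- Koebe's trick: moving the omitted value `a` to 0 allows a holomorphic square root. Recentering
  -- it at `p` undoes a self-map of the disk that is not an automorphism, so the derivative grows.
  obtain ⟨s, hs, hs2⟩ := (hφ.diskMobius_comp hVR hb ha1).exists_sqrt hV hVc hVR hne
  have hsb : MapsTo s V (ball 0 1) := by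
    intro z hz
    have h1 := norm_diskMobius_lt_one ha1 (mem_ball_zero_iff.mp (hb hz))
    rw [← hs2 z hz, norm_pow] at h1
    rw [mem_ball_zero_iff]
    nlinarith [norm_nonneg (s z)]
  have hsi : InjOn s V := by
    intro z hz w hw h
    have : diskMobius a (φ z) = diskMobius a (φ w) := by rw [← hs2 z hz, ← hs2 w hw, h]
    exact hinj hz hw (diskMobius_injOn ha1 (hb hz) (hb hw) this)
  have hb1 : ‖s p‖ < 1 := mem_ball_zero_iff.mp (hsb hp)
  refine ⟨fun z => diskMobius (s p) (s z), hs.diskMobius_comp hVR hsb hb1,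
    (diskMobius_injOn hb1).comp hsi hsb, fun z hz => ?_, diskMobius_self _, ?_⟩
  · exact mem_ball_zero_iff.mpr (norm_diskMobius_lt_one hb1 (mem_ball_zero_iff.mp (hsb hz)))
  · have hds := ((hs.differentiableOn hV).differentiableAt (hV.mem_nhds hp)).hasDerivAt
    have hdφ := ((hφ.differentiableOn hV).differentiableAt (hV.mem_nhds hp)).hasDerivAt
    have h1 := (hasDerivAt_diskMobius hb1 hb1.le).comp p hds
    have h2 : HasDerivAt (fun z => s z ^ 2) (2 * s p * deriv s p) p := by
      simpa using hds.fun_pow 2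
    have h3 : HasDerivAt (fun z => s z ^ 2) ((1 - ‖a‖ ^ 2) * deriv φ p) p := by
      have h0 : ‖φ p‖ ≤ 1 := by simp [hp0]
      have := (hasDerivAt_diskMobius ha1 h0).comp p hdφ
      rw [hp0] at this
      refine HasDerivAt.congr_of_eventuallyEq (by simpa using this) ?_
      filter_upwards [hV.mem_nhds hp] with z hz
      exact hs2 z hz
    have h4 := h2.unique h3
    have h5 : deriv (fun z => diskMobius (s p) (s z)) p = _ := h1.deriv
    have h6 : s p ^ 2 = -a := by rw [hs2 p hp, hp0]; simp [diskMobius]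
    have h7 : ‖s p‖ ^ 2 = ‖a‖ := by rw [← norm_pow, h6, norm_neg]
    rw [h5, Complex.conj_mul']
    set b := ‖s p‖ with hbdef
    have hb0 : 0 < b := by
      rw [hbdef, norm_pos_iff]
      intro h0
      exact hne p hp (by rw [← hs2 p hp, h0]; simp)
    have hbb : 0 < 1 - b ^ 2 := by nlinarith
    have e1 : ((1 : ℂ) - (b : ℂ) ^ 2) = ((1 - b ^ 2 : ℝ) : ℂ) := by push_cast; ring
    have e2 : ((1 : ℂ) - (‖a‖ : ℂ) ^ 2) = ((1 - ‖a‖ ^ 2 : ℝ) : ℂ) := by push_cast; ring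
    rw [e2] at h4
    have h8 := congrArg norm h4
    rw [norm_mul, norm_mul, norm_mul, Complex.norm_real, Real.norm_of_nonneg
      (by rw [← h7]; nlinarith [pow_pos hb0 2]), ← hbdef, ← h7] at h8
    simp only [Complex.norm_ofNat] at h8
    rw [e1, norm_mul, norm_div, norm_pow, Complex.norm_real, Real.norm_of_nonneg hbb.le]
    have hφ0 : 0 < ‖deriv φ p‖ := norm_pos_iff.mpr hd
    have h9 : (1 - b ^ 2) / (1 - b ^ 2) ^ 2 * ‖deriv s p‖ = ‖deriv s p‖ / (1 - b ^ 2) := by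
      field_simp
    rw [h9, lt_div_iff₀ hbb]
    -- With `b ^ 2 = ‖a‖` the new derivative is `(1 + b ^ 2) / (2 * b)` times the old one in
    -- modulus; the factor exceeds 1 because `(1 - b) ^ 2 > 0`.
    have h10 : ‖deriv s p‖ = (1 - (b ^ 2) ^ 2) * ‖deriv φ p‖ / (2 * b) := by
      rw [← h8]; field_simp
    rw [h10, lt_div_iff₀ (by positivity)]
    have h11 : 0 < ‖deriv φ p‖ * (1 - b ^ 2) := by positivity
    nlinarith [mul_pos h11 (pow_pos (sub_pos.mpr hb1) 2)]

/-- The Riemann mapping theorem for connected open subsets of the unit disk with a Runge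
exhaustion. -/
theorem exists_bijOn_ball {V : Set ℂ} (hV : IsOpen V) (hVc : IsConnected V)
    (hVR : HasRungeExhaustion V) (hV1 : V ⊆ ball 0 1) :
    ∃ φ : ℂ → ℂ, DifferentiableOn ℂ φ V ∧ InjOn φ V ∧ φ '' V = ball 0 1 := by
  obtain ⟨p, hp⟩ := hVc.nonempty
  let 𝓕 : Set (ℂ → ℂ) := {ψ | PolyApprox V ψ ∧ InjOn ψ V ∧ MapsTo ψ V (ball 0 1) ∧ ψ p = 0}
  have hp1 : ‖p‖ < 1 := mem_ball_zero_iff.mp (hV1 hp)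
  have hne : (fun z => (1 / 2) * (z - p)) ∈ 𝓕 := by
    refine ⟨(PolyApprox.const _).mul (PolyApprox.id.sub (PolyApprox.const p)), ?_, ?_, by simp⟩
    · intro z _ w _ h
      simpa using h
    · intro z hz
      have := mem_ball_zero_iff.mp (hV1 hz)
      rw [mem_ball_zero_iff, norm_mul]
      have h2 := norm_sub_le z p
      simp only [one_div, norm_inv, Complex.norm_ofNat]
      linarith
  obtain ⟨r, hr, hrV⟩ := Metric.isOpen_iff.mp hV p hp
  have hbdd : BddAbove ((fun ψ => ‖deriv ψ p‖) '' 𝓕) := by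
    refine ⟨1 / r, ?_⟩
    rintro _ ⟨ψ, hψ, rfl⟩
    refine Complex.norm_deriv_le_div_of_mapsTo_ball ((hψ.1.differentiableOn hV).mono hrV) ?_ hr
    rw [hψ.2.2.2]
    exact (hψ.2.2.1.mono_left hrV).mono_right ball_subset_closedBall
  set M := sSup ((fun ψ => ‖deriv ψ p‖) '' 𝓕) with hM
  have hMle : ∀ ψ ∈ 𝓕, ‖deriv ψ p‖ ≤ M := fun ψ hψ => le_csSup hbdd ⟨ψ, hψ, rfl⟩
  obtain ⟨u, -, hu, humem⟩ := exists_seq_tendsto_sSup (Set.Nonempty.image _ ⟨_, hne⟩) hbdd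
  choose ψ hψ hψu using humem
  have hψd := fun n => (hψ n).1.differentiableOn hV
  -- A limit along a nonprincipal ultrafilter takes the place of a convergent subsequence of the
  -- maximizing sequence.
  obtain ⟨φ, hφ⟩ := exists_tendstoLocallyUniformlyOn_of_norm_le_one hV (hyperfilter ℕ) hψd
    fun n z hz => (mem_ball_zero_iff.mp ((hψ n).2.2.1 hz)).le
  have hle : (hyperfilter ℕ : Filter ℕ) ≤ atTop := by
    rw [← Nat.cofinite_eq_atTop]; exact hyperfilter_le_cofinite
  have hφd : ‖deriv φ p‖ = M := by
    have h1 := ((hφ.deriv (Eventually.of_forall hψd) hV).tendsto_at hp).norm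
    refine tendsto_nhds_unique h1 ?_
    have : Tendsto u (hyperfilter ℕ) (𝓝 M) := hu.mono_left hle
    exact this.congr fun n => (hψu n).symm
  have hM0 : 0 < M := by
    refine lt_of_lt_of_le ?_ (hMle _ hne)
    have : HasDerivAt (fun z : ℂ => (1 / 2) * (z - p)) (1 / 2 * 1) p :=
      ((hasDerivAt_id p).sub_const p).const_mul _
    rw [this.deriv]
    simp
  have hd0 : deriv φ p ≠ 0 := by rw [← norm_pos_iff, hφd]; exact hM0
  have hφP : PolyApprox V φ := PolyApprox.of_tendsto (fun n => (hψ n).1) hV hφ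
  have hφi : InjOn φ V := injOn_of_tendstoLocallyUniformlyOn hV hVc.isPreconnected hψd
    (fun n => (hψ n).2.1) hφ hp hd0
  have hφp : φ p = 0 := by
    refine tendsto_nhds_unique (hφ.tendsto_at hp) ?_
    simp only [(hψ _).2.2.2]
    exact tendsto_const_nhds
  have hφan : AnalyticOnNhd ℂ φ V := (hφP.differentiableOn hV).analyticOnNhd hV
  have hopen : IsOpen (φ '' V) := by
    rcases hφan.is_constant_or_isOpen hVc.isPreconnected with ⟨w, hw⟩ | h
    · exfalso
      apply hd0
      rw [(show φ =ᶠ[𝓝 p] fun _ => w from eventuallyEq_of_mem (hV.mem_nhds hp) hw).deriv_eq]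
      simp
    · exact h V subset_rfl hV
  have hφb : φ '' V ⊆ ball 0 1 := by
    have hcb : φ '' V ⊆ closedBall 0 1 := by
      rintro _ ⟨z, hz, rfl⟩
      refine isClosed_closedBall.mem_of_tendsto (hφ.tendsto_at hz) (Eventually.of_forall fun n => ?_)
      exact ball_subset_closedBall ((hψ n).2.2.1 hz)
    rw [← interior_closedBall _ one_ne_zero]
    exact interior_maximal hcb hopen
  refine ⟨φ, hφP.differentiableOn hV, hφi, hφb.antisymm fun a ha => ?_⟩
  by_contra ha'
  obtain ⟨χ, h1, h2, h3, h4, h5⟩ := exists_norm_deriv_lt hV hVc hVR hp hφP hφi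
    (mapsTo_iff_image_subset.mpr hφb) hφp hd0 ha ha'
  exact absurd (hMle χ ⟨h1, h2, h3, h4⟩) (by rw [← hφd]; exact not_le.mpr h5)

/-! ### Components of sublevel sets in the disk are conformal disks -/

theorem closure_connectedComponentIn_inter_subset {X : Type*} [TopologicalSpace X] (F : Set X)
    (x : X) : closure (connectedComponentIn F x) ∩ F ⊆ connectedComponentIn F x := by
  rintro y ⟨hy, hyF⟩
  by_cases hx : x ∈ F
  · have h1 : IsPreconnected (insert y (connectedComponentIn F x)) :=
      isPreconnected_connectedComponentIn.subset_closure (subset_insert _ _)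
        (insert_subset hy subset_closure)
    exact h1.subset_connectedComponentIn (mem_insert_of_mem _ (mem_connectedComponentIn hx))
      (insert_subset hyF (connectedComponentIn_subset F x)) (mem_insert _ _)
  · simp [connectedComponentIn_eq_empty hx] at hy

/-- A component of a sublevel set of the modulus of a holomorphic function on the disk has a Runge
exhaustion, by the maximum principle. -/
theorem hasRungeExhaustion_connectedComponentIn {H : ℂ → ℂ} {w₀ p : ℂ} {r : ℝ}
    (hH : DifferentiableOn ℂ H (ball 0 1))
    (hcomp : ∀ ρ < r, IsCompact (ball 0 1 ∩ {z | ‖H z - w₀‖ ≤ ρ})) (hp : p ∈ ball (0 : ℂ) 1)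
    (hpr : ‖H p - w₀‖ < r) :
    HasRungeExhaustion (connectedComponentIn (ball 0 1 ∩ {z | ‖H z - w₀‖ < r}) p) := by
  set W : Set ℂ := ball 0 1 ∩ {z | ‖H z - w₀‖ < r} with hW
  set V := connectedComponentIn W p with hV
  have hpW : p ∈ W := ⟨hp, hpr⟩
  have hpV : p ∈ V := mem_connectedComponentIn hpW
  have hVW : V ⊆ W := connectedComponentIn_subset _ _
  intro K hKV hK
  -- Adding `p` makes the compact set nonempty, so that the maximum `ρ` exists.
  have hKp : IsCompact (insert p K) := hK.insert p
  have hKpV : insert p K ⊆ V := insert_subset hpV hKV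
  have hcont : ContinuousOn (fun z => ‖H z - w₀‖) (insert p K) :=
    ((hH.continuousOn.mono fun z hz => (hVW (hKpV hz)).1).sub continuousOn_const).norm
  obtain ⟨q, hq, hmax⟩ := hKp.exists_isMaxOn (insert_nonempty p K) hcont
  set ρ := ‖H q - w₀‖ with hρ
  have hρr : ρ < r := (hVW (hKpV hq)).2
  set C : Set ℂ := ball 0 1 ∩ {z | ‖H z - w₀‖ ≤ ρ} with hC
  have hCW : C ⊆ W := fun z hz => ⟨hz.1, lt_of_le_of_lt hz.2 hρr⟩
  have hCc : IsCompact C := hcomp ρ hρr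
  have hVC : V ∩ C = closure V ∩ C := by
    refine (inter_subset_inter_left _ subset_closure).antisymm fun z hz => ⟨?_, hz.2⟩
    exact closure_connectedComponentIn_inter_subset W p ⟨hz.1, hCW hz.2⟩
  have hK' : IsCompact (V ∩ C) := by
    rw [hVC, inter_comm]; exact hCc.inter_right isClosed_closure
  refine ⟨V ∩ C, inter_subset_left, hK', fun z hz => ⟨hKV hz, (hVW (hKV hz)).1,
    hmax (mem_insert_of_mem p hz)⟩, fun z hz hbd => hz ?_⟩
  set Ω := connectedComponentIn (V ∩ C)ᶜ z with hΩ
  have hΩo : IsOpen Ω := hK'.isClosed.isOpen_compl.connectedComponentIn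
  have hzΩ : z ∈ Ω := mem_connectedComponentIn hz
  have hΩs : Ω ⊆ (V ∩ C)ᶜ := connectedComponentIn_subset _ _
  have hΩ1 : Ω ⊆ ball 0 1 := by
    intro w hw
    by_contra hw1
    have hw1' : 1 ≤ ‖w‖ := by simpa using hw1
    -- A complementary component that leaves the unit disk at `w` contains the outward ray from `w`,
    -- hence is unbounded.
    have hray : (fun t : ℝ => (t : ℂ) * w) '' Ici 1 ⊆ Ω := by
      have hpre : IsPreconnected ((fun t : ℝ => (t : ℂ) * w) '' Ici 1) :=
        isPreconnected_Ici.image _ (by fun_prop)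
      rw [hΩ, connectedComponentIn_eq hw]
      refine hpre.subset_connectedComponentIn ⟨1, self_mem_Ici, by simp⟩ ?_
      rintro _ ⟨t, ht, rfl⟩ hmem
      have h1 := mem_ball_zero_iff.mp hmem.2.1
      simp only [mem_Ici] at ht
      rw [norm_mul, Complex.norm_real, Real.norm_of_nonneg (by linarith)] at h1
      nlinarith
    obtain ⟨R, hR⟩ := hbd.exists_norm_le
    have h2 := hR _ (hray ⟨max 1 (R + 1), mem_Ici.mpr (le_max_left _ _), rfl⟩)
    simp only at h2
    have h3 := le_max_left 1 (R + 1)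
    have h4 := le_max_right 1 (R + 1)
    rw [norm_mul, Complex.norm_real, Real.norm_of_nonneg (by linarith)] at h2
    nlinarith
  have hfr : frontier Ω ⊆ V ∩ C := by
    intro x hx
    by_contra hx'
    have := closure_connectedComponentIn_inter_subset _ _ ⟨frontier_subset_closure hx, hx'⟩
    rw [hΩo.frontier_eq] at hx
    exact hx.2 this
  have hcl : closure Ω ⊆ ball 0 1 := by
    rw [closure_eq_self_union_frontier]
    exact union_subset hΩ1 fun x hx => (hfr hx).2.1
  -- The boundary of `Ω` lies in `V ∩ C`, where the modulus is at most `ρ`. So the closure of `Ω`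
  -- stays in `W` and meets `V`, which forces `Ω` into `V ∩ C` although it was chosen in the
  -- complement.
  have hle : ∀ x ∈ closure Ω, ‖H x - w₀‖ ≤ ρ := fun x hx =>
    Complex.norm_le_of_forall_mem_frontier_norm_le hbd
      (((hH.mono hcl).sub_const w₀).diffContOnCl) (fun y hy => (hfr hy).2.2) hx
  have hclW : closure Ω ⊆ W := fun x hx => hCW ⟨hcl hx, hle x hx⟩
  have hne : Ω ≠ univ := fun h => by
    have : (2 : ℂ) ∈ ball (0 : ℂ) 1 := hΩ1 (by rw [h]; trivial)
    simp at this
  obtain ⟨x, hx⟩ := nonempty_frontier_iff.mpr ⟨⟨z, hzΩ⟩, hne⟩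
  have hzV : z ∈ V := by
    rw [hV, connectedComponentIn_eq (hfr hx).1]
    exact isPreconnected_connectedComponentIn.closure.subset_connectedComponentIn
      (frontier_subset_closure hx) hclW (subset_closure hzΩ)
  exact ⟨hzV, hΩ1 hzΩ, hle z (subset_closure hzΩ)⟩

/-- A continuous solution `h` of `G ∘ h = K` is differentiable where `G` is locally invertible. -/
theorem differentiableAt_of_comp_eq {G h K : ℂ → ℂ} {z : ℂ} (hG : AnalyticAt ℂ G (h z))
    (hG' : deriv G (h z) ≠ 0) (hK : DifferentiableAt ℂ K z) (hh : ContinuousAt h z)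
    (e : ∀ᶠ y in 𝓝 z, G (h y) = K y) : DifferentiableAt ℂ h z := by
  have hs := hG.hasStrictDerivAt
  have hinv := (hs.hasStrictFDerivAt_equiv hG').eventually_left_inverse
  have hd := (hs.to_localInverse hG').hasDerivAt.differentiableAt
  rw [e.self_of_nhds] at hd
  refine (hd.comp z hK).congr_of_eventuallyEq ?_
  filter_upwards [e, hh.eventually hinv] with y h1 h2
  rw [Function.comp_apply, ← h1]
  exact h2.symm

/-- The inverse of an injective holomorphic function is holomorphic. -/
theorem exists_inverse_differentiableOn {V : Set ℂ} (hV : IsOpen V) {φ : ℂ → ℂ}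
    (hφ : DifferentiableOn ℂ φ V) (hinj : InjOn φ V) :
    ∃ g : ℂ → ℂ, DifferentiableOn ℂ g (φ '' V) ∧ InjOn g (φ '' V) ∧ g '' (φ '' V) = V ∧
      ∀ z ∈ V, g (φ z) = z := by
  have hg : ∀ z ∈ V, Function.invFunOn φ V (φ z) = z := hinj.leftInvOn_invFunOn
  refine ⟨Function.invFunOn φ V, ?_, ?_, ?_, hg⟩
  · rintro _ ⟨z, hz, rfl⟩
    refine DifferentiableAt.differentiableWithinAt ?_
    have han := hφ.analyticAt (hV.mem_nhds hz)
    have hd := han.deriv_ne_zero_of_injOn (hV.mem_nhds hz) hinj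
    have hmap := han.hasStrictDerivAt.map_nhds_eq hd
    refine differentiableAt_of_comp_eq (G := φ) (K := _root_.id) (by rwa [hg z hz])
      (by rwa [hg z hz]) differentiableAt_id ?_ ?_
    · rw [ContinuousAt, hg z hz, ← hmap, tendsto_map'_iff]
      refine tendsto_id.congr' ?_
      filter_upwards [hV.mem_nhds hz] with y hy
      exact (hg y hy).symm
    · rw [← hmap, eventually_map]
      filter_upwards [hV.mem_nhds hz] with y hy
      rw [hg y hy]; rfl
  · rintro _ ⟨z, hz, rfl⟩ _ ⟨w, hw, rfl⟩ h
    rw [hg z hz, hg w hw] at h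
    rw [h]
  · ext z
    constructor
    · rintro ⟨_, ⟨w, hw, rfl⟩, rfl⟩
      rwa [hg w hw]
    · exact fun hz => ⟨φ z, ⟨z, hz, rfl⟩, hg z hz⟩

/-- The Runge exhaustion supplied by the maximum principle is all that the Riemann mapping theorem
needs here. With `H` a composite of proper disk maps, these components are the levels of pull-backs
of round disks. -/
theorem exists_conformal_connectedComponentIn {H : ℂ → ℂ} {w₀ p : ℂ} {r : ℝ}
    (hH : DifferentiableOn ℂ H (ball 0 1))
    (hcomp : ∀ ρ < r, IsCompact (ball 0 1 ∩ {z | ‖H z - w₀‖ ≤ ρ})) (hp : p ∈ ball (0 : ℂ) 1)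
    (hpr : ‖H p - w₀‖ < r) :
    ∃ g : ℂ → ℂ, DifferentiableOn ℂ g (ball 0 1) ∧ InjOn g (ball 0 1) ∧
      g '' ball 0 1 = connectedComponentIn (ball 0 1 ∩ {z | ‖H z - w₀‖ < r}) p := by
  have ho : IsOpen (ball 0 1 ∩ {z | ‖H z - w₀‖ < r}) :=
    (hH.continuousOn.sub continuousOn_const).norm.isOpen_inter_preimage isOpen_ball isOpen_Iio
  obtain ⟨φ, h1, h2, h3⟩ := exists_bijOn_ball ho.connectedComponentIn
    (isConnected_connectedComponentIn_iff.mpr ⟨hp, hpr⟩)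
    (hasRungeExhaustion_connectedComponentIn hH hcomp hp hpr)
    ((connectedComponentIn_subset _ _).trans inter_subset_left)
  obtain ⟨g, g1, g2, g3, -⟩ := exists_inverse_differentiableOn ho.connectedComponentIn h1 h2
  rw [h3] at g1 g2 g3
  exact ⟨g, g1, g2, g3⟩

/-! ### Self-reciprocal polynomials and the derivative of a Blaschke product -/

namespace Polynomial

/-- Reversal is multiplicative: it turns a factor `X - C a` with `a ≠ 0` into a constant times `X -
C a⁻¹`, and the factor `X` into 1. -/
theorem roots_reverse (f : ℂ[X]) :
    f.reverse.roots = (f.roots.filter (· ≠ 0)).map fun z => z⁻¹ := by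
  have h1 : (1 : ℂ[X]).reverse = 1 := by rw [← C_1, reverse_C]
  have hX : (X : ℂ[X]).reverse = 1 := by
    have := reverse_mul_X (1 : ℂ[X])
    rwa [one_mul, h1] at this
  have hprod : ∀ s : Multiset ℂ, (s.map fun a => X - C a).prod.reverse.roots =
      (s.filter (· ≠ 0)).map fun z => z⁻¹ := by
    intro s
    induction s using Multiset.induction with
    | empty => simp [h1]
    | cons a s ih =>
      have hs : (s.map fun a => X - C a).prod ≠ 0 :=
        (monic_multiset_prod_of_monic _ _ fun a _ => monic_X_sub_C a).ne_zero
      rw [Multiset.map_cons, Multiset.prod_cons, reverse_mul_of_domain, roots_mul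
        (mul_ne_zero (by simp [X_sub_C_ne_zero]) (by simpa using hs)), ih]
      by_cases ha : a = 0
      · subst ha
        simp [hX]
      · rw [Multiset.filter_cons_of_pos (p := fun z => z ≠ 0) s ha, Multiset.map_cons]
        have : (X - C a : ℂ[X]).reverse = C (-a) * (X - C a⁻¹) := by
          have h1 : (X - C a : ℂ[X]) = 1 * X + C (-a) := by simp [sub_eq_add_neg]
          rw [h1, reverse_add_C, one_mul, hX, mul_sub, ← C_mul]
          simp [ha]
          ring
        rw [this, roots_C_mul _ (neg_ne_zero.mpr ha), roots_X_sub_C, Multiset.singleton_add]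
  by_cases hf : f = 0
  · simp [hf]
  have h := (IsAlgClosed.splits f).eq_prod_roots
  conv_lhs => rw [h]
  rw [reverse_mul_of_domain, reverse_C, roots_C_mul _ (leadingCoeff_ne_zero.mpr hf), hprod]

/-- Polynomials that agree with their conjugate-reciprocal polynomial of formal degree `2 m`. -/
def IsSelfReciprocal (m : ℕ) (f : ℂ[X]) : Prop :=
  f.natDegree ≤ 2 * m ∧ reflect (2 * m) (f.map (starRingEnd ℂ)) = f

namespace IsSelfReciprocal

theorem mul {m n : ℕ} {f g : ℂ[X]} (hf : IsSelfReciprocal m f) (hg : IsSelfReciprocal n g) :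
    IsSelfReciprocal (m + n) (f * g) := by
  refine ⟨natDegree_mul_le.trans (by have := hf.1; have := hg.1; omega), ?_⟩
  rw [Polynomial.map_mul, mul_add, reflect_mul _ _ (by simpa using hf.1) (by simpa using hg.1),
    hf.2, hg.2]

theorem add {m : ℕ} {f g : ℂ[X]} (hf : IsSelfReciprocal m f) (hg : IsSelfReciprocal m g) :
    IsSelfReciprocal m (f + g) :=
  ⟨natDegree_add_le_of_degree_le hf.1 hg.1, by rw [Polynomial.map_add, reflect_add, hf.2, hg.2]⟩

theorem real_mul {m : ℕ} {f : ℂ[X]} (hf : IsSelfReciprocal m f) (r : ℝ) :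
    IsSelfReciprocal m (C (r : ℂ) * f) :=
  ⟨(natDegree_C_mul_le _ _).trans hf.1, by
    rw [Polynomial.map_mul, map_C, Complex.conj_ofReal, reflect_C_mul, hf.2]⟩

theorem one : IsSelfReciprocal 0 1 := by simp [IsSelfReciprocal]

theorem zero (m : ℕ) : IsSelfReciprocal m 0 := by simp [IsSelfReciprocal]

theorem X_sub_C_mul (a : ℂ) : IsSelfReciprocal 1 ((X - C a) * (1 - C (conj a) * X)) := by
  have h1 : ∀ b : ℂ, (X - C b : ℂ[X]).natDegree ≤ 1 := fun b => (natDegree_X_sub_C b).le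
  have h2 : ∀ b : ℂ, (1 - C b * X : ℂ[X]).natDegree ≤ 1 := fun b =>
    (natDegree_sub_le _ _).trans
      (by simpa using (natDegree_C_mul_le b X).trans natDegree_X_le)
  refine ⟨natDegree_mul_le.trans (by have := h1 a; have := h2 (conj a); omega), ?_⟩
  simp only [Polynomial.map_mul, Polynomial.map_sub, map_X, map_C, Polynomial.map_one,
    Complex.conj_conj]
  rw [show 2 * 1 = 1 + 1 from rfl, reflect_mul _ _ (h1 _) (h2 _), reflect_sub, reflect_sub,
    reflect_C_mul, reflect_one_X, reflect_C, reflect_one]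
  ring

/-- The zeros are symmetric under reflection in the unit circle. The gap between `2 * m` and the
actual degree counts the zeros at infinity, which are mirrored by zeros at 0. -/
theorem roots_eq {m : ℕ} {f : ℂ[X]} (hf : IsSelfReciprocal m f) (h0 : f ≠ 0) :
    f.roots = (2 * m - f.natDegree) • {0} +
      (f.roots.filter (· ≠ 0)).map fun z => (conj z)⁻¹ := by
  set g := f.map (starRingEnd ℂ) with hg
  have hgd : g.natDegree = f.natDegree := natDegree_map _
  have hg0 : g ≠ 0 := (Polynomial.map_ne_zero_iff (RingHom.injective _)).mpr h0
  have h1 : f = g.reverse * X ^ (2 * m - f.natDegree) := by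
    have h2 : reflect (f.natDegree + (2 * m - f.natDegree)) (g * 1) = f := by
      rw [Nat.add_sub_cancel' hf.1, mul_one]; exact hf.2
    rw [reflect_mul _ _ hgd.le (by simp), reflect_one, ← hgd] at h2
    rw [hgd] at h2
    conv_lhs => rw [← h2]
    rw [reverse, hgd]
  have h3 : g.roots = f.roots.map (starRingEnd ℂ) :=
    ((IsAlgClosed.splits f).roots_map (starRingEnd ℂ))
  conv_lhs => rw [h1]
  rw [roots_mul (mul_ne_zero (by simpa using hg0) (pow_ne_zero _ X_ne_zero)), roots_X_pow,
    roots_reverse, h3, add_comm, Multiset.filter_map, Multiset.map_map]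
  congr 2
  refine Multiset.filter_congr fun z _ => ?_
  simp

/-- A self-reciprocal polynomial without zeros on the unit circle has as many zeros inside as
outside. -/
theorem card_roots_filter {m : ℕ} {f : ℂ[X]} (hf : IsSelfReciprocal m f)
    (h1 : ∀ z, ‖z‖ = 1 → f.eval z ≠ 0) : (f.roots.filter (‖·‖ < 1)).card = m := by
  have h0 : f ≠ 0 := by rintro rfl; exact h1 1 (by simp) (by simp)
  have hd := (IsAlgClosed.splits f).natDegree_eq_card_roots
  have hsplit : f.roots.card = (f.roots.filter (‖·‖ < 1)).card +
      (f.roots.filter (1 < ‖·‖)).card := by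
    conv_lhs => rw [← Multiset.filter_add_not (‖·‖ < 1) f.roots]
    rw [Multiset.card_add]
    congr 2
    refine Multiset.filter_congr fun z hz => ?_
    have hne : ‖z‖ ≠ 1 := fun h => h1 z h (isRoot_of_mem_roots hz)
    rw [not_lt]
    exact ⟨fun h => lt_of_le_of_ne h (Ne.symm hne), le_of_lt⟩
  -- Zeros inside are reflections of zeros outside, those at 0 being reflections of the missing
  -- zeros at infinity. Together with the count of all zeros this leaves `m` inside.
  have hin : (f.roots.filter (‖·‖ < 1)).card = 2 * m - f.natDegree +
      (f.roots.filter (1 < ‖·‖)).card := by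
    conv_lhs => rw [hf.roots_eq h0]
    rw [Multiset.filter_add, Multiset.card_add, Multiset.filter_map, Multiset.card_map,
      Multiset.filter_filter]
    congr 1
    · rw [Multiset.filter_eq_self.mpr]
      · simp
      · intro a ha
        have := Multiset.mem_of_mem_nsmul ha
        simp only [Multiset.mem_singleton] at this
        simp [this]
    · congr 1
      refine Multiset.filter_congr fun z hz => ?_
      simp only [Function.comp_apply, norm_inv, RCLike.norm_conj]
      constructor
      · rintro ⟨h, hz0⟩
        have := norm_pos_iff.mpr hz0
        exact (inv_lt_one₀ this).mp h
      · intro h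
        have : 0 < ‖z‖ := by linarith
        exact ⟨inv_lt_one_of_one_lt₀ h, norm_pos_iff.mp this⟩
  have := hf.1
  omega

end IsSelfReciprocal

/-- The numerator of the finite Blaschke product with zeros `s`. -/
noncomputable def blaschkeNum (s : Multiset ℂ) : ℂ[X] := (s.map fun a => X - C a).prod

/-- The denominator of the finite Blaschke product with zeros `s`. -/
noncomputable def blaschkeDen (s : Multiset ℂ) : ℂ[X] := (s.map fun a => 1 - C (conj a) * X).prod

/-- The numerator of the derivative of the finite Blaschke product with zeros `s`. -/
noncomputable def blaschkeWronskian (s : Multiset ℂ) : ℂ[X] :=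
  derivative (blaschkeNum s) * blaschkeDen s - blaschkeNum s * derivative (blaschkeDen s)

theorem blaschkeNum_cons (a : ℂ) (s : Multiset ℂ) :
    blaschkeNum (a ::ₘ s) = (X - C a) * blaschkeNum s := by simp [blaschkeNum]

theorem blaschkeDen_cons (a : ℂ) (s : Multiset ℂ) :
    blaschkeDen (a ::ₘ s) = (1 - C (conj a) * X) * blaschkeDen s := by simp [blaschkeDen]

/-- The product rule for one more Blaschke factor, whose derivative has the constant numerator `1 -
‖a‖ ^ 2`. That this constant is real preserves self-reciprocity, and that it is positive for `‖a‖ <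
1` gives nonvanishing on the circle. -/
theorem blaschkeWronskian_cons (a : ℂ) (s : Multiset ℂ) :
    blaschkeWronskian (a ::ₘ s) = C (((1 - ‖a‖ ^ 2 : ℝ) : ℂ)) * (blaschkeNum s * blaschkeDen s) +
      (X - C a) * (1 - C (conj a) * X) * blaschkeWronskian s := by
  have h : (C (((1 - ‖a‖ ^ 2 : ℝ) : ℂ)) : ℂ[X]) = 1 - C (conj a) * C a := by
    rw [← C_mul, Complex.conj_mul']
    simp
  rw [h]
  simp only [blaschkeWronskian, blaschkeNum_cons, blaschkeDen_cons, derivative_mul, derivative_sub,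
    derivative_X, derivative_C, derivative_one]
  ring

theorem isSelfReciprocal_blaschkeNum_mul (s : Multiset ℂ) :
    IsSelfReciprocal s.card (blaschkeNum s * blaschkeDen s) := by
  induction s using Multiset.induction with
  | empty => simpa [blaschkeNum, blaschkeDen] using IsSelfReciprocal.one
  | cons a s ih =>
    rw [blaschkeNum_cons, blaschkeDen_cons, Multiset.card_cons, add_comm, mul_mul_mul_comm]
    exact (IsSelfReciprocal.X_sub_C_mul a).mul ih

theorem isSelfReciprocal_blaschkeWronskian (s : Multiset ℂ) :
    IsSelfReciprocal (s.card - 1) (blaschkeWronskian s) := by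
  induction s using Multiset.induction with
  | empty => simpa [blaschkeWronskian, blaschkeNum, blaschkeDen] using IsSelfReciprocal.zero 0
  | cons a s ih =>
    rw [blaschkeWronskian_cons, Multiset.card_cons, Nat.add_sub_cancel]
    refine ((isSelfReciprocal_blaschkeNum_mul s).real_mul _).add ?_
    -- The subtraction in `s.card - 1` is truncated, so the empty multiset is treated apart; its
    -- Wronskian is 0.
    rcases Nat.eq_zero_or_pos s.card with h | h
    · rw [Multiset.card_eq_zero] at h
      subst h
      simpa [blaschkeWronskian, blaschkeNum, blaschkeDen] using IsSelfReciprocal.zero 0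
    · have := (IsSelfReciprocal.X_sub_C_mul a).mul ih
      rwa [Nat.add_sub_cancel' h] at this

theorem eval_blaschkeNum (s : Multiset ℂ) (z : ℂ) :
    (blaschkeNum s).eval z = (s.map fun a => z - a).prod := by
  simp [blaschkeNum, eval_multiset_prod]

theorem eval_blaschkeDen (s : Multiset ℂ) (z : ℂ) :
    (blaschkeDen s).eval z = (s.map fun a => 1 - conj a * z).prod := by
  simp [blaschkeDen, eval_multiset_prod]

/-- On the circle `(z - a) * (1 - conj a * z) = ‖z - a‖ ^ 2 * z`. By induction, `z` times the
Wronskian is a positive multiple of `z ^ s.card`: the argument of a Blaschke product strictly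
increases along the circle. -/
theorem eval_blaschkeWronskian_ne_zero {s : Multiset ℂ} (hs : ∀ a ∈ s, ‖a‖ < 1) (h0 : s ≠ 0)
    {z : ℂ} (hz : ‖z‖ = 1) : (blaschkeWronskian s).eval z ≠ 0 := by
  have hcirc : ∀ a : ℂ, ‖a‖ < 1 → ∃ r : ℝ, 0 < r ∧ (z - a) * (1 - conj a * z) = r * z := by
    intro a ha
    refine ⟨‖z - a‖ ^ 2, ?_, ?_⟩
    · have : z - a ≠ 0 := sub_ne_zero.mpr fun h => by rw [h] at hz; linarith
      have := norm_pos_iff.mpr this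
      positivity
    · have h1 : conj z * z = 1 := by rw [Complex.conj_mul', hz]; simp
      rw [show ((‖z - a‖ ^ 2 : ℝ) : ℂ) = conj (z - a) * (z - a) by
        rw [Complex.conj_mul']; push_cast; rfl, map_sub]
      linear_combination (-(z - a)) * h1
  have hPQ : ∀ s : Multiset ℂ, (∀ a ∈ s, ‖a‖ < 1) → ∃ r : ℝ, 0 < r ∧
      (blaschkeNum s * blaschkeDen s).eval z = r * z ^ s.card := by
    intro s
    induction s using Multiset.induction with
    | empty => exact fun _ => ⟨1, one_pos, by simp [blaschkeNum, blaschkeDen]⟩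
    | cons a s ih =>
      intro hs
      obtain ⟨r, hr, e⟩ := ih fun b hb => hs b (Multiset.mem_cons_of_mem hb)
      obtain ⟨t, ht, e'⟩ := hcirc a (hs a (Multiset.mem_cons_self a s))
      refine ⟨t * r, by positivity, ?_⟩
      rw [blaschkeNum_cons, blaschkeDen_cons, mul_mul_mul_comm, eval_mul, e]
      simp only [eval_mul, eval_sub, eval_X, eval_C, eval_one]
      rw [e', Multiset.card_cons]
      push_cast
      ring
  have hR : ∀ s : Multiset ℂ, (∀ a ∈ s, ‖a‖ < 1) → ∃ r : ℝ, 0 ≤ r ∧ (s ≠ 0 → 0 < r) ∧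
      z * (blaschkeWronskian s).eval z = r * z ^ s.card := by
    intro s
    induction s using Multiset.induction with
    | empty => exact fun _ => ⟨0, le_rfl, by simp, by simp [blaschkeWronskian, blaschkeNum, blaschkeDen]⟩
    | cons a s ih =>
      intro hs
      obtain ⟨r, hr, -, e⟩ := ih fun b hb => hs b (Multiset.mem_cons_of_mem hb)
      obtain ⟨q, hq, e''⟩ := hPQ s fun b hb => hs b (Multiset.mem_cons_of_mem hb)
      have ha := hs a (Multiset.mem_cons_self a s)
      obtain ⟨t, ht, e'⟩ := hcirc a ha
      have ha2 : 0 < 1 - ‖a‖ ^ 2 := by nlinarith [norm_nonneg a]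
      have hpos : 0 < (1 - ‖a‖ ^ 2) * q + t * r := by positivity
      refine ⟨(1 - ‖a‖ ^ 2) * q + t * r, hpos.le, fun _ => hpos, ?_⟩
      rw [blaschkeWronskian_cons, eval_add, eval_mul, e'']
      simp only [eval_mul, eval_sub, eval_X, eval_C, eval_one]
      rw [e', Multiset.card_cons]
      push_cast
      linear_combination (t : ℂ) * z * e
  obtain ⟨r, -, hr, e⟩ := hR s hs
  intro h
  rw [h, mul_zero] at e
  have hz0 : z ≠ 0 := by rintro rfl; simp at hz
  have := mul_ne_zero (Complex.ofReal_ne_zero.mpr (hr h0).ne') (pow_ne_zero s.card hz0)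
  exact this e.symm

end Polynomial

/-! ### Inner functions and finite Blaschke products -/

/-- Holomorphic functions on the unit disk whose modulus tends to `1` at the unit circle. -/
structure IsInner (g : ℂ → ℂ) : Prop where
  differentiableOn : DifferentiableOn ℂ g (ball 0 1)
  tendsto : Tendsto (fun z => ‖g z‖) (comap norm (𝓝[<] (1 : ℝ))) (𝓝 1)

namespace IsInner

theorem eventually_mem : ∀ᶠ z : ℂ in comap norm (𝓝[<] (1 : ℝ)), ‖z‖ < 1 :=
  tendsto_comap.eventually self_mem_nhdsWithin

theorem eventually_lt {ρ : ℝ} (h : ρ < 1) : ∀ᶠ z : ℂ in comap norm (𝓝[<] (1 : ℝ)), ρ < ‖z‖ :=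
  tendsto_comap.eventually (mem_nhdsWithin_of_mem_nhds (lt_mem_nhds h))

theorem exists_forall {P : ℂ → Prop} (h : ∀ᶠ z in comap norm (𝓝[<] (1 : ℝ)), P z) :
    ∃ ρ < 1, ∀ z : ℂ, ρ < ‖z‖ → ‖z‖ < 1 → P z := by
  obtain ⟨t, ht, h⟩ := mem_comap.mp h
  obtain ⟨ρ, hρ, hs⟩ := mem_nhdsLT_iff_exists_Ioo_subset.mp ht
  exact ⟨ρ, hρ, fun z h1 h2 => h (hs ⟨h1, h2⟩)⟩

/-- Maximum principle on disks of radius close to 1, on whose boundary the modulus is at most `1 +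
ε`. -/
theorem norm_le_one {g : ℂ → ℂ} (hg : IsInner g) {z : ℂ} (hz : ‖z‖ < 1) : ‖g z‖ ≤ 1 := by
  refine le_of_forall_pos_le_add fun ε hε => ?_
  obtain ⟨ρ, hρ, h⟩ := exists_forall (hg.tendsto.eventually (gt_mem_nhds (lt_add_of_pos_right 1 hε)))
  obtain ⟨r, hr, hr1⟩ := exists_between (max_lt (max_lt hρ hz) one_pos)
  have hr0 : 0 < r := lt_of_le_of_lt (le_max_right _ _) hr
  have hρr : ρ < r := lt_of_le_of_lt ((le_max_left _ _).trans (le_max_left _ _)) hr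
  have hzr : ‖z‖ < r := lt_of_le_of_lt ((le_max_right _ _).trans (le_max_left _ _)) hr
  have hsub : closedBall (0 : ℂ) r ⊆ ball 0 1 := closedBall_subset_ball hr1
  refine Complex.norm_le_of_forall_mem_frontier_norm_le (isBounded_ball (x := (0 : ℂ)) (r := r))
    ?_ (fun w hw => ?_) (subset_closure (mem_ball_zero_iff.mpr hzr))
  · apply DifferentiableOn.diffContOnCl
    rw [closure_ball _ hr0.ne']
    exact hg.differentiableOn.mono hsub
  · rw [frontier_ball _ hr0.ne', mem_sphere_zero_iff_norm] at hw
    exact (h w (by rw [hw]; exact hρr) (by rw [hw]; exact hr1)).le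

/-- A squeeze: `1 - ‖diskMobius a z‖ ^ 2` equals `(1 - ‖a‖ ^ 2) * (1 - ‖z‖ ^ 2) / ‖1 - conj a * z‖ ^
2`, whose denominator is bounded below, and the modulus is at least its square. -/
theorem tendsto_norm_diskMobius {a : ℂ} (ha : ‖a‖ < 1) :
    Tendsto (fun z => ‖diskMobius a z‖) (comap norm (𝓝[<] (1 : ℝ))) (𝓝 1) := by
  have h1 : Tendsto (fun z : ℂ => 1 - 2 * (1 - ‖z‖ ^ 2) / (1 - ‖a‖) ^ 2)
      (comap norm (𝓝[<] (1 : ℝ))) (𝓝 1) := by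
    have : Tendsto (fun t : ℝ => 1 - 2 * (1 - t ^ 2) / (1 - ‖a‖) ^ 2) (𝓝 1) (𝓝 1) := by
      have hc : Continuous fun t : ℝ => 1 - 2 * (1 - t ^ 2) / (1 - ‖a‖) ^ 2 := by fun_prop
      simpa using hc.tendsto 1
    exact (this.mono_left nhdsWithin_le_nhds).comp tendsto_comap
  refine tendsto_of_tendsto_of_tendsto_of_le_of_le' h1 tendsto_const_nhds ?_ ?_
  · filter_upwards [eventually_mem] with z hz
    have h0 := norm_pos_iff.mpr (one_sub_conj_mul_ne_zero ha hz.le)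
    have hle : 1 - ‖a‖ ≤ ‖1 - conj a * z‖ := by
      have := norm_sub_norm_le (1 : ℂ) (conj a * z)
      rw [norm_one, norm_mul, RCLike.norm_conj] at this
      nlinarith [norm_nonneg a, norm_nonneg z]
    have hid := normSq_one_sub_conj_mul_sub a z
    have hlt := norm_diskMobius_lt_one ha hz
    have hz2 : 0 ≤ 1 - ‖z‖ ^ 2 := by nlinarith [norm_nonneg z]
    have ha1 : 0 < 1 - ‖a‖ := by linarith
    have hsq : ‖diskMobius a z‖ ^ 2 = 1 - (1 - ‖a‖ ^ 2) * (1 - ‖z‖ ^ 2) / ‖1 - conj a * z‖ ^ 2 := by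
      rw [diskMobius, norm_div, div_pow, ← hid, eq_sub_iff_add_eq, ← add_div, add_sub_cancel,
        div_self (pow_pos h0 2).ne']
    have hb : (1 - ‖a‖ ^ 2) * (1 - ‖z‖ ^ 2) / ‖1 - conj a * z‖ ^ 2 ≤
        2 * (1 - ‖z‖ ^ 2) / (1 - ‖a‖) ^ 2 := by
      gcongr
      nlinarith [norm_nonneg a]
    nlinarith [norm_nonneg (diskMobius a z)]
  · filter_upwards [eventually_mem] with z hz using (norm_diskMobius_lt_one ha hz).le

/-- Dividing an inner function by a disk automorphism at one of its zeros. -/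
theorem exists_eq_diskMobius_mul {g : ℂ → ℂ} (hg : IsInner g) {a : ℂ} (ha : ‖a‖ < 1)
    (h0 : g a = 0) : ∃ k, IsInner k ∧ ∀ z, ‖z‖ < 1 → g z = diskMobius a z * k z := by
  have hab : ball (0 : ℂ) 1 ∈ 𝓝 a := isOpen_ball.mem_nhds (mem_ball_zero_iff.mpr ha)
  have key : ∀ z, ‖z‖ < 1 → g z = diskMobius a z * (dslope g a z * (1 - conj a * z)) := by
    intro z hz
    have h1 := one_sub_conj_mul_ne_zero ha hz.le
    have h2 := sub_smul_dslope g a z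
    rw [h0, sub_zero, smul_eq_mul] at h2
    rw [← h2, diskMobius, div_mul_eq_mul_div, eq_div_iff h1]
    ring
  refine ⟨fun z => dslope g a z * (1 - conj a * z), ⟨?_, ?_⟩, key⟩
  · exact ((Complex.differentiableOn_dslope hab).mpr hg.differentiableOn).mul (by fun_prop)
  · have := hg.tendsto.div (tendsto_norm_diskMobius ha) one_ne_zero
    rw [div_one] at this
    refine this.congr' ?_
    filter_upwards [eventually_mem, eventually_lt ha] with z hz haz
    have : diskMobius a z ≠ 0 := fun h => by
      rw [(diskMobius_eq_zero_iff ha hz.le).mp h] at haz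
      exact lt_irrefl _ haz
    rw [Pi.div_apply, key z hz, norm_mul, mul_div_cancel_left₀ _ (norm_ne_zero_iff.mpr this)]

/-- Without zeros the reciprocal is inner too, so the modulus is identically 1, and the maximum
principle makes the function constant. -/
theorem exists_eq_const {g : ℂ → ℂ} (hg : IsInner g) (h0 : ∀ z, ‖z‖ < 1 → g z ≠ 0) :
    ∃ c : ℂ, ‖c‖ = 1 ∧ ∀ z, ‖z‖ < 1 → g z = c := by
  have hi : IsInner fun z => (g z)⁻¹ :=
    ⟨hg.differentiableOn.inv fun z hz => h0 z (mem_ball_zero_iff.mp hz), by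
      simpa using hg.tendsto.inv₀ one_ne_zero⟩
  have h1 : ∀ z, ‖z‖ < 1 → ‖g z‖ = 1 := by
    intro z hz
    refine le_antisymm (hg.norm_le_one hz) ?_
    have := hi.norm_le_one hz
    rw [norm_inv] at this
    exact (inv_le_one₀ (norm_pos_iff.mpr (h0 z hz))).mp this
  refine ⟨g 0, h1 0 (by simp), fun z hz => ?_⟩
  refine Complex.eqOn_of_isPreconnected_of_isMaxOn_norm (convex_ball (0 : ℂ) 1).isPreconnected
    isOpen_ball hg.differentiableOn (mem_ball_self one_pos) (fun w hw => ?_)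
    (mem_ball_zero_iff.mpr hz)
  simp [h1 0 (by simp), h1 w (mem_ball_zero_iff.mp hw)]

/-- An inner function that is continuous up to the circle in modulus is a finite Blaschke
product. -/
theorem exists_eq_prod {g : ℂ → ℂ} (hg : IsInner g) : ∃ (c : ℂ) (s : Multiset ℂ), ‖c‖ = 1 ∧
    (∀ a ∈ s, ‖a‖ < 1) ∧ ∀ z, ‖z‖ < 1 → g z = c * (s.map fun a => diskMobius a z).prod := by
  obtain ⟨ρ, hρ, hz⟩ := exists_forall (hg.tendsto.eventually (lt_mem_nhds (zero_lt_one (α := ℝ))))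
  obtain ⟨z₀, hz₀, hgz₀⟩ : ∃ z₀ : ℂ, ‖z₀‖ < 1 ∧ g z₀ ≠ 0 := by
    obtain ⟨r, hr, hr1⟩ := exists_between (max_lt hρ (zero_lt_one (α := ℝ)))
    have hr0 : 0 < r := lt_of_le_of_lt (le_max_right _ _) hr
    have hn : ‖(r : ℂ)‖ = r := by simp [abs_of_pos hr0]
    exact ⟨r, by rwa [hn], norm_pos_iff.mp (hz r (by rw [hn]; exact (le_max_left _ _).trans_lt hr)
      (by rwa [hn]))⟩
  -- All zeros of `g` lie in the closed disk of radius `ρ`. By compactness one `κ < 1` bounds at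
  -- `z₀` every Möbius factor that can be divided out.
  obtain ⟨κ, hκ0, hκ1, hκ⟩ : ∃ κ : ℝ, 0 ≤ κ ∧ κ < 1 ∧ ∀ a : ℂ, ‖a‖ ≤ ρ → ‖diskMobius a z₀‖ ≤ κ := by
    by_cases hne : (closedBall (0 : ℂ) ρ).Nonempty
    · have hcont : ContinuousOn (fun a => ‖diskMobius a z₀‖) (closedBall (0 : ℂ) ρ) := by
        refine ContinuousOn.norm (ContinuousOn.div (by fun_prop)
          (continuousOn_const.sub (Complex.continuous_conj.continuousOn.mul continuousOn_const))
          fun a ha => ?_)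
        exact one_sub_conj_mul_ne_zero ((mem_closedBall_zero_iff.mp ha).trans_lt hρ) hz₀.le
      obtain ⟨a, ha, hmax⟩ := (isCompact_closedBall (0 : ℂ) ρ).exists_isMaxOn hne hcont
      exact ⟨_, norm_nonneg _, norm_diskMobius_lt_one
        ((mem_closedBall_zero_iff.mp ha).trans_lt hρ) hz₀,
        fun b hb => hmax (mem_closedBall_zero_iff.mpr hb)⟩
    · exact ⟨0, le_rfl, one_pos, fun a ha => absurd ⟨a, mem_closedBall_zero_iff.mpr ha⟩ hne⟩
  -- Each division by a zero factor multiplies the modulus at `z₀` by at least `1 / κ`, while the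
  -- quotient remains inner and so bounded by 1. Hence fewer than `n` divisions are possible.
  have key : ∀ (n : ℕ) (k : ℂ → ℂ), IsInner k → (∀ z, ‖z‖ < 1 → k z = 0 → g z = 0) →
      κ ^ n < ‖k z₀‖ → ∃ (c : ℂ) (s : Multiset ℂ), ‖c‖ = 1 ∧
        (∀ a ∈ s, ‖a‖ < 1) ∧ ∀ z, ‖z‖ < 1 → k z = c * (s.map fun a => diskMobius a z).prod := by
    intro n
    induction n with
    | zero =>
      intro k hk _ h
      exact absurd (hk.norm_le_one hz₀) (by simpa using h)
    | succ n ih =>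
      intro k hk hkg hlt
      by_cases h0 : ∀ z, ‖z‖ < 1 → k z ≠ 0
      · obtain ⟨c, hc, h⟩ := hk.exists_eq_const h0
        exact ⟨c, 0, hc, by simp, by simpa using h⟩
      push Not at h0
      obtain ⟨a, ha, hka⟩ := h0
      obtain ⟨k', hk', e⟩ := hk.exists_eq_diskMobius_mul ha hka
      have haρ : ‖a‖ ≤ ρ := by
        by_contra! h
        have := hz a h ha
        rw [hkg a ha hka] at this
        simp at this
      have hlt' : κ ^ n < ‖k' z₀‖ := by
        rw [e z₀ hz₀, norm_mul, pow_succ'] at hlt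
        have h1 : ‖diskMobius a z₀‖ * ‖k' z₀‖ ≤ κ * ‖k' z₀‖ := by
          gcongr
          exact hκ a haρ
        exact lt_of_mul_lt_mul_left (hlt.trans_le h1) hκ0
      obtain ⟨c, s, hc, hs, h⟩ := ih k' hk' (fun z hz1 h => hkg z hz1 (by rw [e z hz1, h, mul_zero]))
        hlt'
      refine ⟨c, a ::ₘ s, hc, by simpa using ⟨ha, hs⟩, fun z hz1 => ?_⟩
      rw [e z hz1, h z hz1, Multiset.map_cons, Multiset.prod_cons]
      ring
  obtain ⟨n, hn⟩ := exists_pow_lt_of_lt_one (norm_pos_iff.mpr hgz₀) hκ1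
  exact key n g hg (fun _ _ h => h) hn

end IsInner

/-- Proper holomorphic self-maps of the unit disk. -/
structure IsDiskProper (h : ℂ → ℂ) : Prop where
  differentiableOn : DifferentiableOn ℂ h (ball 0 1)
  mapsTo : MapsTo h (ball 0 1) (ball 0 1)
  isCompact : ∀ ρ < 1, IsCompact (ball 0 1 ∩ {z | ‖h z‖ ≤ ρ})

/-- A compact sublevel set stays away from the circle, so the modulus exceeds any `ρ < 1` near the
circle. -/
theorem IsDiskProper.isInner {h : ℂ → ℂ} (hh : IsDiskProper h) : IsInner h := by
  refine ⟨hh.differentiableOn, tendsto_order.mpr ⟨fun ρ hρ => ?_, fun ρ hρ => ?_⟩⟩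
  · obtain ⟨R, hR1, hR⟩ : ∃ R < 1, ∀ z ∈ ball (0 : ℂ) 1 ∩ {z | ‖h z‖ ≤ ρ}, ‖z‖ ≤ R := by
      by_cases hne : (ball (0 : ℂ) 1 ∩ {z | ‖h z‖ ≤ ρ}).Nonempty
      · obtain ⟨z, hz, hmax⟩ := (hh.isCompact ρ hρ).exists_isMaxOn hne continuous_norm.continuousOn
        exact ⟨‖z‖, mem_ball_zero_iff.mp hz.1, fun w hw => hmax hw⟩
      · exact ⟨0, one_pos, fun z hz => absurd ⟨z, hz⟩ hne⟩
    filter_upwards [IsInner.eventually_mem, IsInner.eventually_lt hR1] with z hz hzR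
    by_contra! hle
    exact absurd (hR z ⟨mem_ball_zero_iff.mpr hz, hle⟩) (not_le.mpr hzR)
  · filter_upwards [IsInner.eventually_mem] with z hz
    exact (mem_ball_zero_iff.mp (hh.mapsTo (mem_ball_zero_iff.mpr hz))).trans hρ

/-! ### Degree, fibres and critical points of proper self-maps of the disk -/

namespace Polynomial

theorem analyticOrderAt_eval {p : ℂ[X]} (hp : p ≠ 0) (z : ℂ) :
    analyticOrderAt (fun w => p.eval w) z = p.rootMultiplicity z := by
  rw [AnalyticAt.analyticOrderAt_eq_natCast (AnalyticOnNhd.eval_polynomial p z (mem_univ z))]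
  obtain ⟨q, hq, hqz⟩ := exists_eq_pow_rootMultiplicity_mul_and_not_dvd p hp z
  refine ⟨fun w => q.eval w, AnalyticOnNhd.eval_polynomial q z (mem_univ z), ?_, ?_⟩
  · rwa [dvd_iff_isRoot] at hqz
  · refine Eventually.of_forall fun w => ?_
    conv_lhs => rw [hq]
    simp

/-- Factor by factor, `‖1 - conj a * z‖ ≤ ‖z - a‖` outside the disk. This keeps all solutions of
"Blaschke product = v" with `‖v‖ < 1` inside the disk. -/
theorem norm_eval_blaschkeDen_le {s : Multiset ℂ} (hs : ∀ a ∈ s, ‖a‖ < 1) {z : ℂ} (hz : 1 ≤ ‖z‖) :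
    ‖(blaschkeDen s).eval z‖ ≤ ‖(blaschkeNum s).eval z‖ := by
  induction s using Multiset.induction with
  | empty => simp [blaschkeDen, blaschkeNum]
  | cons a s ih =>
    rw [blaschkeDen_cons, blaschkeNum_cons, eval_mul, eval_mul, norm_mul, norm_mul]
    refine mul_le_mul ?_ (ih fun b hb => hs b (Multiset.mem_cons_of_mem hb)) (norm_nonneg _)
      (norm_nonneg _)
    simp only [eval_sub, eval_mul, eval_one, eval_C, eval_X]
    have h := normSq_one_sub_conj_mul_sub a z
    have ha := hs a (Multiset.mem_cons_self a s)
    have : 0 ≤ (1 - ‖a‖ ^ 2) * (‖z‖ ^ 2 - 1) :=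
      mul_nonneg (by nlinarith [norm_nonneg a]) (by nlinarith)
    exact le_of_sq_le_sq (by linarith) (norm_nonneg _)

theorem blaschkeDen_natDegree_le (s : Multiset ℂ) : (blaschkeDen s).natDegree ≤ s.card := by
  induction s using Multiset.induction with
  | empty => simp [blaschkeDen]
  | cons a s ih =>
    rw [blaschkeDen_cons, Multiset.card_cons, add_comm]
    refine natDegree_mul_le.trans (add_le_add ?_ ih)
    exact (natDegree_sub_le _ _).trans (by simpa using (natDegree_C_mul_le _ X).trans natDegree_X_le)

/-- Up to sign this coefficient is the product of the conjugates of the zeros. The bound prevents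
the leading term of the fibre polynomial from cancelling. -/
theorem norm_coeff_blaschkeDen_le {s : Multiset ℂ} (hs : ∀ a ∈ s, ‖a‖ < 1) :
    ‖(blaschkeDen s).coeff s.card‖ ≤ 1 := by
  induction s using Multiset.induction with
  | empty => simp [blaschkeDen]
  | cons a s ih =>
    have h1 : (blaschkeDen s).coeff (s.card + 1) = 0 :=
      coeff_eq_zero_of_natDegree_lt (Nat.lt_succ_of_le (blaschkeDen_natDegree_le s))
    rw [blaschkeDen_cons, Multiset.card_cons, sub_mul, one_mul, mul_assoc, coeff_sub, h1,
      coeff_C_mul, coeff_X_mul, zero_sub, norm_neg, norm_mul, RCLike.norm_conj]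
    have ha := hs a (Multiset.mem_cons_self a s)
    have := ih fun b hb => hs b (Multiset.mem_cons_of_mem hb)
    nlinarith [norm_nonneg a, norm_nonneg ((blaschkeDen s).coeff s.card)]

theorem blaschkeNum_monic (s : Multiset ℂ) : (blaschkeNum s).Monic :=
  monic_multiset_prod_of_monic _ _ fun a _ => monic_X_sub_C a

theorem natDegree_blaschkeNum (s : Multiset ℂ) : (blaschkeNum s).natDegree = s.card := by
  simp [blaschkeNum]

theorem eval_blaschkeDen_ne_zero {s : Multiset ℂ} (hs : ∀ a ∈ s, ‖a‖ < 1) {z : ℂ} (hz : ‖z‖ ≤ 1) :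
    (blaschkeDen s).eval z ≠ 0 := by
  rw [eval_blaschkeDen]
  refine Multiset.prod_ne_zero ?_
  simp only [Multiset.mem_map, not_exists, not_and]
  exact fun a ha => one_sub_conj_mul_ne_zero (hs a ha) hz

theorem eval_blaschkeNum_ne_zero {s : Multiset ℂ} (hs : ∀ a ∈ s, ‖a‖ < 1) {z : ℂ} (hz : 1 ≤ ‖z‖) :
    (blaschkeNum s).eval z ≠ 0 := by
  rw [eval_blaschkeNum]
  refine Multiset.prod_ne_zero ?_
  simp only [Multiset.mem_map, not_exists, not_and, sub_eq_zero]
  rintro a ha rfl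
  exact absurd (hs z ha) (not_lt.mpr hz)

end Polynomial

/-- The degree of a proper holomorphic self-map of the disk, its critical points counted with
multiplicity, and the size of its fibres. -/
theorem IsDiskProper.exists_degree {h : ℂ → ℂ} (hh : IsDiskProper h) :
    ∃ (k : ℕ) (M : Multiset ℂ), M.card + 1 = k ∧ (∀ z ∈ M, ‖z‖ < 1) ∧
      (∀ z, ‖z‖ < 1 → analyticOrderAt (deriv h) z = M.count z) ∧
      (∀ v, ‖v‖ < 1 → {z | ‖z‖ < 1 ∧ h z = v}.Finite) ∧
      ∀ v, ‖v‖ < 1 → (∀ z ∈ M, h z ≠ v) → {z | ‖z‖ < 1 ∧ h z = v}.ncard = k := by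
  obtain ⟨c, s, hc, hs, e⟩ := hh.isInner.exists_eq_prod
  have hc0 : c ≠ 0 := norm_ne_zero_iff.mp (by rw [hc]; exact one_ne_zero)
  have hs0 : s ≠ 0 := by
    rintro rfl
    have := hh.mapsTo (mem_ball_self one_pos)
    rw [e 0 (by simp), mem_ball_zero_iff] at this
    simp [hc] at this
  set P := blaschkeNum s with hP
  set Q := blaschkeDen s with hQ
  set R := blaschkeWronskian s with hR
  have hQ0 : ∀ z : ℂ, ‖z‖ < 1 → Q.eval z ≠ 0 := fun z hz => eval_blaschkeDen_ne_zero hs hz.le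
  have e1 : ∀ z, ‖z‖ < 1 → h z = c * (P.eval z / Q.eval z) := by
    intro z hz
    rw [e z hz, hP, hQ, eval_blaschkeNum, eval_blaschkeDen, ← Multiset.prod_map_div]
    rfl
  have hR0 : R ≠ 0 := by
    intro h0
    exact eval_blaschkeWronskian_ne_zero hs hs0 (z := 1) (by simp) (by rw [← hR, h0, eval_zero])
  have e2 : ∀ z, ‖z‖ < 1 → deriv h z = c / (Q.eval z) ^ 2 * R.eval z := by
    intro z hz
    have hev : h =ᶠ[𝓝 z] fun w => c * (P.eval w / Q.eval w) := by
      filter_upwards [isOpen_ball.mem_nhds (mem_ball_zero_iff.mpr hz)] with w hw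
      exact e1 w (mem_ball_zero_iff.mp hw)
    rw [hev.deriv_eq]
    have := ((P.hasDerivAt z).fun_div (Q.hasDerivAt z) (hQ0 z hz)).const_mul c
    rw [this.deriv, hR, blaschkeWronskian, eval_sub, eval_mul, eval_mul]
    ring
  have hM := isSelfReciprocal_blaschkeWronskian s
  have hMc := hM.card_roots_filter fun z hz => eval_blaschkeWronskian_ne_zero hs hs0 hz
  have hcard : 0 < s.card := Multiset.card_pos.mpr hs0
  -- The zeros of this polynomial are exactly the fibre over `v`: outside the disk the denominator
  -- is dominated by the nonvanishing numerator. Its degree is `s.card` for every `v` in the disk.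
  set f : ℂ → ℂ[X] := fun v => C c * P - C v * Q with hf
  have hfz : ∀ v, ‖v‖ < 1 → ∀ z, (f v).eval z = 0 → ‖z‖ < 1 := by
    intro v hv z hz
    by_contra! h1
    have h2 : ‖Q.eval z‖ ≤ ‖P.eval z‖ := norm_eval_blaschkeDen_le hs h1
    have h3 : 0 < ‖P.eval z‖ := norm_pos_iff.mpr (eval_blaschkeNum_ne_zero hs h1)
    simp only [hf, eval_sub, eval_mul, eval_C, sub_eq_zero] at hz
    have h4 := congrArg norm hz
    rw [norm_mul, norm_mul, hc, one_mul] at h4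
    rw [h4] at h2 h3
    have h5 : 0 < ‖Q.eval z‖ := pos_of_mul_pos_right h3 (norm_nonneg v)
    nlinarith
  have hset : ∀ v, ‖v‖ < 1 → {z | ‖z‖ < 1 ∧ h z = v} = {z | (f v).eval z = 0} := by
    intro v hv
    ext z
    simp only [mem_ofPred_eq]
    have key : ∀ hz : ‖z‖ < 1, (h z = v ↔ (f v).eval z = 0) := by
      intro hz
      rw [e1 z hz, ← mul_div_assoc, div_eq_iff (hQ0 z hz)]
      simp [hf, sub_eq_zero]
    exact ⟨fun ⟨hz, hv⟩ => (key hz).mp hv, fun h0 => ⟨hfz v hv z h0, (key (hfz v hv z h0)).mpr h0⟩⟩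
  have hcoeff : ∀ v, ‖v‖ < 1 → (f v).coeff s.card ≠ 0 := by
    intro v hv h0
    have h1 : P.coeff s.card = 1 := by
      rw [← natDegree_blaschkeNum s]
      exact blaschkeNum_monic s
    simp only [hf, coeff_sub, coeff_C_mul, h1, mul_one, sub_eq_zero] at h0
    have h2 := norm_coeff_blaschkeDen_le hs
    have h3 := congrArg norm h0
    rw [norm_mul, hc] at h3
    nlinarith [norm_nonneg v, norm_nonneg (Q.coeff s.card)]
  have hf0 : ∀ v, ‖v‖ < 1 → f v ≠ 0 := fun v hv h0 => hcoeff v hv (by rw [h0, coeff_zero])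
  have hroots : ∀ v, ‖v‖ < 1 → {z | ‖z‖ < 1 ∧ h z = v} = ((f v).roots.toFinset : Set ℂ) := by
    intro v hv
    rw [hset v hv]
    ext z
    simp [hf0 v hv]
  -- Riemann–Hurwitz: the Wronskian has formal degree `2 * (s.card - 1)` and no zeros on the circle,
  -- so `s.card - 1` zeros lie inside.
  refine ⟨s.card, R.roots.filter (‖·‖ < 1), by rw [hMc]; omega, fun z hz => ?_, fun z hz => ?_,
    fun v hv => ?_, fun v hv hM => ?_⟩
  · exact (Multiset.mem_filter.mp hz).2
  · have hev : deriv h =ᶠ[𝓝 z] (fun w => c / (Q.eval w) ^ 2) * fun w => R.eval w := by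
      filter_upwards [isOpen_ball.mem_nhds (mem_ball_zero_iff.mpr hz)] with w hw
      exact e2 w (mem_ball_zero_iff.mp hw)
    have han : AnalyticAt ℂ (fun w => c / (Q.eval w) ^ 2) z :=
      analyticAt_const.div ((AnalyticOnNhd.eval_polynomial Q z (mem_univ z)).pow 2)
        (pow_ne_zero 2 (hQ0 z hz))
    rw [analyticOrderAt_congr hev, analyticOrderAt_mul han
      (AnalyticOnNhd.eval_polynomial R z (mem_univ z)), analyticOrderAt_eval hR0,
      han.analyticOrderAt_eq_zero.mpr (div_ne_zero hc0 (pow_ne_zero 2 (hQ0 z hz))), zero_add,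
      Multiset.count_filter_of_pos (p := fun w : ℂ => ‖w‖ < 1) hz, count_roots]
  · rw [hroots v hv]
    exact Finset.finite_toSet _
  · have hdeg : (f v).natDegree = s.card := by
      refine le_antisymm ((natDegree_sub_le _ _).trans (max_le ?_ ?_))
        (le_natDegree_of_ne_zero (hcoeff v hv))
      · exact (natDegree_C_mul_le _ _).trans (natDegree_blaschkeNum s).le
      · exact (natDegree_C_mul_le _ _).trans (blaschkeDen_natDegree_le s)
    -- A double zero would make the values and the derivatives of numerator and denominator
    -- proportional, hence would be a zero of the Wronskian, that is a critical point over `v`.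
    have hnodup : (f v).roots.Nodup := by
      refine Multiset.nodup_iff_count_le_one.mpr fun z => ?_
      rw [count_roots]
      by_contra! hlt
      obtain ⟨h1, h2⟩ := (one_lt_rootMultiplicity_iff_isRoot (hf0 v hv)).mp hlt
      have hz := hfz v hv z h1
      simp only [IsRoot, hf, derivative_sub, derivative_C_mul, eval_sub, eval_mul, eval_C] at h1 h2
      refine hM z (Multiset.mem_filter.mpr ⟨(mem_roots hR0).mpr ?_, hz⟩)
        (show z ∈ {z | ‖z‖ < 1 ∧ h z = v} by rw [hset v hv]; simpa [hf] using h1).2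
      rw [IsRoot, hR, blaschkeWronskian, eval_sub, eval_mul, eval_mul]
      apply mul_left_cancel₀ hc0
      rw [mul_zero]
      linear_combination Q.eval z * h2 - (derivative Q).eval z * h1
    rw [hroots v hv, ncard_coe_finset, Multiset.toFinset_card_of_nodup hnodup, ← hdeg]
    exact (IsAlgClosed.splits (f v)).natDegree_eq_card_roots.symm

/-! ### Disk components that contain all critical points -/

/-- Let `hV` be the restriction of `hU` to a component `b(D)` of the preimage of a disk `a(D)`. If
this component contains all critical points of `hU`, then it is the whole preimage. -/
theorem IsDiskProper.mem_image_of_criticalPoints_mem {hU hV a b : ℂ → ℂ} (hhU : IsDiskProper hU)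
    (hhV : IsDiskProper hV) (ha : DifferentiableOn ℂ a (ball 0 1)) (hai : InjOn a (ball 0 1))
    (hb : DifferentiableOn ℂ b (ball 0 1)) (hbi : InjOn b (ball 0 1)) (hbm : MapsTo b (ball 0 1) (ball 0 1))
    (e : ∀ z ∈ ball (0 : ℂ) 1, hU (b z) = a (hV z))
    (hcrit : ∀ z ∈ ball (0 : ℂ) 1, deriv hU z = 0 → z ∈ b '' ball 0 1)
    (hcl : ∀ z ∈ ball (0 : ℂ) 1, hU z ∈ a '' ball 0 1 → z ∈ closure (b '' ball 0 1) →
      z ∈ b '' ball 0 1) {z : ℂ} (hz : z ∈ ball (0 : ℂ) 1) (hza : hU z ∈ a '' ball 0 1) :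
    z ∈ b '' ball 0 1 := by
  have han : ∀ {g : ℂ → ℂ}, DifferentiableOn ℂ g (ball 0 1) → ∀ w ∈ ball (0 : ℂ) 1,
      AnalyticAt ℂ g w := fun hg w hw => hg.analyticAt (isOpen_ball.mem_nhds hw)
  have hne : ∀ {g : ℂ → ℂ}, DifferentiableOn ℂ g (ball 0 1) → InjOn g (ball 0 1) →
      ∀ w ∈ ball (0 : ℂ) 1, deriv g w ≠ 0 := fun hg hi w hw =>
    (han hg w hw).deriv_ne_zero_of_injOn (isOpen_ball.mem_nhds hw) hi
  -- Conformal changes of coordinate in source and target do not alter the multiplicity of a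
  -- critical point.
  have hord : ∀ w ∈ ball (0 : ℂ) 1,
      analyticOrderAt (deriv hU) (b w) = analyticOrderAt (deriv hV) w := by
    intro w hw
    have hev : (deriv hU ∘ b) * deriv b =ᶠ[𝓝 w] (deriv a ∘ hV) * deriv hV := by
      filter_upwards [isOpen_ball.mem_nhds hw] with y hy
      have h1 : HasDerivAt (hU ∘ b) (deriv hU (b y) * deriv b y) y :=
        (han hhU.differentiableOn _ (hbm hy)).differentiableAt.hasDerivAt.comp y
          (han hb _ hy).differentiableAt.hasDerivAt
      have h2 : HasDerivAt (a ∘ hV) (deriv a (hV y) * deriv hV y) y :=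
        (han ha _ (hhV.mapsTo hy)).differentiableAt.hasDerivAt.comp y
          (han hhV.differentiableOn _ hy).differentiableAt.hasDerivAt
      refine h1.unique (h2.congr_of_eventuallyEq ?_)
      filter_upwards [isOpen_ball.mem_nhds hy] with x hx using e x hx
    have h1 : AnalyticAt ℂ (deriv hU) (b w) := (han hhU.differentiableOn _ (hbm hw)).deriv
    have h2 : AnalyticAt ℂ (deriv a) (hV w) := (han ha _ (hhV.mapsTo hw)).deriv
    have h3 : AnalyticAt ℂ b w := han hb w hw
    have h4 : AnalyticAt ℂ (deriv a ∘ hV) w := h2.comp (han hhV.differentiableOn _ hw)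
    have h5 := analyticOrderAt_congr hev
    rwa [analyticOrderAt_mul (h1.comp h3) h3.deriv,
      analyticOrderAt_mul h4 (han hhV.differentiableOn _ hw).deriv,
      h3.deriv.analyticOrderAt_eq_zero.mpr (hne hb hbi w hw), add_zero,
      h4.analyticOrderAt_eq_zero.mpr (hne ha hai _ (hhV.mapsTo hw)), zero_add,
      analyticOrderAt_comp_of_deriv_ne_zero h3 (hne hb hbi w hw)] at h5
  obtain ⟨k, M, hkM, hM1, hM, hfin, hk⟩ := hhU.exists_degree
  obtain ⟨k', M', hkM', hM1', hM', -, hk'⟩ := hhV.exists_degree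
  have hmem : ∀ z, z ∈ M ↔ ‖z‖ < 1 ∧ deriv hU z = 0 := by
    intro z
    refine ⟨fun h => ⟨hM1 z h, ?_⟩, fun ⟨h, h0⟩ => ?_⟩
    · apply apply_eq_zero_of_analyticOrderAt_ne_zero
      rw [hM z (hM1 z h)]
      exact_mod_cast Multiset.count_ne_zero.mpr h
    · have := (han hhU.differentiableOn z (mem_ball_zero_iff.mpr h)).deriv.analyticOrderAt_ne_zero.mpr h0
      rw [hM z h] at this
      exact Multiset.count_ne_zero.mp (by exact_mod_cast this)
  have hcount : ∀ w ∈ ball (0 : ℂ) 1, M.count (b w) = M'.count w := by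
    intro w hw
    have := hord w hw
    rw [hM _ (mem_ball_zero_iff.mp (hbm hw)), hM' w (mem_ball_zero_iff.mp hw)] at this
    exact_mod_cast this
  have hMM : M = M'.map b := by
    ext u
    by_cases hu : u ∈ b '' ball 0 1
    · obtain ⟨w, hw, rfl⟩ := hu
      rw [hcount w hw]
      by_cases hwM : w ∈ M'
      · exact (Multiset.count_map_eq_count b M' (fun x hx y hy h =>
          hbi (mem_ball_zero_iff.mpr (hM1' x hx)) (mem_ball_zero_iff.mpr (hM1' y hy)) h) w hwM).symm
      · rw [Multiset.count_eq_zero_of_notMem hwM, Multiset.count_eq_zero_of_notMem]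
        intro h
        obtain ⟨y, hy, hyw⟩ := Multiset.mem_map.mp h
        rw [hbi (mem_ball_zero_iff.mpr (hM1' y hy)) hw hyw] at hy
        exact hwM hy
    · rw [Multiset.count_eq_zero_of_notMem, Multiset.count_eq_zero_of_notMem]
      · intro h
        obtain ⟨y, hy, hyw⟩ := Multiset.mem_map.mp h
        exact hu ⟨y, mem_ball_zero_iff.mpr (hM1' y hy), hyw⟩
      · intro h
        have := (hmem u).mp h
        exact hu (hcrit u (mem_ball_zero_iff.mpr this.1) this.2)
  -- Both maps have the same critical points with multiplicity, up to `b`, and the degree is one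
  -- more than their number.
  have hkk : k = k' := by rw [← hkM, ← hkM', hMM, Multiset.card_map]
  -- Over a noncritical value both fibres have `k` points, so the injective image under `b` of the
  -- smaller fibre is all of the larger one.
  have hreg : ∀ z ∈ ball (0 : ℂ) 1, hU z ∈ a '' ball 0 1 → (∀ y ∈ M, hU y ≠ hU z) →
      z ∈ b '' ball 0 1 := by
    rintro z hz ⟨v, hv, hvz⟩ hy
    have hz1 := mem_ball_zero_iff.mp (hhU.mapsTo hz)
    have hv1 := mem_ball_zero_iff.mp hv
    have h1 := hk _ hz1 hy
    have h2 := hk' v hv1 fun w hw hwv => by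
      refine hy (b w) (hMM ▸ Multiset.mem_map_of_mem b hw) ?_
      rw [e w (mem_ball_zero_iff.mpr (hM1' w hw)), hwv, hvz]
    have hinj : InjOn b {w | ‖w‖ < 1 ∧ hV w = v} := fun x hx y hy h =>
      hbi (mem_ball_zero_iff.mpr hx.1) (mem_ball_zero_iff.mpr hy.1) h
    have hsub : b '' {w | ‖w‖ < 1 ∧ hV w = v} ⊆ {w | ‖w‖ < 1 ∧ hU w = hU z} := by
      rintro _ ⟨w, ⟨hw, hwv⟩, rfl⟩
      have hw' := mem_ball_zero_iff.mpr hw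
      exact ⟨mem_ball_zero_iff.mp (hbm hw'), by rw [e w hw', hwv, hvz]⟩
    have heq := eq_of_subset_of_ncard_le hsub (by rw [hinj.ncard_image, h1, h2, hkk])
      (hfin _ hz1)
    obtain ⟨w, hw, hwz⟩ : z ∈ b '' {w | ‖w‖ < 1 ∧ hV w = v} := by
      rw [heq]
      exact ⟨mem_ball_zero_iff.mp hz, rfl⟩
    exact ⟨w, mem_ball_zero_iff.mpr hw.1, hwz⟩
  by_contra hzb
  have haopen : IsOpen (a '' ball 0 1) := by
    rw [isOpen_iff_mem_nhds]
    rintro _ ⟨w, hw, rfl⟩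
    have := (han ha w hw).eventually_constant_or_nhds_le_map_nhds.resolve_left ?_
    · exact this (image_mem_map (isOpen_ball.mem_nhds hw))
    · intro hc
      refine hne ha hai w hw ?_
      rw [EventuallyEq.deriv_eq (f := fun _ => a w) hc, deriv_const]
  -- Missed points form an open set, because the image of `b` is relatively closed in the preimage.
  -- If nonempty, this set is infinite and contains a point off the finitely many critical fibres,
  -- against `hreg`.
  set W : Set ℂ := (ball (0 : ℂ) 1 ∩ hU ⁻¹' (a '' ball 0 1)) \ closure (b '' ball 0 1)
  have hWo : IsOpen W :=
    (hhU.differentiableOn.continuousOn.isOpen_inter_preimage isOpen_ball haopen).sdiff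
      isClosed_closure
  have hzW : z ∈ W := ⟨⟨hz, hza⟩, fun h => hzb (hcl z hz hza h)⟩
  have hfinB : (⋃ y ∈ M.toFinset, {w | ‖w‖ < 1 ∧ hU w = hU y}).Finite :=
    M.toFinset.finite_toSet.biUnion fun y hy => hfin _ (mem_ball_zero_iff.mp
      (hhU.mapsTo (mem_ball_zero_iff.mpr (hM1 y (Multiset.mem_toFinset.mp hy)))))
  have hinf : W.Infinite := infinite_of_mem_nhds z (hWo.mem_nhds hzW)
  obtain ⟨y, hyW, hy⟩ := hinf.exists_notMem_finite hfinB
  refine hyW.2 (subset_closure (hreg y hyW.1.1 hyW.1.2 fun x hx hxy => hy ?_))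
  simp only [mem_iUnion]
  exact ⟨x, Multiset.mem_toFinset.mpr hx, mem_ball_zero_iff.mp hyW.1.1, hxy.symm⟩

/-! ### Disk parametrizations on a Riemann surface -/

/-- A conformal parametrization of a conformal disk by the unit disk. -/
structure IsDiskParam {S : Type*} [TopologicalSpace S] [ChartedSpace ℂ S] (g : ℂ → S) : Prop where
  mdifferentiableOn : MDifferentiableOn 𝓘(ℂ) 𝓘(ℂ) g (ball 0 1)
  injOn : InjOn g (ball 0 1)

section RiemannSurface

variable {S : Type*} [TopologicalSpace S] [ChartedSpace ℂ S] [IsManifold 𝓘(ℂ) ω S]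

theorem mdifferentiableAt_chart_comp_iff {g : ℂ → S} {z : ℂ} (hg : ContinuousAt g z) {p : S}
    (hp : g z ∈ (chartAt ℂ p).source) :
    MDifferentiableAt 𝓘(ℂ) 𝓘(ℂ) g z ↔ DifferentiableAt ℂ (fun w => chartAt ℂ p (g w)) z := by
  have hat := chart_mem_atlas ℂ p
  constructor
  · intro h
    exact ((mdifferentiableAt_atlas hat hp).comp z h).differentiableAt
  · intro h
    have h1 : MDifferentiableAt 𝓘(ℂ) 𝓘(ℂ) (fun w => (chartAt ℂ p).symm (chartAt ℂ p (g w))) z :=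
      (mdifferentiableAt_atlas_symm hat ((chartAt ℂ p).map_source hp)).comp z h.mdifferentiableAt
    refine h1.congr_of_eventuallyEq ?_
    filter_upwards [hg.preimage_mem_nhds ((chartAt ℂ p).open_source.mem_nhds hp)] with w hw
    exact ((chartAt ℂ p).left_inv hw).symm

namespace IsDiskParam

variable {g : ℂ → S} (hg : IsDiskParam g)
include hg

theorem continuousOn : ContinuousOn g (ball 0 1) := hg.mdifferentiableOn.continuousOn

theorem mdifferentiableAt {z : ℂ} (hz : z ∈ ball (0 : ℂ) 1) : MDifferentiableAt 𝓘(ℂ) 𝓘(ℂ) g z :=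
  (hg.mdifferentiableOn z hz).mdifferentiableAt (isOpen_ball.mem_nhds hz)

theorem analyticAt_chart {z : ℂ} (hz : z ∈ ball (0 : ℂ) 1) {p : S}
    (hp : g z ∈ (chartAt ℂ p).source) :
    AnalyticAt ℂ (fun w => chartAt ℂ p (g w)) z ∧ deriv (fun w => chartAt ℂ p (g w)) z ≠ 0 := by
  set e := chartAt ℂ p
  set W := ball (0 : ℂ) 1 ∩ g ⁻¹' e.source
  have hWo : IsOpen W := hg.continuousOn.isOpen_inter_preimage isOpen_ball e.open_source
  have hzW : W ∈ 𝓝 z := hWo.mem_nhds ⟨hz, hp⟩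
  have hd : DifferentiableOn ℂ (fun w => e (g w)) W := fun w hw =>
    ((mdifferentiableAt_chart_comp_iff (hg.mdifferentiableAt hw.1).continuousAt hw.2).mp
      (hg.mdifferentiableAt hw.1)).differentiableWithinAt
  have han := hd.analyticAt hzW
  exact ⟨han, han.deriv_ne_zero_of_injOn hzW fun x hx y hy h =>
    hg.injOn hx.1 hy.1 (e.injOn hx.2 hy.2 h)⟩

theorem map_nhds {z : ℂ} (hz : z ∈ ball (0 : ℂ) 1) : map g (𝓝 z) = 𝓝 (g z) := by
  set e := chartAt ℂ (g z)
  have hp : g z ∈ e.source := mem_chart_source ℂ (g z)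
  obtain ⟨han, hne⟩ := hg.analyticAt_chart hz hp
  have h1 : map (fun w => e (g w)) (𝓝 z) = 𝓝 (e (g z)) := han.hasStrictDerivAt.map_nhds_eq hne
  have h2 : map e.symm (𝓝 (e (g z))) = 𝓝 (g z) := by
    rw [e.symm.map_nhds_eq (e.map_source hp), e.left_inv hp]
  rw [← h2, ← h1, map_map]
  refine map_congr ?_
  filter_upwards [(hg.mdifferentiableAt hz).continuousAt.preimage_mem_nhds
    (e.open_source.mem_nhds hp)] with w hw
  exact (e.left_inv hw).symm

theorem isOpen_image {s : Set ℂ} (hs : IsOpen s) (hs1 : s ⊆ ball 0 1) : IsOpen (g '' s) := by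
  rw [isOpen_iff_mem_nhds]
  rintro _ ⟨z, hz, rfl⟩
  rw [← hg.map_nhds (hs1 hz)]
  exact image_mem_map (hs.mem_nhds hz)

theorem isConnected_image : IsConnected (g '' ball 0 1) :=
  ((convex_ball (0 : ℂ) 1).isPathConnected ⟨0, by simp⟩).isConnected.image _ hg.continuousOn

theorem continuousAt_invFunOn {z : ℂ} (hz : z ∈ ball (0 : ℂ) 1) :
    ContinuousAt (Function.invFunOn g (ball 0 1)) (g z) := by
  have hl := hg.injOn.leftInvOn_invFunOn
  rw [ContinuousAt, hl hz, ← hg.map_nhds hz, tendsto_map'_iff]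
  refine tendsto_id.congr' ?_
  filter_upwards [isOpen_ball.mem_nhds hz] with y hy
  exact (hl hy).symm

theorem mfderiv_apply_ne_zero {z : ℂ} (hz : z ∈ ball (0 : ℂ) 1) :
    mfderiv 𝓘(ℂ) 𝓘(ℂ) g z (1 : ℂ) ≠ 0 := by
  intro h0
  obtain ⟨han, hne⟩ := hg.analyticAt_chart hz (mem_chart_source ℂ (g z))
  have h1 := mfderiv_comp z (mdifferentiableAt_atlas (chart_mem_atlas ℂ (g z))
    (mem_chart_source ℂ (g z))) (hg.mdifferentiableAt hz)
  apply hne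
  have h2 : fderiv ℂ (fun w => chartAt ℂ (g z) (g w)) z 1 = 0 := by
    rw [← mfderiv_eq_fderiv]
    refine (DFunLike.congr_fun h1 (1 : ℂ)).trans ?_
    refine (congrArg _ h0).trans ?_
    exact map_zero (mfderiv 𝓘(ℂ) 𝓘(ℂ) (chartAt ℂ (g z)) (g z))
  rwa [fderiv_apply_one_eq_deriv] at h2

/-- Holomorphic maps into a conformal disk lift to the unit disk. -/
theorem exists_lift {F : ℂ → S} (hF : MDifferentiableOn 𝓘(ℂ) 𝓘(ℂ) F (ball 0 1))
    (hFm : MapsTo F (ball 0 1) (g '' ball 0 1)) :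
    ∃ h : ℂ → ℂ, DifferentiableOn ℂ h (ball 0 1) ∧ MapsTo h (ball 0 1) (ball 0 1) ∧
      ∀ z ∈ ball (0 : ℂ) 1, g (h z) = F z := by
  set h : ℂ → ℂ := fun z => Function.invFunOn g (ball 0 1) (F z)
  have hm : MapsTo h (ball 0 1) (ball 0 1) := fun z hz => Function.invFunOn_mem (hFm hz)
  have he : ∀ z ∈ ball (0 : ℂ) 1, g (h z) = F z := fun z hz => Function.invFunOn_eq (hFm hz)
  refine ⟨h, fun z hz => DifferentiableAt.differentiableWithinAt ?_, hm, he⟩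
  set e := chartAt ℂ (g (h z))
  have hp : g (h z) ∈ e.source := mem_chart_source ℂ _
  obtain ⟨han, hne⟩ := hg.analyticAt_chart (hm hz) hp
  have hFz : MDifferentiableAt 𝓘(ℂ) 𝓘(ℂ) F z :=
    (hF z hz).mdifferentiableAt (isOpen_ball.mem_nhds hz)
  refine differentiableAt_of_comp_eq han hne (K := fun w => e (F w)) ?_ ?_ ?_
  · exact (mdifferentiableAt_chart_comp_iff hFz.continuousAt (by rwa [← he z hz])).mp hFz
  · have := hg.continuousAt_invFunOn (hm hz)
    rw [he z hz] at this
    exact this.comp hFz.continuousAt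
  · filter_upwards [isOpen_ball.mem_nhds hz] with w hw
    rw [he w hw]

theorem comp {b : ℂ → ℂ} (hb : DifferentiableOn ℂ b (ball 0 1)) (hbi : InjOn b (ball 0 1))
    (hbm : MapsTo b (ball 0 1) (ball 0 1)) : IsDiskParam (g ∘ b) :=
  ⟨hg.mdifferentiableOn.comp hb.mdifferentiableOn hbm, hg.injOn.comp hbi hbm⟩

end IsDiskParam

theorem IsConformalDisk.isOpen {U : Set S} (hU : IsConformalDisk U) : IsOpen U := by
  obtain ⟨g, h1, h2, rfl⟩ := hU
  exact IsDiskParam.isOpen_image ⟨h1, h2⟩ isOpen_ball subset_rfl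

theorem IsConformalDisk.isConnected {U : Set S} (hU : IsConformalDisk U) : IsConnected U := by
  obtain ⟨g, h1, h2, rfl⟩ := hU
  exact IsDiskParam.isConnected_image ⟨h1, h2⟩

/-- Every neighbourhood of a point contains a conformal disk centred there. -/
theorem exists_isDiskParam {p : S} {N : Set S} (hN : N ∈ 𝓝 p) :
    ∃ g : ℂ → S, IsDiskParam g ∧ g 0 = p ∧ g '' ball 0 1 ⊆ N := by
  set e := chartAt ℂ p
  have hp : p ∈ e.source := mem_chart_source ℂ p
  have h1 : e.target ∩ e.symm ⁻¹' N ∈ 𝓝 (e p) := by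
    refine inter_mem (e.open_target.mem_nhds (e.map_source hp)) ?_
    have := e.symm.continuousAt (e.map_source hp)
    rw [ContinuousAt, e.left_inv hp] at this
    exact this hN
  obtain ⟨ε, hε, hsub⟩ := Metric.mem_nhds_iff.mp h1
  have hm : ∀ z ∈ ball (0 : ℂ) 1, e p + ε * z ∈ ball (e p) ε := by
    intro z hz
    rw [mem_ball_iff_norm, add_sub_cancel_left, norm_mul, Complex.norm_real,
      Real.norm_of_nonneg hε.le]
    have := mem_ball_zero_iff.mp hz
    nlinarith
  refine ⟨fun z => e.symm (e p + ε * z), ⟨?_, ?_⟩, by simp [e.left_inv hp], ?_⟩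
  · intro z hz
    have h2 : DifferentiableAt ℂ (fun z : ℂ => e p + ε * z) z := by fun_prop
    exact ((mdifferentiableAt_atlas_symm (chart_mem_atlas ℂ p) (hsub (hm z hz)).1).comp z
      h2.mdifferentiableAt).mdifferentiableWithinAt
  · intro z hz w hw h
    have := e.symm.injOn (hsub (hm z hz)).1 (hsub (hm w hw)).1 h
    have hε' : (ε : ℂ) ≠ 0 := by exact_mod_cast hε.ne'
    exact mul_left_cancel₀ hε' (add_left_cancel this)
  · rintro _ ⟨z, hz, rfl⟩
    exact (hsub (hm z hz)).2

variable {f : S → S} (hf : MDifferentiable 𝓘(ℂ) 𝓘(ℂ) f)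
include hf

/-- Chain rule for `g ∘ h = f ∘ g'`: the two parametrizations have nonvanishing derivatives. This
transfers the critical point counts of disk maps to `f`. -/
theorem isCriticalPoint_iff_of_lift {g g' : ℂ → S} (hg : IsDiskParam g) (hg' : IsDiskParam g')
    {h : ℂ → ℂ} (hh : DifferentiableOn ℂ h (ball 0 1)) (hm : MapsTo h (ball 0 1) (ball 0 1))
    (e : ∀ z ∈ ball (0 : ℂ) 1, g (h z) = f (g' z)) {z : ℂ} (hz : z ∈ ball (0 : ℂ) 1) :
    IsCriticalPoint f (g' z) ↔ deriv h z = 0 := by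
  have hd : DifferentiableAt ℂ h z := hh.differentiableAt (isOpen_ball.mem_nhds hz)
  have h1 := mfderiv_comp z (hf (g' z)) (hg'.mdifferentiableAt hz)
  have h2 := mfderiv_comp z (hg.mdifferentiableAt (hm hz)) hd.mdifferentiableAt
  have hev : g ∘ h =ᶠ[𝓝 z] f ∘ g' := by
    filter_upwards [isOpen_ball.mem_nhds hz] with w hw using e w hw
  have h3 := hev.mfderiv_eq (I := 𝓘(ℂ)) (I' := 𝓘(ℂ))
  set A : ℂ →L[ℂ] ℂ := mfderiv 𝓘(ℂ) 𝓘(ℂ) f (g' z)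
  set B : ℂ →L[ℂ] ℂ := mfderiv 𝓘(ℂ) 𝓘(ℂ) g' z
  set G : ℂ →L[ℂ] ℂ := mfderiv 𝓘(ℂ) 𝓘(ℂ) g (h z)
  have h4 : A.comp B = G.comp (fderiv ℂ h z) := by
    rw [← mfderiv_eq_fderiv]
    exact h1.symm.trans (h3.symm.trans h2)
  have hB : B 1 ≠ 0 := hg'.mfderiv_apply_ne_zero hz
  have hG : G 1 ≠ 0 := hg.mfderiv_apply_ne_zero (hm hz)
  have h5 : A (B 1) = deriv h z * G 1 := by
    have := DFunLike.congr_fun h4 1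
    rw [ContinuousLinearMap.comp_apply, ContinuousLinearMap.comp_apply,
      fderiv_apply_one_eq_deriv] at this
    rw [this, ← smul_eq_mul, ← map_smul, smul_eq_mul, mul_one]
  change A = 0 ↔ _
  constructor
  · intro hc
    rw [hc, ContinuousLinearMap.zero_apply] at h5
    exact (mul_eq_zero.mp h5.symm).resolve_right hG
  · intro h0
    rw [h0, zero_mul] at h5
    refine ContinuousLinearMap.ext fun v => ?_
    rw [show v = (v / B 1) • B 1 by rw [smul_eq_mul, div_mul_cancel₀ _ hB], map_smul, h5, smul_zero,
      ContinuousLinearMap.zero_apply]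

/-- Local form of a holomorphic self-map of a Riemann surface. -/
theorem exists_local_lift (p : S) : ∃ (g g' : ℂ → S) (h : ℂ → ℂ), IsDiskParam g ∧ IsDiskParam g' ∧
    g' 0 = p ∧ DifferentiableOn ℂ h (ball 0 1) ∧ MapsTo h (ball 0 1) (ball 0 1) ∧
    ∀ z ∈ ball (0 : ℂ) 1, g (h z) = f (g' z) := by
  obtain ⟨g, hg, hg0, -⟩ := exists_isDiskParam (p := f p) univ_mem
  have hN : g '' ball 0 1 ∈ 𝓝 (f p) :=
    (hg.isOpen_image isOpen_ball subset_rfl).mem_nhds ⟨0, by simp, hg0⟩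
  obtain ⟨g', hg', hg'0, hsub⟩ := exists_isDiskParam (hf.continuous.continuousAt hN)
  have hF : MDifferentiableOn 𝓘(ℂ) 𝓘(ℂ) (fun z => f (g' z)) (ball 0 1) :=
    hf.comp_mdifferentiableOn hg'.mdifferentiableOn
  obtain ⟨h, h1, h2, h3⟩ := hg.exists_lift hF fun z hz => hsub ⟨z, hz, rfl⟩
  exact ⟨g, g', h, hg, hg', hg'0, h1, h2, h3⟩

/-- A holomorphic map is locally injective exactly at its noncritical points. -/
theorem not_isCriticalPoint_iff {p : S} :
    ¬ IsCriticalPoint f p ↔ ∃ N ∈ 𝓝 p, InjOn f N := by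
  obtain ⟨g, g', h, hg, hg', rfl, h1, h2, h3⟩ := exists_local_lift hf p
  have h0 : (0 : ℂ) ∈ ball (0 : ℂ) 1 := mem_ball_self one_pos
  have han := h1.analyticAt (isOpen_ball.mem_nhds h0)
  rw [isCriticalPoint_iff_of_lift hf hg hg' h1 h2 h3 h0]
  constructor
  · intro hne
    obtain ⟨u, hu, hinj⟩ : ∃ u ∈ 𝓝 (0 : ℂ), InjOn h u := by
      have := (han.hasStrictDerivAt.hasStrictFDerivAt_equiv hne)
      exact ⟨_, (this.toOpenPartialHomeomorph h).open_source.mem_nhds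
        this.mem_toOpenPartialHomeomorph_source, (this.toOpenPartialHomeomorph h).injOn⟩
    refine ⟨g' '' (u ∩ ball 0 1), ?_, ?_⟩
    · rw [← hg'.map_nhds h0]
      exact image_mem_map (inter_mem hu (isOpen_ball.mem_nhds h0))
    · rintro _ ⟨z, hz, rfl⟩ _ ⟨w, hw, rfl⟩ hzw
      rw [← h3 z hz.2, ← h3 w hw.2] at hzw
      rw [hinj hz.1 hw.1 (hg.injOn (h2 hz.2) (h2 hw.2) hzw)]
  · rintro ⟨N, hN, hinj⟩
    have hN' : g' ⁻¹' N ∈ 𝓝 0 := (hg'.mdifferentiableAt h0).continuousAt hN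
    refine han.deriv_ne_zero_of_injOn (inter_mem hN' (isOpen_ball.mem_nhds h0)) ?_
    intro z hz w hw hzw
    refine hg'.injOn hz.2 hw.2 (hinj hz.1 hw.1 ?_)
    rw [← h3 z hz.2, ← h3 w hw.2, hzw]

end RiemannSurface

/-! ### Fibres and critical points of a branched covering -/

section BranchedCovering

variable {S : Type*} [TopologicalSpace S] [ChartedSpace ℂ S] [IsManifold 𝓘(ℂ) ω S]

theorem infinite_of_mem_nhds_riemannSurface {p : S} {N : Set S} (hN : N ∈ 𝓝 p) : N.Infinite := by
  obtain ⟨g, hg, -, hsub⟩ := exists_isDiskParam hN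
  refine Infinite.mono hsub (Infinite.image hg.injOn ?_)
  exact infinite_of_mem_nhds (0 : ℂ) (ball_mem_nhds 0 one_pos)

namespace IsBranchedSelfCovering

variable {f : S → S} {d : ℕ} (hf : IsBranchedSelfCovering f d)
include hf

theorem continuous : Continuous f := hf.proper.continuous

/-- The identity theorem in a coordinate disk: local constancy at one of its points forces constancy
on the disk. -/
theorem isClosed_setOf_eventually_const :
    IsClosed {p | ∀ᶠ q in 𝓝 p, f q = f p} := by
  refine isClosed_of_closure_subset fun p hp => ?_
  obtain ⟨g, g', h, hg, hg', rfl, h1, h2, h3⟩ := exists_local_lift hf.holomorphic p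
  have h0 : (0 : ℂ) ∈ ball (0 : ℂ) 1 := mem_ball_self one_pos
  obtain ⟨_, ⟨z, hz, rfl⟩, hzK⟩ := mem_closure_iff.mp hp _
    (hg'.isOpen_image isOpen_ball subset_rfl) ⟨0, h0, rfl⟩
  have hev : h =ᶠ[𝓝 z] fun _ => h z := by
    have hzK : ∀ᶠ q in 𝓝 (g' z), f q = f (g' z) := hzK
    rw [← hg'.map_nhds hz, eventually_map] at hzK
    filter_upwards [hzK, isOpen_ball.mem_nhds hz] with w hw hwb
    rw [← h3 w hwb, ← h3 z hz] at hw
    exact hg.injOn (h2 hwb) (h2 hz) hw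
  have heq := (h1.analyticOnNhd isOpen_ball).eqOn_of_preconnected_of_eventuallyEq
    analyticOnNhd_const (convex_ball (0 : ℂ) 1).isPreconnected hz hev
  change ∀ᶠ q in 𝓝 (g' 0), f q = f (g' 0)
  rw [← hg'.map_nhds h0, eventually_map]
  filter_upwards [isOpen_ball.mem_nhds h0] with w hw
  rw [← h3 w hw, ← h3 0 h0, heq hw, heq h0]

variable [ConnectedSpace S] (hd : 1 < d)
include hd

/-- The set of points of local constancy is clopen. Were it everything, a generic fibre would be
open, nonempty and finite, but neighborhoods on a Riemann surface are infinite. -/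
theorem not_eventually_const (p : S) : ¬ ∀ᶠ q in 𝓝 p, f q = f p := by
  set K := {p | ∀ᶠ q in 𝓝 p, f q = f p}
  have hK : IsClopen K := ⟨hf.isClosed_setOf_eventually_const, by
    refine isOpen_iff_mem_nhds.mpr fun q hq => ?_
    filter_upwards [eventually_eventually_nhds.mpr hq, hq] with r hr hr'
    filter_upwards [hr] with t ht
    rw [ht, hr']⟩
  rcases isClopen_iff.mp hK with h | h
  · intro hp
    have : p ∈ K := hp
    rw [h] at this
    exact this
  exfalso
  obtain ⟨B, hB, -, hdeg⟩ := hf.generic_fibre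
  obtain ⟨y, -, hy⟩ := (infinite_of_mem_nhds_riemannSurface (p := p) univ_mem).exists_notMem_finite hB
  have hfib := hdeg y hy
  obtain ⟨q, hq⟩ := nonempty_of_ncard_ne_zero (s := f ⁻¹' {y}) (by omega)
  have hqK : q ∈ K := by rw [h]; trivial
  have hN : f ⁻¹' {y} ∈ 𝓝 q := by
    filter_upwards [hqK] with r hr
    rw [mem_preimage, hr]
    exact hq
  exact infinite_of_mem_nhds_riemannSurface hN (finite_of_ncard_pos (by omega))

theorem exists_local_lift (p : S) : ∃ (g g' : ℂ → S) (h : ℂ → ℂ), IsDiskParam g ∧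
    IsDiskParam g' ∧ g' 0 = p ∧ (∀ z ∈ ball (0 : ℂ) 1, g (h z) = f (g' z)) ∧ MapsTo h (ball 0 1) (ball 0 1) ∧
    AnalyticAt ℂ h 0 ∧ ¬ ∀ᶠ z in 𝓝 0, h z = h 0 := by
  obtain ⟨g, g', h, hg, hg', rfl, h1, h2, h3⟩ := _root_.exists_local_lift hf.holomorphic p
  have h0 : (0 : ℂ) ∈ ball (0 : ℂ) 1 := mem_ball_self one_pos
  refine ⟨g, g', h, hg, hg', rfl, h3, h2, h1.analyticAt (isOpen_ball.mem_nhds h0), fun hc => ?_⟩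
  refine hf.not_eventually_const hd (g' 0) ?_
  rw [← hg'.map_nhds h0, eventually_map]
  filter_upwards [hc, isOpen_ball.mem_nhds h0] with w hw hwb
  rw [← h3 w hwb, ← h3 0 h0, hw]

/-- Fibres are compact by properness and discrete because zeros of nonconstant holomorphic functions
are isolated. -/
theorem finite_fibre [T2Space S] (y : S) : (f ⁻¹' {y}).Finite := by
  have hc := hf.proper.isCompact_preimage (isCompact_singleton (x := y))
  have hN : ∀ p ∈ f ⁻¹' {y}, ∃ N ∈ 𝓝 p, N ∩ f ⁻¹' {y} ⊆ {p} := by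
    intro p hp
    obtain ⟨g, g', h, hg, hg', rfl, h3, h2, han, hne⟩ := hf.exists_local_lift hd p
    have h0 : (0 : ℂ) ∈ ball (0 : ℂ) 1 := mem_ball_self one_pos
    have hev := (han.eventually_eq_or_eventually_ne analyticAt_const).resolve_left hne
    rw [eventually_nhdsWithin_iff] at hev
    refine ⟨g' '' {z | (z ∈ ({0}ᶜ : Set ℂ) → h z ≠ h 0) ∧ z ∈ ball (0 : ℂ) 1 }, ?_, ?_⟩
    · rw [← hg'.map_nhds h0]
      exact image_mem_map (hev.and (isOpen_ball.mem_nhds h0))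
    · rintro _ ⟨⟨z, ⟨hz, hzb⟩, rfl⟩, hzy⟩
      have hh : f (g' z) = f (g' 0) := Eq.trans hzy (Eq.symm hp)
      by_contra hne0
      have hz0 : z ≠ 0 := by rintro rfl; exact hne0 rfl
      rw [← h3 z hzb, ← h3 0 h0] at hh
      exact hz hz0 (hg.injOn (h2 hzb) (h2 h0) hh)
  choose! N hN1 hN2 using hN
  obtain ⟨t, ht, hcov⟩ := hc.elim_nhds_subcover N hN1
  refine t.finite_toSet.subset fun q hq => ?_
  obtain ⟨p, hp, hqp⟩ := mem_iUnion₂.mp (hcov hq)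
  rw [hN2 p (ht p hp) ⟨hqp, hq⟩]
  exact hp

theorem isOpenMap : IsOpenMap f := by
  refine IsOpenMap.of_nhds_le fun p => ?_
  obtain ⟨g, g', h, hg, hg', rfl, h3, h2, han, hne⟩ := hf.exists_local_lift hd p
  have h0 : (0 : ℂ) ∈ ball (0 : ℂ) 1 := mem_ball_self one_pos
  have h4 := han.eventually_constant_or_nhds_le_map_nhds.resolve_left hne
  have h5 : map (fun z => f (g' z)) (𝓝 0) = map (fun z => g (h z)) (𝓝 0) := by
    refine map_congr ?_
    filter_upwards [isOpen_ball.mem_nhds h0] with z hz using (h3 z hz).symm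
  rw [← hg'.map_nhds h0, map_map, Function.comp_def, h5, ← h3 0 h0, ← hg.map_nhds (h2 h0)]
  exact (map_mono h4).trans_eq map_map

/-- Off the exceptional values `f` is a local homeomorphism, so critical points lie in finitely many
finite fibres. -/
theorem finite_isCriticalPoint [T2Space S] : {c | IsCriticalPoint f c}.Finite := by
  obtain ⟨B, hB, hcov, -⟩ := hf.generic_fibre
  refine (hB.preimage' fun y _ => hf.finite_fibre hd y).subset fun c hc => ?_
  by_contra hcB
  obtain ⟨e, hce, he⟩ := hcov.isLocalHomeomorphOn c hcB
  refine (not_isCriticalPoint_iff hf.holomorphic).mpr ⟨e.source, e.open_source.mem_nhds hce, ?_⟩ hc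
  rw [he]
  exact e.injOn

end IsBranchedSelfCovering

end BranchedCovering

/-! ### Preimage components and pull-backs of disks -/

theorem IsDiskProper.isCompact_inter_preimage {h : ℂ → ℂ} (hh : IsDiskProper h) {K : Set ℂ}
    (hK : IsCompact K) (hKb : K ⊆ ball 0 1) : IsCompact (ball 0 1 ∩ h ⁻¹' K) := by
  obtain ⟨ρ, hρ, hKρ⟩ : ∃ ρ < 1, ∀ z ∈ K, ‖z‖ ≤ ρ := by
    rcases K.eq_empty_or_nonempty with rfl | hne
    · exact ⟨0, one_pos, by simp⟩
    · obtain ⟨z, hz, hmax⟩ := hK.exists_isMaxOn hne continuous_norm.continuousOn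
      exact ⟨‖z‖, mem_ball_zero_iff.mp (hKb hz), fun w hw => hmax hw⟩
  have hc := hh.isCompact ρ hρ
  have := (hh.differentiableOn.continuousOn.mono inter_subset_left).preimage_isClosed_of_isClosed
    hc.isClosed hK.isClosed
  convert hc.of_isClosed_subset this inter_subset_left using 1
  ext z
  exact ⟨fun h => ⟨⟨h.1, hKρ _ h.2⟩, h.2⟩, fun h => ⟨h.1.1, h.2⟩⟩

section Disks

variable {S : Type*} [TopologicalSpace S] [T2Space S] [ChartedSpace ℂ S] [IsManifold 𝓘(ℂ) ω S]
  {f : S → S} {d : ℕ} (hf : IsBranchedSelfCovering f d)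
include hf

/-- A component is relatively closed in the whole preimage, so the preimage of a compact set inside
it is closed in a compact set. Thus `f` between the two disks is proper in disk coordinates. -/
theorem IsBranchedSelfCovering.exists_isDiskProper {g g' : ℂ → S} (hg : IsDiskParam g)
    (hg' : IsDiskParam g') {s : S}
    (h' : g' '' ball 0 1 = connectedComponentIn (f ⁻¹' (g '' ball 0 1)) s) :
    ∃ h, IsDiskProper h ∧ ∀ z ∈ ball (0 : ℂ) 1, g (h z) = f (g' z) := by
  have hsub : g' '' ball 0 1 ⊆ f ⁻¹' (g '' ball 0 1) := h' ▸ connectedComponentIn_subset _ _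
  obtain ⟨h, h1, h2, h3⟩ := hg.exists_lift (F := fun z => f (g' z))
    (hf.holomorphic.comp_mdifferentiableOn hg'.mdifferentiableOn) fun z hz => hsub ⟨z, hz, rfl⟩
  refine ⟨h, ⟨h1, h2, fun ρ hρ => ?_⟩, h3⟩
  have hcb : closedBall (0 : ℂ) ρ ⊆ ball 0 1 := closedBall_subset_ball hρ
  have hc1 : IsCompact (g '' closedBall 0 ρ) :=
    (isCompact_closedBall 0 ρ).image_of_continuousOn (hg.continuousOn.mono hcb)
  have hc2 := hf.proper.isCompact_preimage hc1
  have hc3 : IsCompact (g' '' ball 0 1 ∩ f ⁻¹' (g '' closedBall 0 ρ)) := by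
    have hcl : g' '' ball 0 1 ∩ f ⁻¹' (g '' closedBall 0 ρ) =
        closure (g' '' ball 0 1) ∩ f ⁻¹' (g '' closedBall 0 ρ) := by
      refine subset_antisymm (inter_subset_inter_left _ subset_closure) fun p hp => ⟨?_, hp.2⟩
      have := closure_connectedComponentIn_inter_subset (f ⁻¹' (g '' ball 0 1)) s
      rw [← h'] at this
      exact this ⟨hp.1, preimage_mono (image_mono hcb) hp.2⟩
    rw [hcl]
    exact hc2.inter_left isClosed_closure
  have hl := hg'.injOn.leftInvOn_invFunOn
  have hc4 := hc3.image_of_continuousOn (f := Function.invFunOn g' (ball 0 1)) (by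
    rintro _ ⟨⟨z, hz, rfl⟩, -⟩
    exact (hg'.continuousAt_invFunOn hz).continuousWithinAt)
  convert hc4 using 1
  ext z
  symm
  constructor
  · rintro ⟨_, ⟨⟨w, hw, rfl⟩, y, hy, hyw⟩, rfl⟩
    rw [hl hw]
    refine ⟨hw, ?_⟩
    rw [← h3 w hw] at hyw
    rw [mem_ofPred_eq, ← hg.injOn (hcb hy) (h2 hw) hyw]
    exact mem_closedBall_zero_iff.mp hy
  · rintro ⟨hz, hz'⟩
    exact ⟨g' z, ⟨⟨z, hz, rfl⟩, h z, mem_closedBall_zero_iff.mpr hz', h3 z hz⟩, hl hz⟩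

/-- If a disk component of the preimage of a disk contains all critical points of a disk component
of the preimage of a larger disk, then it is the whole preimage. -/
theorem IsBranchedSelfCovering.inter_preimage_subset {U V U' V' : Set S} {s : S}
    (hU : IsConformalDisk U) (hV : IsConformalDisk V) (hU' : IsConformalDisk U')
    (hV' : IsConformalDisk V') (hUs : U' = connectedComponentIn (f ⁻¹' U) s)
    (hVs : V' = connectedComponentIn (f ⁻¹' V) s) (hVU : V ⊆ U)
    (hcrit : ∀ c ∈ U', IsCriticalPoint f c → c ∈ V') : U' ∩ f ⁻¹' V ⊆ V' := by
  have hVU' : V' ⊆ U' := by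
    rw [hUs, hVs]
    exact connectedComponentIn_mono _ (preimage_mono hVU)
  obtain ⟨gU, u1, u2, rfl⟩ := hU
  obtain ⟨gV, v1, v2, rfl⟩ := hV
  obtain ⟨gU', u1', u2', rfl⟩ := hU'
  obtain ⟨gV', v1', v2', rfl⟩ := hV'
  have pU : IsDiskParam gU := ⟨u1, u2⟩
  have pV : IsDiskParam gV := ⟨v1, v2⟩
  have pU' : IsDiskParam gU' := ⟨u1', u2'⟩
  have pV' : IsDiskParam gV' := ⟨v1', v2'⟩
  obtain ⟨hU, hU1, hU2⟩ := hf.exists_isDiskProper pU pU' hUs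
  obtain ⟨hV, hV1, hV2⟩ := hf.exists_isDiskProper pV pV' hVs
  obtain ⟨a, a1, a2, a3⟩ := pU.exists_lift v1 fun z hz => hVU ⟨z, hz, rfl⟩
  obtain ⟨b, b1, b2, b3⟩ := pU'.exists_lift v1' fun z hz => hVU' ⟨z, hz, rfl⟩
  have ai : InjOn a (ball 0 1) := fun z hz w hw h => v2 hz hw (by rw [← a3 z hz, ← a3 w hw, h])
  have bi : InjOn b (ball 0 1) := fun z hz w hw h => v2' hz hw (by rw [← b3 z hz, ← b3 w hw, h])
  have memb : ∀ z ∈ ball (0 : ℂ) 1, gU' z ∈ gV' '' ball 0 1 → z ∈ b '' ball 0 1 := by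
    rintro z hz ⟨w, hw, hwz⟩
    rw [← b3 w hw] at hwz
    exact ⟨w, hw, u2' (b2 hw) hz hwz⟩
  have mema : ∀ z ∈ ball (0 : ℂ) 1, hU z ∈ a '' ball 0 1 ↔ f (gU' z) ∈ gV '' ball 0 1 := by
    intro z hz
    rw [← hU2 z hz]
    constructor
    · rintro ⟨w, hw, hwz⟩
      exact ⟨w, hw, by rw [← a3 w hw, hwz]⟩
    · rintro ⟨w, hw, hwz⟩
      rw [← a3 w hw] at hwz
      exact ⟨w, hw, u2 (a2 hw) (hU1.mapsTo hz) hwz⟩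
  rintro _ ⟨⟨z, hz, rfl⟩, hzV⟩
  obtain ⟨w, hw, rfl⟩ := hU1.mem_image_of_criticalPoints_mem hV1 a1 ai b1 bi b2 (fun w hw => by
      refine u2 (hU1.mapsTo (b2 hw)) (a2 (hV1.mapsTo hw)) ?_
      rw [hU2 _ (b2 hw), b3 w hw, a3 _ (hV1.mapsTo hw), hV2 w hw])
    (fun w hw hw0 => memb w hw (hcrit _ ⟨w, hw, rfl⟩
      ((isCriticalPoint_iff_of_lift hf.holomorphic pU pU' hU1.differentiableOn hU1.mapsTo hU2 hw).mpr hw0)))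
    (fun w hw hwa hwb => memb w hw (by
      have h1 := closure_connectedComponentIn_inter_subset (f ⁻¹' (gV '' ball 0 1)) s
      rw [← hVs] at h1
      refine h1 ⟨?_, (mema w hw).mp hwa⟩
      have h2 : ContinuousWithinAt gU' (b '' ball 0 1) w :=
        (pU'.mdifferentiableAt hw).continuousAt.continuousWithinAt
      refine closure_mono ?_ (h2.mem_closure_image hwb)
      rintro _ ⟨_, ⟨y, hy, rfl⟩, rfl⟩
      exact ⟨y, hy, (b3 y hy).symm⟩))
    hz ((mema z hz).mpr hzV)
  rw [b3 w hw]
  exact ⟨w, hw, rfl⟩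

end Disks

open PlaqueInverseLimit in
/-- The pull-backs of round disks along a point of a plaque are sequences of conformal disks. -/
theorem IsBranchedSelfCovering.isConformalDisk_pullbackLevel {S : Type*} [TopologicalSpace S]
    [T2Space S] [ChartedSpace ℂ S] [IsManifold 𝓘(ℂ) ω S] {f : S → S} {d : ℕ}
    (hf : IsBranchedSelfCovering f d) {U : ℕ → Set S} (hU : ∀ n, IsConformalDisk (U n))
    (hUc : ∀ n, ∃ s ∈ f ⁻¹' U n, U (n + 1) = connectedComponentIn (f ⁻¹' U n) s)
    {x : PlaqueInverseLimit f} (hx : x ∈ box f U) {g₀ : ℂ → S} (hg₀ : IsDiskParam g₀)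
    (hgU : g₀ '' ball 0 1 = U 0) {w₀ : ℂ} {r : ℝ} (hr : closedBall w₀ r ⊆ ball 0 1)
    (hxw : x.coord 0 ∈ g₀ '' ball w₀ r) (n : ℕ) :
    IsConformalDisk (pullbackLevel x (g₀ '' ball w₀ r) n) := by
  have hUx : ∀ n, U (n + 1) = connectedComponentIn (f ⁻¹' U n) (x.coord (n + 1)) := by
    intro n
    obtain ⟨s, -, hs⟩ := hUc n
    have := hx (n + 1)
    rw [hs] at this ⊢
    exact connectedComponentIn_eq this
  -- At level 0 the prescribed parametrization is kept, since the disk to be pulled back is round in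
  -- that one.
  have hU' : ∀ n, ∃ g : ℂ → S, IsDiskParam g ∧ g '' ball 0 1 = U n ∧ (n = 0 → g = g₀) := by
    intro n
    rcases eq_or_ne n 0 with rfl | hn
    · exact ⟨g₀, hg₀, hgU, fun _ => rfl⟩
    · obtain ⟨g, h1, h2, h3⟩ := hU n
      exact ⟨g, ⟨h1, h2⟩, h3, fun h => absurd h hn⟩
  choose g hg hg3 hg0 using hU'
  have hg2 : ∀ n, InjOn (g n) (ball 0 1) := fun n => (hg n).injOn
  rw [← hg0 0 rfl] at hxw ⊢
  choose h hh1 hh2 using fun n => hf.exists_isDiskProper (hg n) (hg (n + 1)) (by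
    rw [hg3, hg3]; exact hUx n)
  choose z hz1 hz2 using fun n => (hg3 n).symm.subset (hx n)
  have hhz : ∀ n, h n (z (n + 1)) = z n := by
    intro n
    refine hg2 n ((hh1 n).mapsTo (hz1 _)) (hz1 n) ?_
    rw [hh2 n _ (hz1 _), hz2, hz2, x.map_coord]
  -- `H n` expresses the iterate of `f` from level `n` down to level 0 in disk coordinates.
  obtain ⟨H, hH0, hHs⟩ : ∃ H : ℕ → ℂ → ℂ, H 0 = _root_.id ∧ ∀ n, H (n + 1) = H n ∘ h n :=
    ⟨fun n => Nat.rec _root_.id (fun k F => F ∘ h k) n, rfl, fun n => rfl⟩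
  have hHd : ∀ n, DifferentiableOn ℂ (H n) (ball 0 1) := by
    intro n
    induction n with
    | zero => rw [hH0]; exact differentiableOn_id
    | succ n ih => rw [hHs]; exact ih.comp (hh1 n).differentiableOn (hh1 n).mapsTo
  have hHz : ∀ n, H n (z n) = z 0 := by
    intro n
    induction n with
    | zero => rw [hH0, _root_.id]
    | succ n ih => rw [hHs, Function.comp_apply, hhz, ih]
  have hHc : ∀ n (K : Set ℂ), IsCompact K → K ⊆ ball 0 1 → IsCompact (ball 0 1 ∩ H n ⁻¹' K) := by
    intro n
    induction n with
    | zero => exact fun K hK hKb => by rwa [hH0, preimage_id, inter_eq_right.mpr hKb]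
    | succ n ih =>
      intro K hK hKb
      rw [hHs]
      convert (hh1 n).isCompact_inter_preimage (ih K hK hKb) inter_subset_left using 1
      ext w
      exact ⟨fun hw => ⟨hw.1, (hh1 n).mapsTo hw.1, hw.2⟩, fun hw => ⟨hw.1, hw.2.2⟩⟩
  have hrb : ball w₀ r ⊆ ball 0 1 := ball_subset_closedBall.trans hr
  have hzr : z 0 ∈ ball w₀ r := by
    obtain ⟨w, hw, hwz⟩ := hxw
    rw [← hz2 0] at hwz
    rwa [← hg2 0 (hrb hw) (hz1 0) hwz]
  set W : ℕ → Set ℂ := fun n => connectedComponentIn (ball 0 1 ∩ {w | ‖H n w - w₀‖ < r}) (z n)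
  have hmem : ∀ n, z n ∈ ball (0 : ℂ) 1 ∩ {w | ‖H n w - w₀‖ < r} := fun n =>
    ⟨hz1 n, by rw [mem_ofPred_eq, hHz]; exact mem_ball_iff_norm.mp hzr⟩
  have hWsub : ∀ n, W n ⊆ ball (0 : ℂ) 1 ∩ {w | ‖H n w - w₀‖ < r} := fun n =>
    connectedComponentIn_subset _ _
  have hzW : ∀ n, z n ∈ W n := fun n => mem_connectedComponentIn (hmem n)
  -- In coordinates the `n`-th level is the component at `z n` of the set where `H n` is closer than
  -- `r` to `w₀`. Successive components give the same set as one component for the composite.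
  have key : ∀ n, pullbackLevel x (g 0 '' ball w₀ r) n = g n '' W n := by
    intro n
    induction n with
    | zero =>
      have h1 : IsPreconnected (ball w₀ r) := (convex_ball _ _).isPreconnected
      have h2 : W 0 = ball w₀ r := by
        have : ball (0 : ℂ) 1 ∩ {w | ‖H 0 w - w₀‖ < r} = ball w₀ r := by
          rw [← inter_eq_right.mpr hrb]
          congr 1
          ext w
          rw [mem_ball_iff_norm, hH0]
          rfl
        simp only [W, this]
        exact h1.connectedComponentIn hzr
      rw [h2]
      refine (h1.image _ ((hg 0).continuousOn.mono hrb)).connectedComponentIn ?_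
      exact ⟨z 0, hzr, hz2 0⟩
    | succ n ih =>
      change connectedComponentIn (f ⁻¹' pullbackLevel x (g 0 '' ball w₀ r) n)
        (x.coord (n + 1)) = _
      rw [ih]
      have hxm : x.coord (n + 1) ∈ f ⁻¹' (g n '' W n) := by
        rw [mem_preimage, x.map_coord]
        exact ⟨z n, hzW n, hz2 n⟩
      refine subset_antisymm ?_ ?_
      · set C := connectedComponentIn (f ⁻¹' (g n '' W n)) (x.coord (n + 1))
        have hCU : C ⊆ g (n + 1) '' ball 0 1 := by
          rw [hg3, hUx]
          refine connectedComponentIn_mono _ (preimage_mono ?_)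
          rw [← hg3]
          exact image_mono ((hWsub n).trans inter_subset_left)
        have hl := (hg2 (n + 1)).leftInvOn_invFunOn
        have hCc : IsPreconnected (Function.invFunOn (g (n + 1)) (ball 0 1) '' C) := by
          refine isPreconnected_connectedComponentIn.image _ fun p hp => ?_
          obtain ⟨w, hw, rfl⟩ := hCU hp
          exact ((hg (n + 1)).continuousAt_invFunOn hw).continuousWithinAt
        have hzC : z (n + 1) ∈ Function.invFunOn (g (n + 1)) (ball 0 1) '' C :=
          ⟨_, mem_connectedComponentIn hxm, by rw [← hz2, hl (hz1 _)]⟩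
        have hCW : Function.invFunOn (g (n + 1)) (ball 0 1) '' C ⊆ W (n + 1) := by
          refine hCc.subset_connectedComponentIn hzC ?_
          rintro _ ⟨p, hp, rfl⟩
          obtain ⟨w, hw, rfl⟩ := hCU hp
          rw [hl hw]
          obtain ⟨y, hy, hyw⟩ := connectedComponentIn_subset _ _ hp
          rw [← hh2 n w hw] at hyw
          have hyb := (hWsub n hy)
          rw [hg2 n hyb.1 ((hh1 n).mapsTo hw) hyw] at hyb
          exact ⟨hw, by rw [hHs]; exact hyb.2⟩
        intro p hp
        obtain ⟨w, hw, rfl⟩ := hCU hp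
        exact ⟨w, by simpa [hl hw] using hCW ⟨_, hp, rfl⟩, rfl⟩
      · have hc : IsPreconnected (g (n + 1) '' W (n + 1)) :=
          isPreconnected_connectedComponentIn.image _
            ((hg (n + 1)).continuousOn.mono ((hWsub _).trans inter_subset_left))
        refine hc.subset_connectedComponentIn ⟨_, hzW _, hz2 _⟩ ?_
        have h1 : h n '' W (n + 1) ⊆ W n := by
          refine (isPreconnected_connectedComponentIn.image _ ((hh1 n).differentiableOn.continuousOn.mono
            ((hWsub _).trans inter_subset_left))).subset_connectedComponentIn
            ⟨_, hzW _, hhz n⟩ ?_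
          rintro _ ⟨w, hw, rfl⟩
          have := (hWsub _ hw).2
          rw [hHs] at this
          exact ⟨(hh1 n).mapsTo (hWsub _ hw).1, this⟩
        rintro _ ⟨w, hw, rfl⟩
        rw [mem_preimage, ← hh2 n w (hWsub _ hw).1]
        exact ⟨_, h1 ⟨w, hw, rfl⟩, rfl⟩
  obtain ⟨b, b1, b2, b3⟩ := exists_conformal_connectedComponentIn (hHd n) (w₀ := w₀) (r := r)
    (p := z n) (fun ρ hρ => by
      have := hHc n (closedBall w₀ ρ) (isCompact_closedBall _ _)
        ((closedBall_subset_closedBall hρ.le).trans hr)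
      convert this using 2
      ext w
      rw [mem_preimage, mem_closedBall_iff_norm]
      rfl) (hmem n).1 (hmem n).2
  have hbm : MapsTo b (ball 0 1) (ball 0 1) := by
    rw [mapsTo_iff_image_subset, b3]
    exact (hWsub n).trans inter_subset_left
  have := (hg n).comp b1 b2 hbm
  refine ⟨g n ∘ b, this.mdifferentiableOn, this.injOn, ?_⟩
  rw [image_comp, b3, key]

/-! ### Coordinates and pull-backs in the plaque topology -/

namespace PlaqueInverseLimit

variable {S : Type*} {f : S → S}

/-- The backward orbit with its first `N` coordinates dropped. -/
def shift (N : ℕ) (y : PlaqueInverseLimit f) : PlaqueInverseLimit f :=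
  ⟨fun n => y.coord (N + n), fun n => y.map_coord (N + n)⟩

theorem iterate_coord (y : PlaqueInverseLimit f) (n k : ℕ) : f^[k] (y.coord (n + k)) = y.coord n := by
  induction k with
  | zero => rfl
  | succ k ih => rw [Function.iterate_succ_apply, ← add_assoc, y.map_coord, ih]

variable [TopologicalSpace S]

theorem isPreconnected_pullbackLevel (y : PlaqueInverseLimit f) (A : Set S) (n : ℕ) :
    IsPreconnected (pullbackLevel y A n) := by
  cases n <;> exact isPreconnected_connectedComponentIn

theorem pullbackLevel_succ_subset (y : PlaqueInverseLimit f) (A : Set S) (n : ℕ) :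
    pullbackLevel y A (n + 1) ⊆ f ⁻¹' pullbackLevel y A n :=
  connectedComponentIn_subset _ _

theorem iterate_mem_pullbackLevel (y : PlaqueInverseLimit f) (A : Set S) (n k : ℕ) {s : S}
    (hs : s ∈ pullbackLevel y A (n + k)) : f^[k] s ∈ pullbackLevel y A n := by
  induction k generalizing s with
  | zero => exact hs
  | succ k ih => exact ih (pullbackLevel_succ_subset y A (n + k) hs)

/-- A sequence of components of successive preimages is contained in any sequence of successive
preimage components that contains its first term. -/
theorem pullbackLevel_shift_subset (y : PlaqueInverseLimit f) {A : Set S} {N : ℕ}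
    {W : ℕ → Set S} (hA : y.coord N ∈ A)
    (hW : ∀ n, W (n + 1) = connectedComponentIn (f ⁻¹' W n) (y.coord (N + (n + 1))))
    (h0 : A ⊆ W 0) (n : ℕ) : pullbackLevel (shift N y) A n ⊆ W n := by
  induction n with
  | zero => exact (connectedComponentIn_subset _ _).trans h0
  | succ n ih =>
    rw [hW]
    exact connectedComponentIn_mono _ (preimage_mono ih)

theorem isOpen_pullbackLevel [LocallyConnectedSpace S] (hfc : Continuous f)
    (y : PlaqueInverseLimit f) {A : Set S} (hA : IsOpen A) (n : ℕ) :
    IsOpen (pullbackLevel y A n) := by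
  induction n with
  | zero => exact hA.connectedComponentIn
  | succ n ih => exact (ih.preimage hfc).connectedComponentIn

/-- The closures of the levels of the pull-back of a smaller set. -/
theorem closure_pullbackLevel_subset (hfc : Continuous f) (y : PlaqueInverseLimit f) {A B : Set S}
    (hB : IsPreconnected B) (hBA : closure B ⊆ A) (hy : y.coord 0 ∈ B) (n : ℕ) :
    closure (pullbackLevel y B n) ⊆ pullbackLevel y A n := by
  induction n with
  | zero =>
    exact (closure_mono (connectedComponentIn_subset _ _)).trans
      (hB.closure.subset_connectedComponentIn (subset_closure hy) hBA)
  | succ n ih =>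
    intro p hp
    refine closure_connectedComponentIn_inter_subset _ _ ⟨closure_mono
      (pullbackLevel_mono y (subset_closure.trans hBA) (n + 1)) hp, ih ?_⟩
    exact closure_mono (image_subset_iff.mpr (pullbackLevel_succ_subset y B n))
      (image_closure_subset_closure_image hfc ⟨p, hp, rfl⟩)

variable [T2Space S] [LocallyCompactSpace S]

/-- Surround the next coordinate by a closed neighborhood inside `A` that contains no other preimage
of the current one. The image of its frontier is closed and omits the current coordinate, so it can
be avoided one level down by induction. A connected level that avoids the frontier cannot escape. -/
theorem exists_pullbackLevel_subset (hfcl : IsClosedMap f) (hfin : ∀ s, (f ⁻¹' {s}).Finite)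
    (y : PlaqueInverseLimit f) (N : ℕ) {A : Set S} (hA : IsOpen A) (hy : y.coord N ∈ A) :
    ∃ B, IsOpen B ∧ y.coord 0 ∈ B ∧ pullbackLevel y B N ⊆ A := by
  induction N generalizing A with
  | zero => exact ⟨A, hA, hy, connectedComponentIn_subset _ _⟩
  | succ N ih =>
    set p := y.coord (N + 1)
    have hF : IsClosed (f ⁻¹' {y.coord N} \ {p}) := ((hfin _).subset sdiff_subset).isClosed
    have hN : A ∩ (f ⁻¹' {y.coord N} \ {p})ᶜ ∈ 𝓝 p :=
      (hA.inter hF.isOpen_compl).mem_nhds ⟨hy, fun h => h.2 rfl⟩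
    obtain ⟨K, hK, hKc, hKA⟩ := exists_mem_nhds_isClosed_subset hN
    have hfr : y.coord N ∈ (f '' frontier (interior K))ᶜ := by
      rintro ⟨q, hq, hqy⟩
      rw [isOpen_interior.frontier_eq] at hq
      refine (hKA (hKc.closure_subset_iff.mpr interior_subset hq.1)).2 ⟨hqy, fun hqp => hq.2 ?_⟩
      rw [mem_singleton_iff.mp hqp]
      exact mem_interior_iff_mem_nhds.mpr hK
    obtain ⟨B, hB, hyB, hBN⟩ := ih (hfcl _ isClosed_frontier).isOpen_compl hfr
    refine ⟨B, hB, hyB, ?_⟩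
    have hsub : pullbackLevel y B (N + 1) ⊆ interior K := by
      refine (isPreconnected_pullbackLevel y B (N + 1)).subset_of_closure_inter_subset
        isOpen_interior ⟨p, coord_mem_pullbackLevel y hyB _, mem_interior_iff_mem_nhds.mpr hK⟩ ?_
      rintro q ⟨hq, hqB⟩
      by_contra hqK
      refine hBN (pullbackLevel_succ_subset y B N hqB) ⟨q, ?_, rfl⟩
      rw [isOpen_interior.frontier_eq]
      exact ⟨hq, hqK⟩
    exact fun q hq => (hKA (interior_subset (hsub hq))).1

theorem continuous_shift (hfcl : IsClosedMap f) (hfin : ∀ s, (f ⁻¹' {s}).Finite) (N : ℕ) :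
    Continuous (shift N : PlaqueInverseLimit f → PlaqueInverseLimit f) := by
  refine ⟨fun O hO y hy => ?_⟩
  obtain ⟨A, hA, hyA, hAO⟩ := hO _ hy
  obtain ⟨B, hB, hyB, hBA⟩ := exists_pullbackLevel_subset hfcl hfin y N hA hyA
  refine ⟨B, hB, hyB, fun z hz => hAO fun n => ?_⟩
  have key : ∀ n, pullbackLevel y B (N + n) ⊆ pullbackLevel (shift N y) A n := by
    intro n
    induction n with
    | zero =>
      exact (isPreconnected_pullbackLevel y B N).subset_connectedComponentIn
        (coord_mem_pullbackLevel y hyB N) hBA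
    | succ n ih => exact connectedComponentIn_mono _ (preimage_mono ih)
  exact key n (hz (N + n))

theorem continuous_coord (hfcl : IsClosedMap f) (hfin : ∀ s, (f ⁻¹' {s}).Finite) (N : ℕ) :
    Continuous fun y : PlaqueInverseLimit f => y.coord N := by
  have h0 : Continuous fun y : PlaqueInverseLimit f => y.coord 0 :=
    ⟨fun A hA y hy => ⟨A, hA, hy, fun z hz =>
      connectedComponentIn_subset A (y.coord 0) (hz 0)⟩⟩
  exact h0.comp (continuous_shift hfcl hfin N)

theorem t2Space (hfcl : IsClosedMap f) (hfin : ∀ s, (f ⁻¹' {s}).Finite) :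
    T2Space (PlaqueInverseLimit f) := by
  refine ⟨fun y z hyz => ?_⟩
  obtain ⟨n, hn⟩ : ∃ n, y.coord n ≠ z.coord n := by
    by_contra! h
    exact hyz (PlaqueInverseLimit.ext (funext h))
  exact separated_by_continuous (continuous_coord hfcl hfin n) hn

omit [T2Space S] [LocallyCompactSpace S]

/-- Components of preimages of connected open sets are mapped onto. -/
theorem image_connectedComponentIn_preimage [LocallyConnectedSpace S] (hfc : Continuous f)
    (hfo : IsOpenMap f) (hfcl : IsClosedMap f) {A : Set S} (hA : IsOpen A) (hAc : IsPreconnected A)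
    {s : S} (hs : s ∈ f ⁻¹' A) : f '' connectedComponentIn (f ⁻¹' A) s = A := by
  set C := connectedComponentIn (f ⁻¹' A) s
  have hC : IsOpen C := (hA.preimage hfc).connectedComponentIn
  refine subset_antisymm (image_subset_iff.mpr (connectedComponentIn_subset _ _)) ?_
  refine hAc.subset_of_closure_inter_subset (hfo C hC) ⟨f s, hs, s, mem_connectedComponentIn hs, rfl⟩ ?_
  rintro q ⟨hq, hqA⟩
  obtain ⟨p, hp, rfl⟩ := hfcl.closure_image_subset C hq
  exact ⟨p, closure_connectedComponentIn_inter_subset _ _ ⟨hp, hqA⟩, rfl⟩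

theorem image_pullbackLevel_succ [LocallyConnectedSpace S] (hfc : Continuous f)
    (hfo : IsOpenMap f) (hfcl : IsClosedMap f) (y : PlaqueInverseLimit f) {A : Set S}
    (hA : IsOpen A) (hy : y.coord 0 ∈ A) (n : ℕ) :
    f '' pullbackLevel y A (n + 1) = pullbackLevel y A n := by
  refine image_connectedComponentIn_preimage hfc hfo hfcl (isOpen_pullbackLevel hfc y hA n)
    (isPreconnected_pullbackLevel y A n) ?_
  rw [mem_preimage, y.map_coord]
  exact coord_mem_pullbackLevel y hy n

/-- Each level maps onto the preceding one, so a point of one level can be lifted step by step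
through all higher levels to a full backward orbit. -/
theorem level_pullback [LocallyConnectedSpace S] (hfc : Continuous f)
    (hfo : IsOpenMap f) (hfcl : IsClosedMap f) (y : PlaqueInverseLimit f) {A : Set S}
    (hA : IsOpen A) (hy : y.coord 0 ∈ A) (n : ℕ) :
    level (pullback y A) n = pullbackLevel y A n := by
  refine subset_antisymm (image_subset_iff.mpr fun z hz => hz n) fun s hs => ?_
  have hstep : ∀ (k : ℕ) (p : S), ∃ q, p ∈ pullbackLevel y A (n + k) →
      q ∈ pullbackLevel y A (n + (k + 1)) ∧ f q = p := by
    intro k p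
    by_cases hp : p ∈ pullbackLevel y A (n + k)
    · rw [← image_pullbackLevel_succ hfc hfo hfcl y hA hy] at hp
      obtain ⟨q, hq, hqp⟩ := hp
      exact ⟨q, fun _ => ⟨hq, hqp⟩⟩
    · exact ⟨p, fun h => absurd h hp⟩
  choose nxt hnxt using hstep
  set u : ℕ → S := fun k => Nat.rec s nxt k
  have hu : ∀ k, u k ∈ pullbackLevel y A (n + k) := by
    intro k
    induction k with
    | zero => exact hs
    | succ k ih => exact (hnxt k _ ih).1
  have huf : ∀ k, f (u (k + 1)) = u k := fun k => (hnxt k _ (hu k)).2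
  have hun : ∀ k, f^[k] (u k) = s := by
    intro k
    induction k with
    | zero => rfl
    | succ k ih => rw [Function.iterate_succ_apply, huf, ih]
  -- The lifts `u k` of `s` live at level `n + k`. Applying `f^[n]` re-indexes them so that one
  -- formula also covers the levels below `n`.
  refine ⟨⟨fun m => f^[n] (u m), fun m => ?_⟩, fun m => ?_, hun n⟩
  · change f (f^[n] (u (m + 1))) = f^[n] (u m)
    rw [← Function.iterate_succ_apply' f, Function.iterate_succ_apply, huf]
  · refine iterate_mem_pullbackLevel y A m n ?_
    rw [add_comm]
    exact hu m

theorem isOpenMap_coord [LocallyConnectedSpace S] (hfc : Continuous f)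
    (hfo : IsOpenMap f) (hfcl : IsClosedMap f) (n : ℕ) :
    IsOpenMap fun y : PlaqueInverseLimit f => y.coord n := by
  intro O hO
  rw [isOpen_iff_mem_nhds]
  rintro _ ⟨y, hy, rfl⟩
  obtain ⟨A, hA, hyA, hAO⟩ := hO y hy
  refine mem_of_superset ((isOpen_pullbackLevel hfc y hA n).mem_nhds
    (coord_mem_pullbackLevel y hyA n)) ?_
  rw [← level_pullback hfc hfo hfcl y hA hyA]
  exact image_mono hAO

/-- A plaque is the pull-back of its first level along any of its points. -/
theorem eq_pullbackLevel {y : PlaqueInverseLimit f} {U : ℕ → Set S} (hU : IsPreconnected (U 0))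
    (hUc : ∀ n, ∃ s ∈ f ⁻¹' U n, U (n + 1) = connectedComponentIn (f ⁻¹' U n) s)
    (hy : y ∈ box f U) (n : ℕ) : U n = pullbackLevel y (U 0) n := by
  induction n with
  | zero => exact (hU.connectedComponentIn (hy 0)).symm
  | succ n ih =>
    obtain ⟨s, -, hs⟩ := hUc n
    have := hy (n + 1)
    rw [hs] at this
    rw [hs, connectedComponentIn_eq this, pullbackLevel, ← ih]

end PlaqueInverseLimit

/-! ### Path-connectedness: infinite concatenation, deleting a point -/

section PathConnected

variable {X : Type*} [TopologicalSpace X]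

/-- Concatenation of a sequence of paths that shrink to a point. -/
theorem joinedIn_of_antitone_basis {V : ℕ → Set X} {x : X} (hV : Antitone V) (hx : x ∈ V 0)
    (hbasis : ∀ O ∈ 𝓝 x, ∃ k, V k ⊆ O) {y : ℕ → X}
    (hy : ∀ k, JoinedIn (V k) (y k) (y (k + 1))) : JoinedIn (V 0) (y 0) x := by
  set γ := fun k => (hy k).somePath
  -- The `k`-th path is run on the interval from `k` to `k + 1`.
  set F : ℝ → X := fun t => (γ ⌊t⌋₊).extend (t - ⌊t⌋₊) with hF
  have hFV : ∀ t, 0 ≤ t → F t ∈ V ⌊t⌋₊ := by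
    intro t ht
    have h1 := Nat.floor_le ht
    have h2 := Nat.lt_floor_add_one t
    simp only [hF]
    rw [Path.extend_apply _ ⟨by linarith, by linarith⟩]
    exact (hy _).somePath_mem _
  have hFeq : ∀ (k : ℕ) (t : ℝ), ⌊t⌋₊ = k → F t = (γ k).extend (t - k) := by
    rintro k t rfl
    rfl
  have hFk : ∀ k : ℕ, EqOn F (fun t => (γ k).extend (t - k)) (Icc k (k + 1)) := by
    intro k t ht
    rcases ht.2.eq_or_lt with h | h
    · have hfl : ⌊t⌋₊ = k + 1 := by
        rw [h]
        exact_mod_cast Nat.floor_natCast (k + 1)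
      simp only [hFeq (k + 1) t hfl]
      rw [h, add_sub_cancel_left, Path.extend_one]
      push_cast
      rw [sub_self, Path.extend_zero]
    · have hfl : ⌊t⌋₊ = k := (Nat.floor_eq_iff (k.cast_nonneg.trans ht.1)).mpr ⟨ht.1, h⟩
      exact hFeq k t hfl
  have hFc : ∀ k : ℕ, ContinuousOn F (Icc 0 k) := by
    intro k
    induction k with
    | zero => simp
    | succ k ih =>
      have h1 : ContinuousOn F (Icc k (k + 1)) :=
        ((γ k).continuous_extend.comp (by fun_prop : Continuous fun t : ℝ => t - k)).continuousOn.congr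
          (hFk k)
      push_cast
      rw [← Icc_union_Icc_eq_Icc k.cast_nonneg (by linarith : (k : ℝ) ≤ k + 1)]
      exact ih.union_of_isClosed h1 isClosed_Icc isClosed_Icc
  have hFc' : ContinuousOn F (Ici 0) := by
    intro t ht
    obtain ⟨k, hk⟩ := exists_nat_gt t
    refine (hFc k t ⟨ht, hk.le⟩).mono_of_mem_nhdsWithin ?_
    filter_upwards [self_mem_nhdsWithin, mem_nhdsWithin_of_mem_nhds (Iio_mem_nhds hk)] with s h1 h2
    exact ⟨h1, le_of_lt h2⟩
  have hpos : ∀ s : ℝ, 0 ≤ s → s < 1 → 0 ≤ s / (1 - s) := fun s h0 h1 =>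
    div_nonneg h0 (by linarith)
  -- The substitution `s / (1 - s)` compresses the half-line into the unit interval. For `s > k / (k
  -- + 1)` the path lies in `V k`, which gives continuity at the end point `x`.
  refine JoinedIn.ofLine (f := fun s => if s < 1 then F (s / (1 - s)) else x) ?_ ?_ (by simp) ?_
  · intro s hs
    rcases hs.2.eq_or_lt with h | h
    · subst h
      have h1 : (if (1 : ℝ) < 1 then F (1 / (1 - 1)) else x) = x := by simp
      rw [ContinuousWithinAt, h1]
      intro O hO
      obtain ⟨k, hk⟩ := hbasis O hO
      have hk1 : (k : ℝ) / (k + 1) < 1 := by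
        rw [div_lt_one (by positivity)]
        linarith
      refine mem_map.mpr ?_
      filter_upwards [self_mem_nhdsWithin, mem_nhdsWithin_of_mem_nhds (Ioi_mem_nhds hk1)]
        with s hs hsk
      rw [mem_preimage]
      split_ifs with hlt
      · have hle : (k : ℝ) ≤ s / (1 - s) := by
          rw [le_div_iff₀ (by linarith)]
          have := (div_lt_iff₀ (by positivity : (0 : ℝ) < k + 1)).mp hsk
          nlinarith
        exact hk (hV (Nat.le_floor hle) (hFV _ (hpos s hs.1 hlt)))
      · exact mem_of_mem_nhds hO
    · have h1 : ContinuousWithinAt (fun s : ℝ => F (s / (1 - s))) (unitInterval ∩ Iio 1) s := by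
        have h2 : ContinuousWithinAt (fun s : ℝ => s / (1 - s)) (unitInterval ∩ Iio 1) s :=
          (ContinuousAt.div (f := fun s : ℝ => s) (g := fun s : ℝ => 1 - s) continuousAt_id
            (by fun_prop) (sub_ne_zero.mpr h.ne')).continuousWithinAt
        exact ContinuousWithinAt.comp (g := F) (t := Ici (0 : ℝ)) (hFc' _ (hpos s hs.1 h)) h2 fun r hr => hpos r hr.1.1 hr.2
      have h3 : ContinuousWithinAt (fun s => if s < 1 then F (s / (1 - s)) else x)
          (unitInterval ∩ Iio 1) s :=
        h1.congr (fun r hr => if_pos hr.2) (if_pos h)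
      exact h3.mono_of_mem_nhdsWithin
        (inter_mem self_mem_nhdsWithin (mem_nhdsWithin_of_mem_nhds (Iio_mem_nhds h)))
  · simp only [zero_lt_one, if_true, zero_div, hF]
    simp
  · rintro _ ⟨s, hs, rfl⟩
    by_cases h : s < 1
    · simp only [h, if_true]
      exact hV (Nat.zero_le _) (hFV _ (hpos s hs.1 h))
    · simpa only [h, if_false] using hx

theorem IsConnected.isPathConnected_of_local {O : Set X} (hO : IsConnected O)
    (h : ∀ y ∈ O, ∃ Δ ∈ 𝓝 y, Δ ⊆ O ∧ IsPathConnected Δ) : IsPathConnected O := by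
  obtain ⟨x, hx⟩ := hO.nonempty
  refine ⟨x, hx, ?_⟩
  change O ⊆ pathComponentIn O x
  have hopen : IsOpen (pathComponentIn O x) := by
    rw [isOpen_iff_mem_nhds]
    intro y hy
    obtain ⟨Δ, hΔ, hsub, hc⟩ := h y (pathComponentIn_subset hy)
    filter_upwards [hΔ] with z hz
    exact JoinedIn.trans hy ((hc.joinedIn y (mem_of_mem_nhds hΔ) z hz).mono hsub)
  refine hO.isPreconnected.subset_of_closure_inter_subset hopen
    ⟨x, hx, mem_pathComponentIn_self hx⟩ ?_
  rintro y ⟨hy, hyO⟩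
  obtain ⟨Δ, hΔ, hsub, hc⟩ := h y hyO
  obtain ⟨z, hzΔ, hz⟩ := mem_closure_iff_nhds.mp hy Δ hΔ
  exact JoinedIn.trans hz ((hc.joinedIn z hzΔ y (mem_of_mem_nhds hΔ)).mono hsub)

/-- In a separation of the punctured set, the connected punctured neighborhood lies on one side.
Adding `v` to that side would separate `V` itself. -/
theorem IsConnected.sdiff_singleton_of_local [T1Space X] {V Δ : Set X} {v : X}
    (hV : IsConnected V) (hv : v ∈ V) (hΔ : IsOpen Δ) (hvΔ : v ∈ Δ) (hsub : Δ ⊆ V)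
    (hc : IsConnected (Δ \ {v})) : IsConnected (V \ {v}) := by
  refine ⟨hc.nonempty.mono (sdiff_subset_sdiff_left hsub), ?_⟩
  have key : ∀ u u' : Set X, IsOpen u → IsOpen u' → V \ {v} ⊆ u ∪ u' →
      (V \ {v}) ∩ (u ∩ u') = ∅ → Δ \ {v} ⊆ u → V \ {v} ⊆ u := by
    intro u u' hu hu' hcov hdis hΔu
    have h1 := isPreconnected_iff_subset_of_disjoint.mp hV.isPreconnected (u ∪ Δ) (u' \ {v})
      (hu.union hΔ) (hu'.sdiff isClosed_singleton) ?_ ?_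
    · rcases h1 with h1 | h1
      · intro p hp
        rcases h1 hp.1 with h | h
        · exact h
        · exact hΔu ⟨h, hp.2⟩
      · exact absurd rfl (h1 hv).2
    · intro p hp
      by_cases hpv : p = v
      · exact Or.inl (Or.inr (hpv ▸ hvΔ))
      · exact (hcov ⟨hp, hpv⟩).imp Or.inl fun h => ⟨h, hpv⟩
    · refine eq_empty_of_forall_notMem ?_
      rintro p ⟨hpV, hp, hpu', hpv⟩
      have hpu : p ∈ u := hp.elim _root_.id fun h => hΔu ⟨h, hpv⟩
      exact hdis.subset ⟨⟨hpV, hpv⟩, hpu, hpu'⟩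
  refine isPreconnected_iff_subset_of_disjoint.mpr fun u u' hu hu' hcov hdis => ?_
  have hΔ' : Δ \ {v} ⊆ V \ {v} := sdiff_subset_sdiff_left hsub
  rcases isPreconnected_iff_subset_of_disjoint.mp hc.isPreconnected u u' hu hu' (hΔ'.trans hcov)
    (subset_empty_iff.mp (hdis ▸ inter_subset_inter_left _ hΔ')) with h | h
  · exact Or.inl (key u u' hu hu' hcov hdis h)
  · exact Or.inr (key u' u hu' hu (union_comm u u' ▸ hcov) (inter_comm u u' ▸ hdis) h)

end PathConnected

theorem isConnected_ball_sdiff_singleton (w : ℂ) {r : ℝ} (hr : 0 < r) :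
    IsConnected (ball w r \ {w}) := by
  have h1 := isConnected_compl_singleton_of_one_lt_rank (E := ℂ)
    (by rw [Complex.rank_real_complex]; norm_num) 0
  have h2 := h1.image _ (OpenPartialHomeomorph.continuous_univBall w r).continuousOn
  convert h2 using 1
  set e := OpenPartialHomeomorph.univBall w r
  have hs : e.source = univ := OpenPartialHomeomorph.univBall_source w r
  have ht : e.target = ball w r := OpenPartialHomeomorph.univBall_target w hr
  have h0 : e 0 = w := OpenPartialHomeomorph.univBall_apply_zero w r
  ext p
  constructor
  · rintro ⟨hp, hpw⟩
    rw [← ht] at hp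
    refine ⟨e.symm p, fun h => hpw ?_, e.right_inv hp⟩
    rw [mem_singleton_iff, ← e.right_inv hp, mem_singleton_iff.mp h, h0]
  · rintro ⟨z, hz, rfl⟩
    refine ⟨ht ▸ e.map_source (hs ▸ mem_univ z), fun h => hz ?_⟩
    exact e.injOn (hs ▸ mem_univ z) (hs ▸ mem_univ 0) (h.trans h0.symm)

/-! ### Decreasing binary sequences with an infimum -/

/-- Diagonal argument: a decreasing sequence of classes of binary sequences whose common lower
bounds have a greatest element must reach that element. Applied to the indices of a shrinking basis,
it shows that they are eventually constant. -/
theorem exists_forall_eventually_imp_of_germ {E : ℕ → ℕ → Prop}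
    (hE : ∀ j k n, j ≤ k → E k n → E j n)
    (h : ∃ a : AlmostBinarySeq, ⋂ j, Set.Iic ((E j : ℕ → Prop) : AlmostBinarySeq) = Set.Iic a) :
    ∃ K, ∀ j, ∀ᶠ n in cofinite, E K n → E j n := by
  obtain ⟨a, ha⟩ := h
  induction a using Germ.inductionOn with | _ α
  have hα : ∀ j, ∀ᶠ n in cofinite, α n → E j n := fun j =>
    Germ.coe_le.mp (mem_iInter.mp (ha.symm.subset (mem_Iic.mpr le_rfl)) j)
  obtain ⟨K, hK⟩ : ∃ K, ∀ᶠ n in cofinite, E K n → α n := by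
    by_contra! hcon
    have hex : ∀ k, ∃ n, k ≤ n ∧ E k n ∧ ¬ α n := by
      intro k
      obtain ⟨n, hn, hkn⟩ := (frequently_cofinite_iff_infinite.mp (hcon k)).exists_gt k
      exact ⟨n, hkn.le, hn⟩
    choose ν hν1 hν2 hν3 using hex
    -- The set of the chosen places `ν k` lies almost below every `E j`, since only the finitely
    -- many `k < j` can fail. So it lies almost below `α`, although `α` fails at each of these
    -- infinitely many places.
    have hδ : (((fun n => ∃ k, ν k = n : ℕ → Prop)) : AlmostBinarySeq) ∈
        ⋂ j, Set.Iic ((E j : ℕ → Prop) : AlmostBinarySeq) := by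
      refine mem_iInter.mpr fun j => Germ.coe_le.mpr ?_
      refine ((finite_Iio j).image ν).subset fun n hn => ?_
      obtain ⟨⟨k, rfl⟩, hnE⟩ := Classical.not_imp.mp hn
      refine ⟨k, ?_, rfl⟩
      by_contra! hjk
      exact hnE (hE j k _ (not_lt.mp hjk) (hν2 k))
    have h2 : {n | ¬ ((∃ k, ν k = n) → α n)}.Finite := Germ.coe_le.mp (mem_Iic.mp (ha.subset hδ))
    have h3 : (range ν).Finite := h2.subset (by
      rintro _ ⟨k, rfl⟩ hk
      exact hν3 k (hk ⟨k, rfl⟩))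
    obtain ⟨m, hm⟩ := h3.bddAbove
    have := hm ⟨m + 1, rfl⟩
    have := hν1 (m + 1)
    omega
  refine ⟨K, fun j => ?_⟩
  filter_upwards [hK, hα j] with n h1 h2 h3 using h2 (h1 h3)

/-! ### Inverse of the shift and sections of the projection -/

namespace PlaqueInverseLimit

variable {S : Type*} {f : S → S}

/-- The map of the inverse limit induced by `f^[N]`, inverse to the shift. -/
def unshift (N : ℕ) (y : PlaqueInverseLimit f) : PlaqueInverseLimit f :=
  ⟨fun n => f^[N] (y.coord n), fun n => by
    rw [← Function.iterate_succ_apply' f, Function.iterate_succ_apply, y.map_coord]⟩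

theorem unshift_shift (N : ℕ) (y : PlaqueInverseLimit f) : unshift N (shift N y) = y := by
  ext n
  have := y.iterate_coord n N
  rwa [add_comm] at this

theorem shift_unshift (N : ℕ) (y : PlaqueInverseLimit f) : shift N (unshift N y) = y := by
  ext n
  have := y.iterate_coord n N
  rwa [add_comm] at this

variable [TopologicalSpace S]

theorem continuous_unshift (hfc : Continuous f) (N : ℕ) :
    Continuous (unshift N : PlaqueInverseLimit f → PlaqueInverseLimit f) := by
  refine ⟨fun O hO y hy => ?_⟩
  obtain ⟨A, hA, hyA, hAO⟩ := hO _ hy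
  refine ⟨f^[N] ⁻¹' A, hA.preimage (hfc.iterate N), hyA, fun z hz => hAO fun n => ?_⟩
  have key : ∀ n, pullbackLevel y (f^[N] ⁻¹' A) n ⊆ f^[N] ⁻¹' pullbackLevel (unshift N y) A n := by
    intro n
    rw [← image_subset_iff]
    have hc : IsPreconnected (f^[N] '' pullbackLevel y (f^[N] ⁻¹' A) n) :=
      (isPreconnected_pullbackLevel y _ n).image _ (hfc.iterate N).continuousOn
    have hm : (unshift N y).coord n ∈ f^[N] '' pullbackLevel y (f^[N] ⁻¹' A) n :=
      ⟨y.coord n, coord_mem_pullbackLevel y hyA n, rfl⟩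
    induction n with
    | zero =>
      exact hc.subset_connectedComponentIn hm (image_subset_iff.mpr (connectedComponentIn_subset _ _))
    | succ n ih =>
      refine hc.subset_connectedComponentIn hm ?_
      rintro _ ⟨p, hp, rfl⟩
      rw [mem_preimage, ← Function.iterate_succ_apply' f, Function.iterate_succ_apply]
      refine ih ((isPreconnected_pullbackLevel y _ n).image _ (hfc.iterate N).continuousOn)
        ⟨y.coord n, coord_mem_pullbackLevel y hyA n, rfl⟩ ⟨f p, ?_, rfl⟩
      exact pullbackLevel_succ_subset y _ n hp
  exact key n (hz n)

/-- The inverse branch of the projection of a pull-back along which `f` is injective. -/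
theorem exists_section [LocallyConnectedSpace S] (hfc : Continuous f) (hfo : IsOpenMap f)
    (hfcl : IsClosedMap f) (y : PlaqueInverseLimit f) {A : Set S} (hA : IsOpen A)
    (hAc : IsPreconnected A) (hy : y.coord 0 ∈ A)
    (hinj : ∀ n, InjOn f (pullbackLevel y A (n + 1))) :
    ∃ σ : S → PlaqueInverseLimit f, ContinuousOn σ A ∧ (∀ t ∈ A, σ t ∈ pullback y A) ∧
      (∀ t ∈ A, (σ t).coord 0 = t) ∧ ∀ w ∈ pullback y A, σ (w.coord 0) = w := by
  set p : PlaqueInverseLimit f → S := fun w => w.coord 0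
  have hpi : InjOn p (pullback y A) := by
    intro w hw z hz h
    ext n
    induction n with
    | zero => exact h
    | succ n ih => exact hinj n (hw (n + 1)) (hz (n + 1)) (by rw [w.map_coord, z.map_coord, ih])
  have hps : p '' pullback y A = A := by
    refine (level_pullback hfc hfo hfcl y hA hy 0).trans ?_
    exact hAc.connectedComponentIn hy
  have : Nonempty (PlaqueInverseLimit f) := ⟨y⟩
  have hl : ∀ w ∈ pullback y A, Function.invFunOn p (pullback y A) (p w) = w :=
    hpi.leftInvOn_invFunOn
  refine ⟨Function.invFunOn p (pullback y A), ?_, ?_, ?_, hl⟩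
  · intro t ht
    obtain ⟨w, hw, rfl⟩ := hps.symm.subset ht
    refine ContinuousAt.continuousWithinAt fun O hO => ?_
    rw [hl w hw] at hO
    obtain ⟨O', hO', hO'o, hwO'⟩ := mem_nhds_iff.mp hO
    have h1 := isOpenMap_coord hfc hfo hfcl 0 _ (hO'o.inter (isOpen_pullback y hA))
    refine mem_map.mpr (mem_of_superset (h1.mem_nhds ⟨w, ⟨hwO', hw⟩, rfl⟩) ?_)
    rintro _ ⟨z, hz, rfl⟩
    rw [mem_preimage]
    change Function.invFunOn p (pullback y A) (p z) ∈ O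
    rw [hl z hz.2]
    exact hO' hz.1
  · exact fun t ht => Function.invFunOn_mem (hps.symm.subset ht)
  · exact fun t ht => Function.invFunOn_eq (hps.symm.subset ht)

end PlaqueInverseLimit

open PlaqueInverseLimit

/-! ### Disk neighborhoods of points other than the given one -/

section Sheets

variable {S : Type*} [TopologicalSpace S] [T2Space S] [ChartedSpace ℂ S] [IsManifold 𝓘(ℂ) ω S]
  {f : S → S} {d : ℕ}

/-- With no critical points the degree is 1 by the Riemann–Hurwitz count, so every fibre is a single
point. -/
theorem IsBranchedSelfCovering.injOn_of_not_isCriticalPoint (hf : IsBranchedSelfCovering f d)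
    {A A' : Set S} {s : S} (hA : IsConformalDisk A) (hA' : IsConformalDisk A')
    (h : A' = connectedComponentIn (f ⁻¹' A) s) (hc : ∀ c ∈ A', ¬ IsCriticalPoint f c) :
    InjOn f A' := by
  obtain ⟨g, g1, g2, rfl⟩ := hA
  obtain ⟨g', g1', g2', rfl⟩ := hA'
  have hg : IsDiskParam g := ⟨g1, g2⟩
  have hg' : IsDiskParam g' := ⟨g1', g2'⟩
  obtain ⟨h, h1, h2⟩ := hf.exists_isDiskProper hg hg' h
  obtain ⟨k, M, hkM, hM1, hM, -, hk⟩ := h1.exists_degree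
  have hM0 : M = 0 := by
    refine Multiset.eq_zero_of_forall_notMem fun z hz => ?_
    have hzb := mem_ball_zero_iff.mpr (hM1 z hz)
    refine hc _ ⟨z, hzb, rfl⟩ ((isCriticalPoint_iff_of_lift hf.holomorphic hg hg'
      h1.differentiableOn h1.mapsTo h2 hzb).mpr ?_)
    apply apply_eq_zero_of_analyticOrderAt_ne_zero
    rw [hM z (hM1 z hz)]
    exact_mod_cast Multiset.count_ne_zero.mpr hz
  subst hM0
  rintro _ ⟨z, hz, rfl⟩ _ ⟨w, hw, rfl⟩ hzw
  rw [← h2 z hz, ← h2 w hw] at hzw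
  have hzw' := g2 (h1.mapsTo hz) (h1.mapsTo hw) hzw
  have h3 := hk (h z) (mem_ball_zero_iff.mp (h1.mapsTo hz)) (by simp)
  rw [← hkM, Multiset.card_zero, zero_add, ncard_eq_one] at h3
  obtain ⟨t, ht⟩ := h3
  have hz' : z = t := ht.subset ⟨mem_ball_zero_iff.mp hz, rfl⟩
  have hw' : w = t := ht.subset ⟨mem_ball_zero_iff.mp hw, hzw'.symm⟩
  rw [hz', hw']

omit [T2Space S] in
theorem IsDiskParam.exists_closedBall {g : ℂ → S} (hg : IsDiskParam g) {z : ℂ}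
    (hz : z ∈ ball (0 : ℂ) 1) {O : Set S} (hO : IsOpen O) (hzO : g z ∈ O) :
    ∃ r > 0, closedBall z r ⊆ ball 0 1 ∧ g '' closedBall z r ⊆ O := by
  have h1 := hg.continuousOn.isOpen_inter_preimage isOpen_ball hO
  obtain ⟨r, hr, hsub⟩ := Metric.nhds_basis_closedBall.mem_iff.mp (h1.mem_nhds ⟨hz, hzO⟩)
  exact ⟨r, hr, hsub.trans inter_subset_left, image_subset_iff.mpr (hsub.trans inter_subset_right)⟩

variable [LocallyConnectedSpace S] [ConnectedSpace S]

/-- Inverse branches over a disk whose iterated preimages in `U` avoid sets `V n` which contain all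
critical points in `U n`. -/
theorem IsBranchedSelfCovering.exists_sheet (hf : IsBranchedSelfCovering f d) (hd : 1 < d)
    {U V : ℕ → Set S} (hU : ∀ n, IsConformalDisk (U n))
    (hUc : ∀ n, ∃ s ∈ f ⁻¹' U n, U (n + 1) = connectedComponentIn (f ⁻¹' U n) s)
    (hV : ∀ n, V (n + 1) ⊆ f ⁻¹' V n) {N : ℕ}
    (hcrit : ∀ n ≥ N, ∀ c ∈ U n, IsCriticalPoint f c → c ∈ V n)
    {y : PlaqueInverseLimit f} (hy : y ∈ box f U) {g : ℂ → S} (hg : IsDiskParam g)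
    (hgU : g '' ball 0 1 = U N) {w : ℂ} {r : ℝ} (hr : closedBall w r ⊆ ball 0 1)
    (hgV : Disjoint (g '' ball w r) (V N)) (hyA : y.coord N ∈ g '' ball w r) :
    ∃ σ : S → PlaqueInverseLimit f, ContinuousOn σ (g '' ball w r) ∧
      (∀ t ∈ g '' ball w r, shift N (σ t) ∈ pullback (shift N y) (g '' ball w r)) ∧
      (∀ t ∈ g '' ball w r, (σ t).coord N = t) ∧
      ∀ z, shift N z ∈ pullback (shift N y) (g '' ball w r) → σ (z.coord N) = z := by
  have hrb : ball w r ⊆ ball 0 1 := ball_subset_closedBall.trans hr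
  set A := g '' ball w r
  have hAo : IsOpen A := hg.isOpen_image isOpen_ball hrb
  have hAc : IsPreconnected A :=
    (convex_ball w r).isPreconnected.image _ (hg.continuousOn.mono hrb)
  have hsub : ∀ n, pullbackLevel (shift N y) A n ⊆ U (N + n) := by
    refine pullbackLevel_shift_subset (W := fun n => U (N + n)) y hyA (fun n => ?_)
      ((image_mono hrb).trans hgU.subset)
    obtain ⟨s, -, hs⟩ := hUc (N + n)
    have h1 : y.coord (N + (n + 1)) ∈ U (N + n + 1) := hy (N + (n + 1))
    rw [hs] at h1
    exact hs.trans (connectedComponentIn_eq h1)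
  -- Since `f` maps `V (n + 1)` into `V n`, a disk disjoint from `V N` has all its pull-backs
  -- disjoint from the later `V n`, hence free of critical points.
  have hdis : ∀ n, Disjoint (pullbackLevel (shift N y) A n) (V (N + n)) := by
    intro n
    induction n with
    | zero => exact hgV.mono_left (connectedComponentIn_subset _ _)
    | succ n ih =>
      refine disjoint_left.mpr fun p hp hpV => disjoint_left.mp ih ?_ (hV (N + n) hpV)
      exact pullbackLevel_succ_subset _ _ n hp
  have hdisk : ∀ n, IsConformalDisk (pullbackLevel (shift N y) A n) := fun n =>
    hf.isConformalDisk_pullbackLevel (U := fun n => U (N + n)) (fun n => hU _)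
      (fun n => hUc (N + n)) (x := shift N y) (fun n => hy (N + n)) hg hgU hr hyA n
  obtain ⟨σ, h1, h2, h3, h4⟩ := exists_section hf.continuous (hf.isOpenMap hd)
    hf.proper.isClosedMap (shift N y) hAo hAc hyA fun n =>
      hf.injOn_of_not_isCriticalPoint (hdisk n) (hdisk (n + 1)) rfl fun c hc hcc =>
        disjoint_left.mp (hdis (n + 1)) hc
          (hcrit _ (Nat.le_add_right _ _) c (hsub (n + 1) hc) hcc)
  refine ⟨fun t => unshift N (σ t), (continuous_unshift hf.continuous N).comp_continuousOn h1,
    fun t ht => ?_, fun t ht => ?_, fun z hz => ?_⟩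
  · rw [shift_unshift]
    exact h2 t ht
  · change (shift N (unshift N (σ t))).coord 0 = t
    rw [shift_unshift]
    exact h3 t ht
  · change unshift N (σ ((shift N z).coord 0)) = z
    rw [h4 _ hz, unshift_shift]

variable [LocallyCompactSpace S]

/-- Points that leave the sets `V n` containing the critical points have disk neighbourhoods. -/
theorem IsBranchedSelfCovering.exists_disk_nhds (hf : IsBranchedSelfCovering f d) (hd : 1 < d)
    {U V : ℕ → Set S} (hU : ∀ n, IsConformalDisk (U n))
    (hUc : ∀ n, ∃ s ∈ f ⁻¹' U n, U (n + 1) = connectedComponentIn (f ⁻¹' U n) s)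
    (hV : ∀ n, V (n + 1) ⊆ f ⁻¹' V n) {N : ℕ}
    (hcrit : ∀ n ≥ N, ∀ c ∈ U n, IsCriticalPoint f c → c ∈ V n)
    {y : PlaqueInverseLimit f} (hy : y ∈ box f U) (hyV : y.coord N ∉ closure (V N))
    {W : Set (PlaqueInverseLimit f)} (hW : W ∈ 𝓝 y) :
    ∃ Δ, IsOpen Δ ∧ y ∈ Δ ∧ Δ ⊆ W ∧ IsPathConnected Δ ∧ IsConnected (Δ \ {y}) := by
  obtain ⟨g, g1, g2, hgU⟩ := hU N
  have hg : IsDiskParam g := ⟨g1, g2⟩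
  obtain ⟨w, hw, hwy⟩ := hgU.symm.subset (hy N)
  obtain ⟨r, hr0, hr, hrO⟩ := hg.exists_closedBall hw isClosed_closure.isOpen_compl
    (by rw [hwy]; exact hyV)
  have hrb : ball w r ⊆ ball 0 1 := ball_subset_closedBall.trans hr
  have hyA : y.coord N ∈ g '' ball w r := ⟨w, mem_ball_self hr0, hwy⟩
  have hAo : IsOpen (g '' ball w r) := hg.isOpen_image isOpen_ball hrb
  obtain ⟨σ, σc, σm, σN, σi⟩ := hf.exists_sheet hd hU hUc hV hcrit hy hg hgU hr
    (disjoint_left.mpr fun p hp hpV =>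
      hrO (image_mono ball_subset_closedBall hp) (subset_closure hpV)) hyA
  have hσy : σ (g w) = y := by
    rw [hwy]
    exact σi y fun n => coord_mem_pullbackLevel _ hyA n
  have hcont : ContinuousAt (fun z => σ (g z)) w :=
    ContinuousAt.comp (g := σ) (by rw [hwy]; exact σc.continuousAt (hAo.mem_nhds hyA))
      (hg.mdifferentiableAt hw).continuousAt
  have hWw : (fun z => σ (g z)) ⁻¹' W ∈ 𝓝 w := hcont (by simpa only [hσy] using hW)
  obtain ⟨r', hr'0, hr'⟩ := Metric.mem_nhds_iff.mp
    (inter_mem hWw (ball_mem_nhds w hr0))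
  have hr'r : ball w r' ⊆ ball w r := hr'.trans inter_subset_right
  have hcOn : ContinuousOn (fun z => σ (g z)) (ball w r') :=
    σc.comp (hg.continuousOn.mono (hr'r.trans hrb)) fun z hz => ⟨z, hr'r hz, rfl⟩
  -- Describing the sheet by conditions on continuous coordinates shows that it is open.
  have hΔ : (fun z => σ (g z)) '' ball w r' =
      shift N ⁻¹' pullback (shift N y) (g '' ball w r) ∩
        (fun z => z.coord N) ⁻¹' (g '' ball w r') := by
    ext z
    constructor
    · rintro ⟨t, ht, rfl⟩
      have ht' : g t ∈ g '' ball w r := ⟨t, hr'r ht, rfl⟩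
      exact ⟨σm _ ht', t, ht, (σN _ ht').symm⟩
    · rintro ⟨h1, t, ht, hzt⟩
      refine ⟨t, ht, ?_⟩
      simp only [hzt]
      exact σi z h1
  have hfin := hf.finite_fibre hd
  refine ⟨(fun z => σ (g z)) '' ball w r', ?_, ⟨w, mem_ball_self hr'0, hσy⟩, ?_, ?_, ?_⟩
  · rw [hΔ]
    exact ((isOpen_pullback _ hAo).preimage
      (continuous_shift hf.proper.isClosedMap hfin N)).inter
      ((hg.isOpen_image isOpen_ball (hr'r.trans hrb)).preimage
        (continuous_coord hf.proper.isClosedMap hfin N))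
  · exact image_subset_iff.mpr (hr'.trans inter_subset_left)
  · exact ((convex_ball w r').isPathConnected ⟨w, mem_ball_self hr'0⟩).image' hcOn
  · have := (isConnected_ball_sdiff_singleton w hr'0).image _ (hcOn.mono sdiff_subset)
    convert this using 1
    have hinj : InjOn (fun z => σ (g z)) (ball w r') := by
      intro a ha b hb hab
      have h1 := congrArg (fun z => z.coord N) hab
      simp only at h1
      rw [σN _ ⟨a, hr'r ha, rfl⟩, σN _ ⟨b, hr'r hb, rfl⟩] at h1
      exact g2 (hrb (hr'r ha)) (hrb (hr'r hb)) h1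
    rw [hinj.image_sdiff_subset (singleton_subset_iff.mpr (mem_ball_self hr'0)), image_singleton,
      hσy]

end Sheets

/-! ### Joining points to smaller neighborhoods -/

section Joining

variable {S : Type*} [TopologicalSpace S] [T2Space S] [LocallyConnectedSpace S]
  [LocallyCompactSpace S] [ConnectedSpace S] [ChartedSpace ℂ S] [IsManifold 𝓘(ℂ) ω S]
  {f : S → S} {d : ℕ}

/-- Every point of a pull-back of a connected open set along `x` can be joined, inside the
pull-back, to a smaller neighbourhood of `x`. -/
theorem IsBranchedSelfCovering.exists_joinedIn (hf : IsBranchedSelfCovering f d) (hd : 1 < d)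
    {U : ℕ → Set S} (hU : ∀ n, IsConformalDisk (U n))
    (hUc : ∀ n, ∃ s ∈ f ⁻¹' U n, U (n + 1) = connectedComponentIn (f ⁻¹' U n) s)
    {x : PlaqueInverseLimit f} (hx : x ∈ box f U)
    (hlocal : ∀ z ∈ box f U, z ≠ x → ∀ W ∈ 𝓝 z, ∃ Δ ∈ 𝓝 z, Δ ⊆ W ∧ IsPathConnected Δ)
    {A B₁ B₂ : Set S} (hA : IsOpen A) (hxA : x.coord 0 ∈ A)
    (hAU : ∀ n, pullbackLevel x A n ⊆ U n) (hB₁ : ∀ n, IsConformalDisk (pullbackLevel x B₁ n))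
    (hxB₂ : x.coord 0 ∈ B₂) (hB₁U : pullbackLevel x B₁ 0 ⊆ U 0)
    (hB : ∀ n, closure (pullbackLevel x B₂ n) ⊆ pullbackLevel x B₁ n) {N : ℕ}
    (hcrit : ∀ n ≥ N, ∀ c ∈ U n, IsCriticalPoint f c → c ∈ pullbackLevel x B₂ n)
    {y : PlaqueInverseLimit f} (hy : y ∈ pullback x A) :
    ∃ z ∈ pullback x B₁, JoinedIn (pullback x A) y z := by
  have hfin := hf.finite_fibre hd
  have hfcl := hf.proper.isClosedMap
  have : T2Space (PlaqueInverseLimit f) := t2Space hfcl hfin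
  set V := fun n => pullbackLevel x A n
  have hxV : x ∈ pullback x A := fun n => coord_mem_pullbackLevel x hxA n
  have hxB : ∀ n, x.coord n ∈ pullbackLevel x B₂ n := fun n => coord_mem_pullbackLevel x hxB₂ n
  have hUx : ∀ n, U (n + 1) = connectedComponentIn (f ⁻¹' U n) (x.coord (n + 1)) := by
    intro n
    obtain ⟨s, -, hs⟩ := hUc n
    have := hx (n + 1)
    rw [hs] at this
    exact hs.trans (connectedComponentIn_eq this)
  have hB₁U' : ∀ n, pullbackLevel x B₁ n ⊆ U n := by
    intro n
    induction n with
    | zero => exact hB₁U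
    | succ n ih =>
      rw [hUx]
      exact connectedComponentIn_mono _ (preimage_mono ih)
  -- The level of the pull-back of `B₁` contains all critical points of `U (n + 1)`, so it is the
  -- full preimage there.
  have hstay : ∀ n ≥ N, U (n + 1) ∩ f ⁻¹' pullbackLevel x B₁ n ⊆ pullbackLevel x B₁ (n + 1) :=
    fun n hn => hf.inter_preimage_subset (hU n) (hB₁ n) (hU (n + 1)) (hB₁ (n + 1)) (hUx n) rfl
      (hB₁U' n) fun c hc hcc => hB _ (subset_closure (hcrit (n + 1) (by omega) c hc hcc))
  -- For points of `box f U`, membership in the pull-back of `B₁` is decided at level `N`: higher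
  -- levels follow from `hstay`, lower ones by applying `f`.
  have hmem : ∀ z ∈ box f U, z.coord N ∈ pullbackLevel x B₁ N → z ∈ pullback x B₁ := by
    intro z hz hzN
    have h1 : ∀ k, z.coord (N + k) ∈ pullbackLevel x B₁ (N + k) := by
      intro k
      induction k with
      | zero => exact hzN
      | succ k ih =>
        refine hstay (N + k) (Nat.le_add_right _ _) ⟨hz (N + k + 1), ?_⟩
        rw [mem_preimage, show f (z.coord (N + (k + 1))) = _ from z.map_coord (N + k)]
        exact ih
    intro n
    have h2 := iterate_mem_pullbackLevel x B₁ n N (add_comm N n ▸ h1 n)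
    rwa [z.iterate_coord] at h2
  by_contra! hcon
  have hyx : y ≠ x := by
    rintro rfl
    exact hcon y (hmem y hx (hB _ (subset_closure (hxB N)))) (JoinedIn.refl hy)
  set Y := pathComponentIn (pullback x A \ {x}) y
  have hYsub : Y ⊆ pullback x A \ {x} := pathComponentIn_subset
  have hYU : ∀ z ∈ Y, z ∈ box f U := fun z hz n => hAU n ((hYsub hz).1 n)
  have hVo : IsOpen (pullback x A \ {x}) := (isOpen_pullback x hA).sdiff isClosed_singleton
  have hYo : IsOpen Y := by
    rw [isOpen_iff_mem_nhds]
    intro z hz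
    obtain ⟨Δ, hΔ, hΔs, hΔc⟩ := hlocal z (hYU z hz) (hYsub hz).2 _ (hVo.mem_nhds (hYsub hz))
    filter_upwards [hΔ] with w hw
    exact JoinedIn.trans hz ((hΔc.joinedIn z (mem_of_mem_nhds hΔ) w hw).mono hΔs)
  have hYN : ∀ z ∈ Y, z.coord N ∉ pullbackLevel x B₁ N := fun z hz hzN =>
    hcon z (hmem z (hYU z hz) hzN) (JoinedIn.mono hz sdiff_subset)
  set Z := (fun z : PlaqueInverseLimit f => z.coord N) '' Y
  have hZo : IsOpen Z := isOpenMap_coord hf.continuous (hf.isOpenMap hd) hfcl N _ hYo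
  have hyY : y ∈ Y := mem_pathComponentIn_self ⟨hy, hyx⟩
  -- `Z` is relatively closed in `V N`. A limit point `q` is outside the open `N`-th level of the
  -- pull-back of `B₁`, which `Z` avoids, hence off the closure of that of `B₂`. A sheet over a
  -- small disk around `q` then continues the path component to a point over `q`.
  have hVZ : V N ⊆ Z := by
    refine (isPreconnected_pullbackLevel x A N).subset_of_closure_inter_subset hZo
      ⟨y.coord N, hy N, y, hyY, rfl⟩ ?_
    rintro q ⟨hqZ, hqV⟩
    have hqB₁ : q ∉ pullbackLevel x B₁ N := by
      intro hq
      obtain ⟨_, hp, z, hz, rfl⟩ := mem_closure_iff.mp hqZ _ (hB₁ N).isOpen hq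
      exact hYN z hz hp
    obtain ⟨g, g1, g2, hgU⟩ := hU N
    have hg : IsDiskParam g := ⟨g1, g2⟩
    obtain ⟨w, hw, rfl⟩ := hgU.symm.subset (hAU N hqV)
    obtain ⟨r, hr0, hr, hrO⟩ := hg.exists_closedBall hw
      ((isOpen_pullbackLevel hf.continuous x hA N).sdiff
        (isClosed_closure (s := pullbackLevel x B₂ N))) ⟨hqV, fun h => hqB₁ (hB N h)⟩
    have hrb : ball w r ⊆ ball 0 1 := ball_subset_closedBall.trans hr
    have hrO' : g '' ball w r ⊆ V N \ closure (pullbackLevel x B₂ N) :=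
      (image_mono ball_subset_closedBall).trans hrO
    have hwA : g w ∈ g '' ball w r := ⟨w, mem_ball_self hr0, rfl⟩
    obtain ⟨_, hzA, z, hz, rfl⟩ := mem_closure_iff.mp hqZ _ (hg.isOpen_image isOpen_ball hrb) hwA
    obtain ⟨σ, σc, σm, σN, σi⟩ := hf.exists_sheet hd hU hUc
      (fun n => pullbackLevel_succ_subset x B₂ n) hcrit (hYU z hz) hg hgU hr
      (disjoint_left.mpr fun p hp hpB => (hrO' hp).2 (subset_closure hpB)) hzA
    have hσz : σ (z.coord N) = z := σi z fun n => coord_mem_pullbackLevel _ hzA n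
    have hpc : IsPathConnected (σ '' (g '' ball w r)) :=
      (((convex_ball w r).isPathConnected ⟨w, mem_ball_self hr0⟩).image'
        (hg.continuousOn.mono hrb)).image' σc
    have hlev : ∀ n, pullbackLevel (shift N z) (g '' ball w r) n ⊆ V (N + n) := by
      refine pullbackLevel_shift_subset (W := fun n => V (N + n)) z hzA (fun n => ?_)
        (hrO'.trans sdiff_subset)
      exact connectedComponentIn_eq ((hYsub hz).1 (N + n + 1))
    have hsub : σ '' (g '' ball w r) ⊆ pullback x A \ {x} := by
      rintro _ ⟨t, ht, rfl⟩
      refine ⟨fun n => ?_, fun h => ?_⟩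
      · have h1 : (σ t).coord (N + n) ∈ V (N + n) := hlev n (σm t ht n)
        rw [add_comm] at h1
        have h2 := iterate_mem_pullbackLevel x A n N h1
        rwa [(σ t).iterate_coord] at h2
      · have h1 := σN t ht
        rw [mem_singleton_iff.mp h] at h1
        exact (hrO' ht).2 (subset_closure (h1 ▸ hxB N))
    refine ⟨σ (g w), JoinedIn.trans hz ?_, σN _ hwA⟩
    exact (hpc.joinedIn z ⟨_, hzA, hσz⟩ _ ⟨_, hwA, rfl⟩).mono hsub
  obtain ⟨z, hz, hzx⟩ := hVZ (coord_mem_pullbackLevel x hxA N)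
  refine hYN z hz ?_
  rw [show z.coord N = x.coord N from hzx]
  exact hB _ (subset_closure (hxB N))

/-! ### Shrinking disks and stabilization of the indices -/

omit [LocallyConnectedSpace S] [LocallyCompactSpace S] [ConnectedSpace S] in
/-- A neighbourhood basis of the first coordinate of a point of a plaque, consisting of disks whose
pull-backs are plaques. -/
theorem IsBranchedSelfCovering.exists_disk_basis (hf : IsBranchedSelfCovering f d)
    {x : PlaqueInverseLimit f} (hplaque : ∃ P : Set (PlaqueInverseLimit f), IsPlaque f P ∧ x ∈ P) :
    ∃ D : ℕ → Set S, (∀ k n, IsConformalDisk (pullbackLevel x (D k) n)) ∧ (∀ k, IsOpen (D k)) ∧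
      (∀ k, x.coord 0 ∈ D k) ∧ Antitone D ∧ (∀ k, IsPreconnected (D k)) ∧
      (∀ k, closure (D (k + 1)) ⊆ D k) ∧ ∀ A ∈ 𝓝 (x.coord 0), ∃ k, D k ⊆ A := by
  obtain ⟨_, ⟨W, hW, hWc, rfl⟩, hx⟩ := hplaque
  obtain ⟨g, g1, g2, hgW⟩ := hW 0
  have hg : IsDiskParam g := ⟨g1, g2⟩
  obtain ⟨z, hz, hzx⟩ := hgW.symm.subset (hx 0)
  obtain ⟨R, hR0, hR, -⟩ := hg.exists_closedBall hz isOpen_univ (mem_univ _)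
  have hpos : ∀ k : ℕ, 0 < R / (k + 1) := fun k => by positivity
  have hle : ∀ k : ℕ, R / (k + 1) ≤ R := fun k =>
    div_le_self hR0.le (by linarith [k.cast_nonneg (α := ℝ)])
  have hcb : ∀ k : ℕ, closedBall z (R / (k + 1)) ⊆ ball 0 1 := fun k =>
    (closedBall_subset_closedBall (hle k)).trans hR
  have hb : ∀ k : ℕ, ball z (R / (k + 1)) ⊆ ball 0 1 := fun k =>
    ball_subset_closedBall.trans (hcb k)
  have hxD : ∀ k : ℕ, x.coord 0 ∈ g '' ball z (R / (k + 1)) := fun k =>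
    ⟨z, mem_ball_self (hpos k), hzx⟩
  refine ⟨fun k => g '' ball z (R / (k + 1)), fun k n => ?_, fun k => ?_, hxD, fun j k hjk => ?_,
    fun k => ?_, fun k => ?_, fun A hA => ?_⟩
  · exact hf.isConformalDisk_pullbackLevel hW hWc hx hg hgW (hcb k) (hxD k) n
  · exact hg.isOpen_image isOpen_ball (hb k)
  · exact image_mono (ball_subset_ball (by gcongr))
  · exact (convex_ball _ _).isPreconnected.image _ (hg.continuousOn.mono (hb k))
  · have hc : IsCompact (g '' closedBall z (R / ((k + 1 : ℕ) + 1))) :=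
      (isCompact_closedBall _ _).image_of_continuousOn (hg.continuousOn.mono (hcb _))
    refine (closure_minimal (image_mono ball_subset_closedBall) hc.isClosed).trans
      (image_mono (closedBall_subset_ball ?_))
    push_cast
    gcongr
    linarith
  · rw [← hzx] at hA
    obtain ⟨ε, hε, hεA⟩ := Metric.mem_nhds_iff.mp ((hg.mdifferentiableAt hz).continuousAt hA)
    obtain ⟨k, hk⟩ := exists_nat_gt (R / ε)
    refine ⟨k, image_subset_iff.mpr ((ball_subset_ball ?_).trans hεA)⟩
    rw [div_lt_iff₀ hε] at hk
    rw [div_le_iff₀ (by positivity)]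
    nlinarith

omit [LocallyCompactSpace S] in
/-- If the signatures have maximal elements, then from some neighbourhood on the indices are
constant. -/
theorem IsBranchedSelfCovering.exists_forall_criticalPoint_mem (hf : IsBranchedSelfCovering f d)
    (hd : 1 < d) {x : PlaqueInverseLimit f} {D : ℕ → Set S} (hDo : ∀ k, IsOpen (D k))
    (hxD : ∀ k, x.coord 0 ∈ D k) (hDanti : Antitone D)
    (hbasis : ∀ O, IsOpen O → x ∈ O → ∃ k, pullback x (D k) ⊆ O)
    (hmax : ∀ c : S, IsCriticalPoint f c → x.SignatureHasMax c) :
    ∃ K, ∀ k, ∃ N, ∀ n ≥ N, ∀ c ∈ pullbackLevel x (D K) n, IsCriticalPoint f c →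
      c ∈ pullbackLevel x (D k) n := by
  have hlev : ∀ k n, level (pullback x (D k)) n = pullbackLevel x (D k) n := fun k n =>
    level_pullback hf.continuous (hf.isOpenMap hd) hf.proper.isClosedMap x (hDo k) (hxD k) n
  have hc : ∀ c, ∃ K, IsCriticalPoint f c → ∀ k, ∀ᶠ n in cofinite,
      c ∈ pullbackLevel x (D K) n → c ∈ pullbackLevel x (D k) n := by
    intro c
    by_cases hc : IsCriticalPoint f c
    · obtain ⟨a, ha⟩ := hmax c hc
      rw [signature_eq_iInter_of_shrinking x c (fun k => pullback x (D k))
        (fun k => ⟨isOpen_pullback x (hDo k), fun n => coord_mem_pullbackLevel x (hxD k) n⟩)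
        hbasis] at ha
      simp only [index, hlev] at ha
      obtain ⟨K, hK⟩ := exists_forall_eventually_imp_of_germ
        (E := fun k n => c ∈ pullbackLevel x (D k) n)
        (fun j k n hjk h => pullbackLevel_mono x (hDanti hjk) n h) ⟨a, ha⟩
      exact ⟨K, fun _ => hK⟩
    · exact ⟨0, fun h => absurd h hc⟩
  choose κ hκ using hc
  have hfin := hf.finite_isCriticalPoint hd
  -- Each critical point has its own stabilization index; finiteness allows a common one.
  refine ⟨hfin.toFinset.sup κ, fun k => ?_⟩
  have h1 : ∀ᶠ n in cofinite, ∀ c ∈ {c | IsCriticalPoint f c},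
      c ∈ pullbackLevel x (D (κ c)) n → c ∈ pullbackLevel x (D k) n :=
    (eventually_all_finite hfin).mpr fun c hc => hκ c hc k
  rw [Nat.cofinite_eq_atTop, eventually_atTop] at h1
  obtain ⟨N, hN⟩ := h1
  refine ⟨N, fun n hn c hcn hc => hN n hn c hc ?_⟩
  exact pullbackLevel_mono x (hDanti (Finset.le_sup (hfin.mem_toFinset.mpr hc))) n hcn

end Joining

/-! ### Proof of the main theorem -/

theorem mainTheorem2 {S : Type*} [TopologicalSpace S] [T2Space S] [SecondCountableTopology S]
    [ChartedSpace ℂ S] [IsManifold 𝓘(ℂ) ω S] [SimplyConnectedSpace S]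
    (f : S → S) (d : ℕ) (hd : 1 < d) (hf : IsBranchedSelfCovering f d)
    (x : PlaqueInverseLimit f)
    (hplaque : ∃ P : Set (PlaqueInverseLimit f), PlaqueInverseLimit.IsPlaque f P ∧ x ∈ P)
    (hirr : x.IsIrregularPoint)
    (hmax : ∀ c : S, IsCriticalPoint f c → x.SignatureHasMax c) :
    ∃ U : Set (PlaqueInverseLimit f), PlaqueInverseLimit.IsPlaque f U ∧ IsOpen U ∧ x ∈ U ∧
      ∀ V : Set (PlaqueInverseLimit f), V ⊆ U → x ∈ V → IsOpen V →
        (PlaqueInverseLimit.IsPlaque f V ∨ IsConnected V) →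
        ∀ v ∈ V, v ≠ x → IsPathConnected (V \ {v}) := by
  have : LocallyConnectedSpace S := ChartedSpace.locallyConnectedSpace ℂ S
  have : LocallyCompactSpace S := ChartedSpace.locallyCompactSpace ℂ S
  have hfin := hf.finite_fibre hd
  have hfc := hf.continuous
  have hfo := hf.isOpenMap hd
  have hfcl := hf.proper.isClosedMap
  have : T2Space (PlaqueInverseLimit f) := t2Space hfcl hfin
  obtain ⟨D, hDdisk, hDo, hxD, hDanti, hDc, hDcl, hDbasis⟩ := hf.exists_disk_basis hplaque
  have hDpull : ∀ {j k}, j ≤ k → pullback x (D k) ⊆ pullback x (D j) := fun h z hz n =>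
    pullbackLevel_mono x (hDanti h) n (hz n)
  have hbasis : ∀ O ∈ 𝓝 x, ∃ k, pullback x (D k) ⊆ O := by
    intro O hO
    obtain ⟨O', hO'O, hO', hxO'⟩ := mem_nhds_iff.mp hO
    obtain ⟨A, hA, hxA, hAO⟩ := hO' x hxO'
    obtain ⟨k, hk⟩ := hDbasis A (hA.mem_nhds hxA)
    exact ⟨k, fun z hz => hO'O (hAO fun n => pullbackLevel_mono x hk n (hz n))⟩
  have hDnhds : ∀ k, pullback x (D k) ∈ 𝓝 x := fun k =>
    (isOpen_pullback x (hDo k)).mem_nhds fun n => coord_mem_pullbackLevel x (hxD k) n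
  obtain ⟨K, hK⟩ := hf.exists_forall_criticalPoint_mem hd hDo hxD hDanti
    (fun O hO hxO => hbasis O (hO.mem_nhds hxO)) hmax
  -- These are the levels of the required plaque: its critical points at high levels lie in every
  -- smaller pull-back, with a threshold that depends on the pull-back.
  set U : ℕ → Set S := pullbackLevel x (D K)
  have hU : ∀ n, IsConformalDisk (U n) := hDdisk K
  have hUc : ∀ n, ∃ s ∈ f ⁻¹' U n, U (n + 1) = connectedComponentIn (f ⁻¹' U n) s := by
    refine fun n => ⟨x.coord (n + 1), ?_, rfl⟩
    rw [mem_preimage, x.map_coord]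
    exact coord_mem_pullbackLevel x (hxD K) n
  have hxU : x ∈ box f U := fun n => coord_mem_pullbackLevel x (hxD K) n
  have hclosure : ∀ k n, closure (pullbackLevel x (D (k + 1)) n) ⊆ pullbackLevel x (D k) n :=
    fun k n => closure_pullbackLevel_subset hfc x (hDc _) (hDcl k) (hxD _) n
  have hlocal : ∀ z ∈ box f U, z ≠ x → ∀ W ∈ 𝓝 z, ∃ Δ, IsOpen Δ ∧ z ∈ Δ ∧ Δ ⊆ W ∧
      IsPathConnected Δ ∧ IsConnected (Δ \ {z}) := by
    intro z hz hzx W hW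
    obtain ⟨n, hn⟩ : ∃ n, z.coord n ≠ x.coord n := by
      by_contra! h
      exact hzx (PlaqueInverseLimit.ext (funext h))
    obtain ⟨O₁, O₂, hO₁, hO₂, hzO₁, hxO₂, hdis⟩ := t2_separation hn
    obtain ⟨B, hB, hxB, hBO⟩ := exists_pullbackLevel_subset hfcl hfin x n hO₂ hxO₂
    obtain ⟨k, hk⟩ := hDbasis B (hB.mem_nhds hxB)
    -- Once a coordinate of `z` is off the closure of a level of the small pull-back, all later ones
    -- are, because `f` maps the closure of each level into that of the preceding one. So the escape
    -- can be taken beyond the threshold of `hK k`.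
    have hzk : ∀ m, z.coord (n + m) ∉ closure (pullbackLevel x (D k) (n + m)) := by
      intro m
      induction m with
      | zero =>
        intro h
        obtain ⟨p, hp1, hp2⟩ := mem_closure_iff.mp h O₁ hO₁ hzO₁
        exact disjoint_left.mp hdis hp1 (hBO (pullbackLevel_mono x hk n hp2))
      | succ m ih =>
        intro h
        refine ih ?_
        rw [← z.map_coord]
        exact closure_mono (image_subset_iff.mpr (pullbackLevel_succ_subset x (D k) (n + m)))
          (image_closure_subset_closure_image hfc ⟨_, h, rfl⟩)
    obtain ⟨N, hN⟩ := hK k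
    exact hf.exists_disk_nhds hd hU hUc (fun n => pullbackLevel_succ_subset x (D k) n)
      (fun m hm => hN m ((Nat.le_add_left N n).trans hm)) hz (hzk N) hW
  -- A point is joined successively to smaller and smaller pull-backs, and the concatenated paths
  -- converge to `x`.
  have hpath : ∀ A, IsOpen A → x.coord 0 ∈ A → (∀ n, pullbackLevel x A n ⊆ U n) →
      IsPathConnected (pullback x A) := by
    intro A hA hxA hAU
    have hG : ∀ A, IsOpen A → x.coord 0 ∈ A → (∀ n, pullbackLevel x A n ⊆ U n) → ∀ j,
        ∀ y ∈ pullback x A, ∃ z ∈ pullback x (D (K + j)), JoinedIn (pullback x A) y z := by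
      intro A hA hxA hAU j y hy
      obtain ⟨N, hN⟩ := hK (K + j + 1)
      refine hf.exists_joinedIn hd hU hUc hxU (fun z hz hzx W hW => ?_) hA hxA hAU
        (hDdisk (K + j)) (hxD (K + j + 1)) (pullbackLevel_mono x (hDanti (Nat.le_add_right _ _)) 0)
        (hclosure (K + j)) hN hy
      obtain ⟨Δ, h1, h2, h3, h4, -⟩ := hlocal z hz hzx W hW
      exact ⟨Δ, h1.mem_nhds h2, h3, h4⟩
    obtain ⟨m, hm⟩ := hDbasis A (hA.mem_nhds hxA)
    -- The sequence starts at `A` itself. The later index `K + (m + k)` keeps its disks both in `D m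
    -- ⊆ A` and in `D K`.
    set A' : ℕ → Set S := fun k => Nat.casesOn k A fun k => D (K + (m + k)) with hA'
    have hA'o : ∀ k, IsOpen (A' k) := fun k => by cases k; exacts [hA, hDo _]
    have hxA' : ∀ k, x.coord 0 ∈ A' k := fun k => by cases k; exacts [hxA, hxD _]
    have hA'U : ∀ k n, pullbackLevel x (A' k) n ⊆ U n := fun k n => by
      cases k
      exacts [hAU n, pullbackLevel_mono x (hDanti (Nat.le_add_right _ _)) n]
    have hA'anti : Antitone A' := by
      refine antitone_nat_of_succ_le fun k => ?_
      cases k with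
      | zero => exact (hDanti (by omega)).trans hm
      | succ k => exact hDanti (by omega)
    have hstep : ∀ (k : ℕ) (y : PlaqueInverseLimit f), ∃ z, y ∈ pullback x (A' k) →
        z ∈ pullback x (A' (k + 1)) ∧ JoinedIn (pullback x (A' k)) y z := by
      intro k y
      by_cases hy : y ∈ pullback x (A' k)
      · obtain ⟨z, hz, hyz⟩ := hG (A' k) (hA'o k) (hxA' k) (hA'U k) (m + k) y hy
        exact ⟨z, fun _ => ⟨hz, hyz⟩⟩
      · exact ⟨y, fun h => absurd h hy⟩
    choose nxt hnxt using hstep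
    have hxA'p : x ∈ pullback x A := fun n => coord_mem_pullbackLevel x hxA n
    refine ⟨x, hxA'p, fun {y} hy => JoinedIn.symm ?_⟩
    set u : ℕ → PlaqueInverseLimit f := fun k => Nat.rec y nxt k
    have hu : ∀ k, u k ∈ pullback x (A' k) := by
      intro k
      induction k with
      | zero => exact hy
      | succ k ih => exact (hnxt k _ ih).1
    refine joinedIn_of_antitone_basis (V := fun k => pullback x (A' k)) (y := u)
      (fun j k hjk z hz n => pullbackLevel_mono x (hA'anti hjk) n (hz n)) hxA'p (fun O hO => ?_)
      fun k => (hnxt k _ (hu k)).2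
    obtain ⟨k, hk⟩ := hbasis O hO
    exact ⟨k + 1, (hDpull (by omega)).trans hk⟩
  have hlocx : ∀ O ∈ 𝓝 x, ∃ Δ ∈ 𝓝 x, Δ ⊆ O ∧ IsPathConnected Δ := by
    intro O hO
    obtain ⟨k, hk⟩ := hbasis O hO
    exact ⟨_, hDnhds (K + k), (hDpull (by omega)).trans hk, hpath _ (hDo _) (hxD _) fun n =>
      pullbackLevel_mono x (hDanti (Nat.le_add_right _ _)) n⟩
  refine ⟨pullback x (D K), ⟨U, hU, hUc, rfl⟩, isOpen_pullback x (hDo K), hxU, ?_⟩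
  intro V hVU hxV hVo hV v hv hvx
  have hVc : IsConnected V := by
    rcases hV with ⟨W, hW, hWc, rfl⟩ | hV
    · have hWeq : W = pullbackLevel x (W 0) :=
        funext (eq_pullbackLevel (hW 0).isConnected.isPreconnected hWc hxV)
      have hbox : box f W = pullback x (W 0) := congrArg (box f) hWeq
      rw [hbox] at hVU ⊢
      refine (hpath (W 0) (hW 0).isOpen (hxV 0) fun n => ?_).isConnected
      rw [← level_pullback hfc hfo hfcl x (hW 0).isOpen (hxV 0)]
      exact (image_mono hVU).trans (level_pullback hfc hfo hfcl x (hDo K) (hxD K) n).subset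
    · exact hV
  -- `v` has a neighborhood in `V` that stays connected without `v`, so the punctured `V` is
  -- connected. It is open and has small path-connected neighborhoods at every point: pull-backs at
  -- `x`, disks elsewhere.
  obtain ⟨Δ, hΔo, hvΔ, hΔV, -, hΔc⟩ := hlocal v (hVU hv) hvx V (hVo.mem_nhds hv)
  refine (hVc.sdiff_singleton_of_local hv hΔo hvΔ hΔV hΔc).isPathConnected_of_local fun y hy => ?_
  have hO : V \ {v} ∈ 𝓝 y := (hVo.sdiff isClosed_singleton).mem_nhds hy
  by_cases hyx : y = x
  · subst hyx
    exact hlocx _ hO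
  · obtain ⟨Δ, h1, h2, h3, h4, -⟩ := hlocal y (hVU hy.1) hyx _ hO
    exact ⟨Δ, h1.mem_nhds h2, h3, h4⟩
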